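/- Let $K$ be an algebraically closed field of characteristic $0$ (purely even). A quadratic form $q$ on a super vector space $V=V_{\bar 0}\oplus V_{\bar 1}$ over $K$ is an even supersymmetric bilinear form; $\operatorname{osp}(q)$ is the Lie superalgebra (under the supercommutator) of all $x\in\operatorname{End}_K V$ with $q(x(u),v)+(-1)^{|u||v|}q(x(v),u)=0$ for all homogeneous $u,v$, and $\operatorname{eosp}(q)$ is the $\mathbb Z$-span of the maps $\mathbf E_{u,v}(p)=u\,q(v,p)-(-1)^{|v||p|}q(u,p)\,v$, for homogeneous $u,v$. For nondegenerate $q$ on a space of dimension $(M\,|\,2n)$, i.e. $\dim V_{\bar 0}=M$, $\dim V_{\bar 1}=2n$, one writes $\operatorname{osp}(M,2n)=\operatorname{osp}(q)$. Let $m,n\ge 1$ be integers. (1) Let $q$ be the orthogonal sum of the hyperbolic form on the even space with basis $h_{\pm1},\dots,h_{\pm m}$ (with $q(h_i,h_{-i})=q(h_{-i},h_i)=1$, all other values $0$) and the symplectic form on the odd space with basis $k_{\pm1},\dots,k_{\pm n}$ (with $q(k_j,k_{-j})=1=-q(k_{-j},k_j)$, all other values $0$), and let $q_0$ be the form on an even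 line $Km_0$ with $q_0(m_0,m_0)=1$. Then $\operatorname{eosp}(q)=\operatorname{osp}(2m,2n)$ and $\operatorname{eosp}(q\oplus q_0)=\operatorname{osp}(2m+1,2n)$. Precisely: $q$ and $q\oplus q_0$ are nondegenerate on spaces of dimension $(2m\,|\,2n)$ and $(2m+1\,|\,2n)$, $\operatorname{eosp}(q)=\operatorname{osp}(q)$ and $\operatorname{eosp}(q\oplus q_0)=\operatorname{osp}(q\oplus q_0)$, and for every other nondegenerate quadratic form $r$ on a super vector space of the same dimension there is an even linear isometry, conjugation by which maps $\operatorname{eosp}(q)$ (respectively $\operatorname{eosp}(q\oplus q_0)$) onto $\operatorname{osp}(r)$. (2) Let $L=\operatorname{osp}(m,2n)$ (for any nondegenerate quadratic form on a super vector space of dimension $(m\,|\,2n)$), and let $A$ be a superextension of $K$, that is, a unital associative supercommutative $K$-superalgebra. Let $L\otimes A=L\otimes_K A$ have the bracket $[x\otimes a,y\otimes b]=(-1)^{|a||y|}[x,y]\otimes ab$. Then $\operatorname{Der}_K(L\otimes A)\cong\operatorname{ad}(L\otimes A)\rtimes\operatorname{Der}_K A$. Precisely: $\Delta\mapsto\bigl(x\otimes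 a\mapsto(-1)^{|\Delta||x|}x\otimes\Delta(a)\bigr)$ is an injective homomorphism of Lie superalgebras from $\operatorname{Der}_K A$ to $\operatorname{Der}_K(L\otimes A)$, and $\operatorname{Der}_K(L\otimes A)$ is the semidirect product of the ideal $\operatorname{ad}(L\otimes A)$ and the image of this homomorphism. Here $\operatorname{Der}_K=(\operatorname{Der}_K)_{\bar 0}\oplus(\operatorname{Der}_K)_{\bar 1}$ consists of the superderivations, $d(xy)=d(x)y+(-1)^{|d||x|}x\,d(y)$. In particular $L$ has no outer derivations: $\operatorname{Der}_K L=\operatorname{ad}L$. -/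

import Mathlib

open scoped TensorProduct

universe u v w

namespace Super

noncomputable section

/-! ### Super vector spaces

A super vector space is a vector space with a decomposition indexed by `ZMod 2`. The base field is
purely even. -/

/-- The sign `(-1) ^ (α β)` of two degrees. -/
def sgn (α β : ZMod 2) : ℤ := if α = 1 ∧ β = 1 then -1 else 1

section Gradings

variable {K : Type*} [Field K] {X : Type*} [AddCommGroup X] [Module K X]

/-- A grading from a complete system of projections. -/
abbrev decompositionOfProj (𝒳 : ZMod 2 → Submodule K X) (P : ZMod 2 → X →ₗ[K] X)
    (hmem : ∀ α x, P α x ∈ 𝒳 α) (hsame : ∀ α, ∀ x ∈ 𝒳 α, P α x = x)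
    (hne : ∀ α β, ∀ x ∈ 𝒳 α, α ≠ β → P β x = 0) (hsum : ∀ x, ∑ α, P α x = x) :
    DirectSum.Decomposition 𝒳 :=
  DirectSum.Decomposition.ofLinearMap 𝒳
    (∑ α, DirectSum.lof K (ZMod 2) (fun i => 𝒳 i) α ∘ₗ (P α).codRestrict (𝒳 α) (hmem α))
    (by
      ext x
      simp [map_sum, hsum])
    (by
      ext α x : 2
      simp only [LinearMap.comp_apply, LinearMap.sum_apply, DirectSum.coeLinearMap_lof,
        LinearMap.id_apply]
      rw [Finset.sum_eq_single α]
      · congr 1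
        exact Subtype.ext (hsame α x x.2)
      · intro β _ hβ
        have : (P β).codRestrict (𝒳 β) (hmem β) (x : X) = 0 :=
          Subtype.ext (hne α β x x.2 hβ.symm)
        rw [this, map_zero]
      · simp)

/-- The projection of a super vector space onto its homogeneous part of degree `α`. -/
def part (𝒳 : ZMod 2 → Submodule K X) [DirectSum.Decomposition 𝒳] (α : ZMod 2) : X →ₗ[K] X :=
  (𝒳 α).subtype ∘ₗ DirectSum.component K (ZMod 2) (fun i => 𝒳 i) α ∘ₗ
    (DirectSum.decomposeLinearEquiv 𝒳).toLinearMap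

variable (𝒳 : ZMod 2 → Submodule K X) [DirectSum.Decomposition 𝒳]

theorem part_apply (α : ZMod 2) (x : X) : part 𝒳 α x = DirectSum.decompose 𝒳 x α := rfl

theorem part_mem (α : ZMod 2) (x : X) : part 𝒳 α x ∈ 𝒳 α := (DirectSum.decompose 𝒳 x α).2

theorem part_same {α : ZMod 2} {x : X} (hx : x ∈ 𝒳 α) : part 𝒳 α x = x :=
  DirectSum.decompose_of_mem_same 𝒳 hx

theorem part_ne {α β : ZMod 2} {x : X} (hx : x ∈ 𝒳 α) (h : α ≠ β) : part 𝒳 β x = 0 :=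
  DirectSum.decompose_of_mem_ne 𝒳 hx h

theorem sum_part (x : X) : ∑ α, part 𝒳 α x = x := by
  classical
  conv_rhs => rw [← DirectSum.sum_support_decompose 𝒳 x]
  symm
  apply Finset.sum_subset (Finset.subset_univ _)
  intro α _ hα
  simpa using hα

/-- The endomorphisms of degree `α`. -/
def endGrading (𝒳 : ZMod 2 → Submodule K X) (α : ZMod 2) : Submodule K (Module.End K X) where
  carrier := {f | ∀ β, ∀ x ∈ 𝒳 β, f x ∈ 𝒳 (α + β)}
  add_mem' hf hg β x hx := add_mem (hf β x hx) (hg β x hx)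
  zero_mem' _ _ _ := zero_mem _
  smul_mem' c _ hf β x hx := Submodule.smul_mem _ c (hf β x hx)

/-- The component of degree `α` of an endomorphism. -/
def endPart (α : ZMod 2) : Module.End K X →ₗ[K] Module.End K X where
  toFun f := ∑ β, part 𝒳 (α + β) ∘ₗ f ∘ₗ part 𝒳 β
  map_add' f g := by
    ext x
    simp [LinearMap.sum_apply, Finset.sum_add_distrib]
  map_smul' c f := by
    ext x
    simp [LinearMap.sum_apply, Finset.smul_sum]

theorem endPart_apply_of_mem (α : ZMod 2) (f : Module.End K X) {β : ZMod 2} {x : X}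
    (hx : x ∈ 𝒳 β) : endPart 𝒳 α f x = part 𝒳 (α + β) (f x) := by
  simp only [endPart, LinearMap.coe_mk, AddHom.coe_mk, LinearMap.sum_apply, LinearMap.comp_apply]
  rw [Finset.sum_eq_single β]
  · rw [part_same 𝒳 hx]
  · intro γ _ hγ
    rw [part_ne 𝒳 hx hγ.symm, map_zero, map_zero]
  · simp

theorem end_ext {Y : Type*} [AddCommGroup Y] [Module K Y] {f g : X →ₗ[K] Y}
    (h : ∀ β, ∀ x ∈ 𝒳 β, f x = g x) : f = g := by
  ext x
  rw [← sum_part 𝒳 x, map_sum, map_sum]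
  exact Finset.sum_congr rfl fun β _ => h β _ (part_mem 𝒳 β x)

instance endDecomposition : DirectSum.Decomposition (endGrading 𝒳) :=
  decompositionOfProj (endGrading 𝒳) (endPart 𝒳)
    (by
      intro α f β x hx
      rw [endPart_apply_of_mem 𝒳 α f hx]
      exact part_mem 𝒳 _ _)
    (by
      intro α f hf
      refine end_ext 𝒳 fun β x hx => ?_
      rw [endPart_apply_of_mem 𝒳 α f hx, part_same 𝒳 (hf β x hx)])
    (by
      intro α β f hf h
      refine end_ext 𝒳 fun γ x hx => ?_
      rw [endPart_apply_of_mem 𝒳 β f hx, part_ne 𝒳 (hf γ x hx) (by simpa using h)]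
      rfl)
    (by
      intro f
      refine end_ext 𝒳 fun γ x hx => ?_
      rw [LinearMap.sum_apply]
      simp only [endPart_apply_of_mem 𝒳 _ f hx]
      exact (Fintype.sum_equiv (Equiv.addRight γ) (fun α => part 𝒳 (α + γ) (f x))
        (fun α => part 𝒳 α (f x)) fun _ => rfl).trans (sum_part 𝒳 (f x)))

theorem part_end (α : ZMod 2) (f : Module.End K X) :
    part (endGrading 𝒳) α f = endPart 𝒳 α f := by
  have key : ∀ β, ∀ g ∈ endGrading 𝒳 β,
      part (endGrading 𝒳) α g = endPart 𝒳 α g := by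
    intro β g hg
    refine end_ext 𝒳 fun γ x hx => ?_
    rw [endPart_apply_of_mem 𝒳 α g hx]
    by_cases h : β = α
    · subst h
      rw [part_same _ hg, part_same 𝒳 (hg γ x hx)]
    · rw [part_ne _ hg h, part_ne 𝒳 (hg γ x hx) (by simpa using h)]
      rfl
  exact LinearMap.congr_fun (end_ext (endGrading 𝒳) key) f

/-- The super commutator: `[f, g] = f g - (-1) ^ (|f| |g|) g f` for homogeneous `f` and `g`. -/
def superBracket : Module.End K X →ₗ[K] Module.End K X →ₗ[K] Module.End K X :=
  LinearMap.mul K (Module.End K X) - ∑ α, ∑ β, sgn α β •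
    (LinearMap.mul K (Module.End K X)).flip.compl₁₂
      (part (endGrading 𝒳) α) (part (endGrading 𝒳) β)

theorem superBracket_of_mem {α β : ZMod 2} {f g : Module.End K X} (hf : f ∈ endGrading 𝒳 α)
    (hg : g ∈ endGrading 𝒳 β) : superBracket 𝒳 f g = f * g - sgn α β • (g * f) := by
  simp only [superBracket, LinearMap.sub_apply, LinearMap.sum_apply, LinearMap.smul_apply,
    LinearMap.compl₁₂_apply, LinearMap.flip_apply, LinearMap.mul_apply']
  congr 1
  rw [Finset.sum_eq_single α, Finset.sum_eq_single β]
  · rw [part_same _ hf, part_same _ hg]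
  · intro γ _ hγ
    rw [part_ne _ hg hγ.symm, zero_mul, smul_zero]
  · simp
  · intro γ _ hγ
    refine Finset.sum_eq_zero fun δ _ => ?_
    rw [part_ne _ hf hγ.symm, mul_zero, smul_zero]
  · simp

/-- The derivations of degree `α` of a superalgebra with underlying super vector space `𝒳` and
multiplication `μ`: the maps `d` of degree `α` with
`d (x y) = d x y + (-1) ^ (α |x|) x (d y)` for homogeneous `x` and all `y`. -/
def derDeg (𝒳 : ZMod 2 → Submodule K X) (μ : X →ₗ[K] X →ₗ[K] X) (α : ZMod 2) :
    Submodule K (Module.End K X) where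
  carrier := {d | d ∈ endGrading 𝒳 α ∧ ∀ β, ∀ x ∈ 𝒳 β, ∀ y,
    d (μ x y) = μ (d x) y + sgn α β • μ x (d y)}
  add_mem' := by
    rintro d e ⟨hd, hd'⟩ ⟨he, he'⟩
    refine ⟨add_mem hd he, fun β x hx y => ?_⟩
    simp only [LinearMap.add_apply, hd' β x hx y, he' β x hx y, map_add, smul_add]
    abel
  zero_mem' := ⟨zero_mem _, fun β x _ y => by simp⟩
  smul_mem' := by
    rintro c d ⟨hd, hd'⟩
    refine ⟨Submodule.smul_mem _ c hd, fun β x hx y => ?_⟩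
    simp only [LinearMap.smul_apply, hd' β x hx y, map_smul, smul_add, smul_comm c (sgn α β)]

/-- The space of derivations, the sum of its homogeneous parts. -/
def der (𝒳 : ZMod 2 → Submodule K X) (μ : X →ₗ[K] X →ₗ[K] X) : Submodule K (Module.End K X) :=
  ⨆ α, derDeg 𝒳 μ α

/-- The maps `ad x = [x, ·]`. -/
def inner (μ : X →ₗ[K] X →ₗ[K] X) : Submodule K (Module.End K X) := LinearMap.range μ

/-- A graded subspace of `End X` closed under the super commutator. -/
structure IsSubalgebra (D : Submodule K (Module.End K X)) : Prop where
  graded : ∀ α, ∀ d ∈ D, part (endGrading 𝒳) α d ∈ D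
  bracket_mem : ∀ d ∈ D, ∀ e ∈ D, superBracket 𝒳 d e ∈ D

/-- The Lie superalgebra `D` of endomorphisms of `X` is the semidirect product `I ⋊ S` of its ideal
`I` and its subalgebra `S`. -/
structure IsSemidirect (D I S : Submodule K (Module.End K X)) : Prop where
  subalgebra : IsSubalgebra 𝒳 D
  ideal_subalgebra : IsSubalgebra 𝒳 I
  ideal : ∀ d ∈ D, ∀ e ∈ I, superBracket 𝒳 d e ∈ I
  complement_subalgebra : IsSubalgebra 𝒳 S
  disjoint : I ⊓ S = ⊥
  sup_eq : I ⊔ S = D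

/-- `Φ` restricts to an injective homomorphism of Lie superalgebras on the Lie superalgebra `D` of
endomorphisms of `X`. -/
structure IsEmbedding {Y : Type*} [AddCommGroup Y] [Module K Y] (D : Submodule K (Module.End K X))
    (𝒴 : ZMod 2 → Submodule K Y) [DirectSum.Decomposition 𝒴]
    (Φ : Module.End K X →ₗ[K] Module.End K Y) : Prop where
  even : ∀ α, ∀ d ∈ D, d ∈ endGrading 𝒳 α → Φ d ∈ endGrading 𝒴 α
  bracket : ∀ d ∈ D, ∀ e ∈ D, Φ (superBracket 𝒳 d e) = superBracket 𝒴 (Φ d) (Φ e)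
  injective : ∀ d ∈ D, Φ d = 0 → d = 0

end Gradings

/-! ### Quadratic forms and orthosymplectic Lie superalgebras -/

section Osp

variable {K : Type*} [Field K] {V : Type*} [AddCommGroup V] [Module K V]

/-- A quadratic form on a super vector space: an even supersymmetric bilinear form. -/
structure QuadForm (𝒱 : ZMod 2 → Submodule K V) where
  bilin : V →ₗ[K] V →ₗ[K] K
  even : ∀ α β, ∀ u ∈ 𝒱 α, ∀ v ∈ 𝒱 β, α ≠ β → bilin u v = 0
  supersymm : ∀ α β, ∀ u ∈ 𝒱 α, ∀ v ∈ 𝒱 β, bilin u v = sgn α β • bilin v u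

variable {𝒱 : ZMod 2 → Submodule K V}

/-- A form is nondegenerate if its radical is zero. -/
def QuadForm.Nondegenerate (q : QuadForm 𝒱) : Prop :=
  ∀ u, (∀ v, q.bilin u v = 0) → u = 0

/-- The endomorphisms `x` with `q (x u) v + (-1) ^ (|u| |v|) q (x v) u = 0`. -/
def osp (q : QuadForm 𝒱) : Submodule K (Module.End K V) where
  carrier := {x | ∀ α β, ∀ u ∈ 𝒱 α, ∀ v ∈ 𝒱 β,
    q.bilin (x u) v + sgn α β • q.bilin (x v) u = 0}
  add_mem' := by
    intro x y hx hy α β u hu v hv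
    have h := congrArg₂ (· + ·) (hx α β u hu v hv) (hy α β u hu v hv)
    simp only [add_zero] at h
    rw [← h]
    simp only [LinearMap.add_apply, map_add, smul_add]
    abel
  zero_mem' := by
    intro α β u _ v _
    simp
  smul_mem' := by
    intro c x hx α β u hu v hv
    have h := congrArg (c • ·) (hx α β u hu v hv)
    simp only [smul_zero, smul_add, smul_comm c (sgn α β)] at h
    simpa only [LinearMap.smul_apply, map_smul] using h

theorem osp_homogeneous (q : QuadForm 𝒱) {α : ZMod 2} {x : Module.End K V}
    (hx : x ∈ endGrading 𝒱 α) :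
    x ∈ osp q ↔ ∀ μ ν, ∀ u ∈ 𝒱 μ, ∀ v ∈ 𝒱 ν,
      q.bilin (x u) v + sgn α μ • q.bilin u (x v) = 0 := by
  refine forall_congr' fun μ => forall_congr' fun ν => forall_congr' fun u =>
    forall_congr' fun hu => forall_congr' fun v => forall_congr' fun hv => ?_
  have hs : ∀ α μ ν : ZMod 2, sgn μ ν * sgn (α + ν) μ = sgn α μ := by decide
  rw [q.supersymm (α + ν) μ (x v) (hx ν v hv) u hu, smul_smul, hs]

variable [DirectSum.Decomposition 𝒱]

/-- The map `E u v`, with `E u v w = q (v, w) u - (-1) ^ (|v| |w|) q (u, w) v`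
for homogeneous `v` and `w`. -/
def elemE (q : QuadForm 𝒱) (u v : V) : Module.End K V :=
  (q.bilin v).smulRight u -
    ∑ α, ∑ β, sgn α β • (q.bilin u ∘ₗ part 𝒱 β).smulRight (part 𝒱 α v)

theorem elemE_apply_of_mem (q : QuadForm 𝒱) (u : V) {α β : ZMod 2} {v w : V}
    (hv : v ∈ 𝒱 α) (hw : w ∈ 𝒱 β) :
    elemE q u v w = q.bilin v w • u - sgn α β • (q.bilin u w • v) := by
  simp only [elemE, LinearMap.sub_apply, LinearMap.sum_apply, LinearMap.smul_apply,
    LinearMap.smulRight_apply, LinearMap.comp_apply]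
  congr 1
  rw [Finset.sum_eq_single α, Finset.sum_eq_single β]
  · rw [part_same _ hv, part_same _ hw]
  · intro γ _ hγ
    rw [part_ne _ hw hγ.symm, map_zero, zero_smul, smul_zero]
  · simp
  · intro γ _ hγ
    refine Finset.sum_eq_zero fun δ _ => ?_
    rw [part_ne _ hv hγ.symm, smul_zero, smul_zero]
  · simp

/-- The `ℤ`-span of the maps `E u v` for homogeneous `u` and `v`. -/
def eosp (q : QuadForm 𝒱) : AddSubgroup (Module.End K V) :=
  AddSubgroup.closure {x | ∃ α β, ∃ u ∈ 𝒱 α, ∃ v ∈ 𝒱 β, x = elemE q u v}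

/-! `osp q` is graded and closed under the super commutator. -/

theorem osp_part_mem (q : QuadForm 𝒱) {x : Module.End K V} (hx : x ∈ osp q) (α : ZMod 2) :
    part (endGrading 𝒱) α x ∈ osp q := by
  have key : ∀ μ ν, ∀ u ∈ 𝒱 μ, ∀ v ∈ 𝒱 ν, q.bilin (endPart 𝒱 α x u) v =
      if α + μ = ν then q.bilin (x u) v else 0 := by
    intro μ ν u hu v hv
    rw [endPart_apply_of_mem 𝒱 α x hu]
    split_ifs with h
    · conv_rhs => rw [← sum_part 𝒱 (x u), map_sum, LinearMap.sum_apply]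
      rw [Finset.sum_eq_single (α + μ)]
      · intro γ _ hγ
        exact q.even γ ν _ (part_mem _ _ _) v hv (by rwa [← h])
      · simp
    · exact q.even _ _ _ (part_mem _ _ _) v hv h
  intro μ ν u hu v hv
  rw [part_end, key μ ν u hu v hv, key ν μ v hv u hu]
  have h2 : ∀ α μ ν : ZMod 2, (α + ν = μ) = (α + μ = ν) := by decide
  simp only [h2 α μ ν]
  split_ifs
  · exact hx μ ν u hu v hv
  · simp

theorem superBracket_mem_osp (q : QuadForm 𝒱) {x y : Module.End K V} (hx : x ∈ osp q)
    (hy : y ∈ osp q) : superBracket 𝒱 x y ∈ osp q := by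
  have key : ∀ α β, ∀ x ∈ endGrading 𝒱 α, ∀ y ∈ endGrading 𝒱 β, x ∈ osp q → y ∈ osp q →
      superBracket 𝒱 x y ∈ osp q := by
    intro α β x hx y hy hxq hyq
    rw [superBracket_of_mem 𝒱 hx hy]
    have hmem : x * y - sgn α β • (y * x) ∈ endGrading 𝒱 (α + β) := by
      refine sub_mem ?_ (zsmul_mem ?_ _)
      · intro γ v hv
        rw [add_assoc]
        exact hx _ _ (hy _ _ hv)
      · intro γ v hv
        rw [add_comm α, add_assoc]
        exact hy _ _ (hx _ _ hv)
    rw [osp_homogeneous q hx] at hxq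
    rw [osp_homogeneous q hy] at hyq
    rw [osp_homogeneous q hmem]
    intro μ ν u hu v hv
    have h1 := hxq (β + μ) ν (y u) (hy _ _ hu) v hv
    have h2 := hyq μ (α + ν) u hu (x v) (hx _ _ hv)
    have h3 := hyq (α + μ) ν (x u) (hx _ _ hu) v hv
    have h4 := hxq μ (β + ν) u hu (y v) (hy _ _ hv)
    simp only [LinearMap.sub_apply, Module.End.mul_apply, map_sub, zsmul_eq_mul] at h1 h2 h3 h4 ⊢
    have hz : ∀ γ : ZMod 2, γ = 0 ∨ γ = 1 := by decide
    have e : (1 : ZMod 2) + 1 = 0 := by decide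
    rcases hz α with rfl | rfl <;> rcases hz β with rfl | rfl <;> rcases hz μ with rfl | rfl <;>
      simp [sgn, e] at h1 h2 h3 h4 ⊢ <;> grind
  rw [← sum_part (endGrading 𝒱) x, ← sum_part (endGrading 𝒱) y]
  simp only [map_sum, LinearMap.sum_apply]
  exact sum_mem fun α _ => sum_mem fun β _ => key _ _ _ (part_mem _ _ _) _ (part_mem _ _ _)
    (osp_part_mem q hx _) (osp_part_mem q hy _)

/-- The homogeneous parts of `osp q`. -/
def ospGrading (q : QuadForm 𝒱) (α : ZMod 2) : Submodule K (osp q) :=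
  (endGrading 𝒱 α).comap (osp q).subtype

instance ospDecomposition (q : QuadForm 𝒱) : DirectSum.Decomposition (ospGrading q) :=
  decompositionOfProj (ospGrading q)
    (fun α => (part (endGrading 𝒱) α).restrict fun _ hx => osp_part_mem q hx α)
    (fun α x => part_mem (endGrading 𝒱) α x)
    (fun _ _ hx => Subtype.ext (part_same (endGrading 𝒱) hx))
    (fun _ _ _ hx h => Subtype.ext (part_ne (endGrading 𝒱) hx h))
    (fun x => Subtype.ext (by
      rw [AddSubmonoidClass.coe_finsetSum]
      exact sum_part (endGrading 𝒱) (x : Module.End K V)))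

/-- The bracket of the Lie superalgebra `osp q`, the super commutator of endomorphisms. -/
def ospBracket (q : QuadForm 𝒱) : osp q →ₗ[K] osp q →ₗ[K] osp q :=
  LinearMap.mk₂ K (fun x y => ⟨superBracket 𝒱 x y, superBracket_mem_osp q x.2 y.2⟩)
    (fun x y z => Subtype.ext (by simp))
    (fun c x y => Subtype.ext (by simp))
    (fun x y z => Subtype.ext (by simp))
    (fun c x y => Subtype.ext (by simp))

end Osp

/-! ### Tensor products with a superextension -/

section Tensor

variable {K : Type*} [Field K] {X : Type*} [AddCommGroup X] [Module K X]
  {A : Type*} [Ring A] [Algebra K A]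

/-- A superalgebra is supercommutative if `a b = (-1) ^ (|a| |b|) b a`. -/
def Supercommutative (𝒜 : ZMod 2 → Submodule K A) : Prop :=
  ∀ α β, ∀ a ∈ 𝒜 α, ∀ b ∈ 𝒜 β, a * b = sgn α β • (b * a)

/-- The total grading of a tensor product. -/
def tensorGrading (𝒳 : ZMod 2 → Submodule K X) (𝒜 : ZMod 2 → Submodule K A) (γ : ZMod 2) :
    Submodule K (X ⊗[K] A) :=
  Submodule.span K {t | ∃ α β, α + β = γ ∧ ∃ x ∈ 𝒳 α, ∃ a ∈ 𝒜 β, t = x ⊗ₜ[K] a}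

variable (𝒳 : ZMod 2 → Submodule K X) [DirectSum.Decomposition 𝒳]
  (𝒜 : ZMod 2 → Submodule K A) [GradedAlgebra 𝒜]

/-- The component of degree `γ` of an element of a tensor product. -/
def tensorPart (γ : ZMod 2) : X ⊗[K] A →ₗ[K] X ⊗[K] A :=
  ∑ α, TensorProduct.map (part 𝒳 α) (part 𝒜 (γ - α))

theorem tensorPart_tmul (γ : ZMod 2) {α β : ZMod 2} {x : X} {a : A} (hx : x ∈ 𝒳 α)
    (ha : a ∈ 𝒜 β) : tensorPart 𝒳 𝒜 γ (x ⊗ₜ a) = if α + β = γ then x ⊗ₜ a else 0 := by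
  simp only [tensorPart, LinearMap.sum_apply, TensorProduct.map_tmul]
  rw [Finset.sum_eq_single α]
  · rw [part_same 𝒳 hx]
    split_ifs with h
    · rw [part_same 𝒜 (show a ∈ 𝒜 (γ - α) by rwa [← h, add_sub_cancel_left])]
    · rw [part_ne 𝒜 ha (fun h' => h (by rw [h', add_sub_cancel])), TensorProduct.tmul_zero]
  · intro δ _ hδ
    rw [part_ne 𝒳 hx hδ.symm, TensorProduct.zero_tmul]
  · simp

instance tensorDecomposition : DirectSum.Decomposition (tensorGrading 𝒳 𝒜) :=
  decompositionOfProj (tensorGrading 𝒳 𝒜) (tensorPart 𝒳 𝒜)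
    (by
      intro γ t
      induction t using TensorProduct.induction_on with
      | zero => rw [map_zero]; exact zero_mem _
      | add s t hs ht => rw [map_add]; exact add_mem hs ht
      | tmul x a =>
        simp only [tensorPart, LinearMap.sum_apply, TensorProduct.map_tmul]
        exact sum_mem fun α _ => Submodule.subset_span
          ⟨α, γ - α, add_sub_cancel _ _, _, part_mem _ _ _, _, part_mem _ _ _, rfl⟩)
    (by
      intro γ t ht
      induction ht using Submodule.span_induction with
      | mem t h =>
        obtain ⟨α, β, h, x, hx, a, ha, rfl⟩ := h
        rw [tensorPart_tmul 𝒳 𝒜 γ hx ha, if_pos h]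
      | zero => rw [map_zero]
      | add s t _ _ hs ht => rw [map_add, hs, ht]
      | smul c t _ ht => rw [map_smul, ht])
    (by
      intro γ δ t ht hne
      induction ht using Submodule.span_induction with
      | mem t h =>
        obtain ⟨α, β, h, x, hx, a, ha, rfl⟩ := h
        rw [tensorPart_tmul 𝒳 𝒜 δ hx ha, if_neg (fun h' => hne (h.symm.trans h'))]
      | zero => rw [map_zero]
      | add s t _ _ hs ht => rw [map_add, hs, ht, add_zero]
      | smul c t _ ht => rw [map_smul, ht, smul_zero])
    (by
      intro t
      induction t using TensorProduct.induction_on with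
      | zero => simp
      | add s t hs ht => simp only [map_add, Finset.sum_add_distrib, hs, ht]
      | tmul x a =>
        simp only [tensorPart, LinearMap.sum_apply, TensorProduct.map_tmul]
        rw [Finset.sum_comm]
        conv_rhs => rw [← sum_part 𝒳 x, TensorProduct.sum_tmul]
        refine Finset.sum_congr rfl fun α _ => ?_
        rw [← TensorProduct.tmul_sum]
        congr 1
        exact (Fintype.sum_equiv (Equiv.subRight α) (fun γ => part 𝒜 (γ - α) a)
          (fun γ => part 𝒜 γ a) fun _ => rfl).trans (sum_part 𝒜 a))

/-- The multiplication `(x ⊗ a) (y ⊗ b) = (-1) ^ (|a| |y|) (x y) ⊗ (a b)` on the tensor product of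
a superalgebra with multiplication `μ` and a superextension. -/
def tensorBracket (μ : X →ₗ[K] X →ₗ[K] X) : X ⊗[K] A →ₗ[K] X ⊗[K] A →ₗ[K] X ⊗[K] A :=
  ∑ α, ∑ β, sgn α β •
    TensorProduct.map₂ (μ.compl₂ (part 𝒳 β)) (LinearMap.mul K A ∘ₗ part 𝒜 α)

theorem tensorBracket_tmul (μ : X →ₗ[K] X →ₗ[K] X) {α β : ZMod 2} (x : X) {a : A}
    (ha : a ∈ 𝒜 α) {y : X} (hy : y ∈ 𝒳 β) (b : A) :
    tensorBracket 𝒳 𝒜 μ (x ⊗ₜ a) (y ⊗ₜ b) = sgn α β • (μ x y ⊗ₜ[K] (a * b)) := by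
  simp only [tensorBracket, LinearMap.sum_apply, LinearMap.smul_apply,
    TensorProduct.map₂_apply_tmul, TensorProduct.map_tmul, LinearMap.compl₂_apply,
    LinearMap.comp_apply, LinearMap.mul_apply']
  rw [Finset.sum_eq_single α, Finset.sum_eq_single β]
  · rw [part_same _ ha, part_same _ hy]
  · intro γ _ hγ
    rw [part_ne _ hy hγ.symm, map_zero, TensorProduct.zero_tmul, smul_zero]
  · simp
  · intro γ _ hγ
    refine Finset.sum_eq_zero fun δ _ => ?_
    rw [part_ne _ ha hγ.symm, zero_mul, TensorProduct.tmul_zero, smul_zero]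
  · simp

/-- The extension `x ⊗ a ↦ (-1) ^ (|Δ| |x|) x ⊗ Δ a` of an endomorphism `Δ` of `A`. -/
def tensorLift : Module.End K A →ₗ[K] Module.End K (X ⊗[K] A) :=
  ∑ α, ∑ β, sgn α β •
    TensorProduct.mapBilinear (RingHom.id K) X A X A (part 𝒳 β) ∘ₗ part (endGrading 𝒜) α

theorem tensorLift_tmul {α β : ZMod 2} {Δ : Module.End K A} (hΔ : Δ ∈ endGrading 𝒜 α) {x : X}
    (hx : x ∈ 𝒳 β) (a : A) : tensorLift 𝒳 𝒜 Δ (x ⊗ₜ a) = sgn α β • (x ⊗ₜ[K] Δ a) := by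
  simp only [tensorLift, LinearMap.sum_apply, LinearMap.smul_apply, LinearMap.comp_apply,
    TensorProduct.mapBilinear_apply, TensorProduct.map_tmul]
  rw [Finset.sum_eq_single α, Finset.sum_eq_single β]
  · rw [part_same _ hΔ, part_same _ hx]
  · intro γ _ hγ
    rw [part_ne _ hx hγ.symm, TensorProduct.zero_tmul, smul_zero]
  · simp
  · intro γ _ hγ
    refine Finset.sum_eq_zero fun δ _ => ?_
    rw [part_ne _ hΔ hγ.symm, LinearMap.zero_apply, TensorProduct.tmul_zero, smul_zero]
  · simp

end Tensor

/-! ### The standard forms -/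

section Standard

variable (K : Type*) [Field K] {ι : Type*}

/-- The super vector space with a homogeneous basis indexed by `ι` with degrees `p`. -/
def coordGrading (p : ι → ZMod 2) (α : ZMod 2) : Submodule K (ι → K) where
  carrier := {v | ∀ i, p i ≠ α → v i = 0}
  add_mem' hu hv i hi := by rw [Pi.add_apply, hu i hi, hv i hi, add_zero]
  zero_mem' _ _ := rfl
  smul_mem' c v hv i hi := by rw [Pi.smul_apply, hv i hi, smul_zero]

instance coordDecomposition (p : ι → ZMod 2) : DirectSum.Decomposition (coordGrading K p) :=
  decompositionOfProj (coordGrading K p)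
    (fun α => LinearMap.pi fun i => if p i = α then LinearMap.proj i else 0)
    (by
      intro α v i hi
      simp [hi])
    (by
      intro α v hv
      ext i
      by_cases h : p i = α
      · simp [h]
      · simp [h, hv i h])
    (by
      intro α β v hv h
      ext i
      by_cases hi : p i = β
      · have := hv i (by rw [hi]; exact h.symm)
        simp [this, hi]
      · simp [hi])
    (by
      intro v
      ext i
      rw [Finset.sum_apply, Finset.sum_eq_single (p i)]
      · simp
      · intro β _ hβ
        simp [hβ.symm]
      · simp)

variable {K} in
/-- The quadratic form `q (v i) (v j) = G i j` on the super vector space with basis `v`. -/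
def gramForm [Fintype ι] [DecidableEq ι] (p : ι → ZMod 2) (G : Matrix ι ι K)
    (heven : ∀ i j, p i ≠ p j → G i j = 0)
    (hsymm : ∀ i j, G i j = sgn (p i) (p j) • G j i) : QuadForm (coordGrading K p) where
  bilin := Matrix.toLinearMap₂' K G
  even := by
    intro α β u hu v hv h
    rw [Matrix.toLinearMap₂'_apply]
    refine Finset.sum_eq_zero fun i _ => Finset.sum_eq_zero fun j _ => ?_
    by_cases hi : p i = α
    · by_cases hj : p j = β
      · rw [heven i j (by rwa [hi, hj])]
        simp
      · rw [hv j hj]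
        simp
    · rw [hu i hi]
      simp
  supersymm := by
    intro α β u hu v hv
    rw [Matrix.toLinearMap₂'_apply, Matrix.toLinearMap₂'_apply, Finset.sum_comm, Finset.smul_sum]
    refine Finset.sum_congr rfl fun j _ => ?_
    rw [Finset.smul_sum]
    refine Finset.sum_congr rfl fun i _ => ?_
    by_cases hi : p i = α
    · by_cases hj : p j = β
      · rw [hsymm i j, hi, hj]
        simp only [smul_eq_mul, zsmul_eq_mul]
        ring
      · rw [hv j hj]
        simp
    · rw [hu i hi]
      simp

/-- The basis of `H({1, …, m}) ⊕ H̃({1, …, n})`: the even vectors `h i`, `h (-i)` for `i ≤ m` and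
the odd vectors `k j`, `k (-j)` for `j ≤ n`. -/
abbrev HypIndex (m n : ℕ) : Type := (Fin m ⊕ Fin m) ⊕ (Fin n ⊕ Fin n)

/-- The degrees of the basis vectors. -/
def hypParity (m n : ℕ) : HypIndex m n → ZMod 2 := Sum.elim (fun _ => 0) (fun _ => 1)

/-- The Gram matrix of the orthogonal sum of the hyperbolic form
(`q (h i, h (-i)) = q (h (-i), h i) = 1`) and the symplectic form
(`q (k j, k (-j)) = 1 = - q (k (-j), k j)`); all other values are zero. -/
def hypGram (m n : ℕ) : Matrix (HypIndex m n) (HypIndex m n) K :=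
  Matrix.fromBlocks (Matrix.fromBlocks 0 1 1 0) 0 0 (Matrix.fromBlocks 0 1 (-1) 0)

/-- The orthogonal sum of the hyperbolic form on `K ^ (2m | 0)` and the symplectic form on
`K ^ (0 | 2n)`. -/
def hypForm (m n : ℕ) : QuadForm (coordGrading K (hypParity m n)) :=
  gramForm (hypParity m n) (hypGram K m n)
    (by
      rintro ((i | i) | (i | i)) ((j | j) | (j | j)) <;> simp [hypParity, hypGram])
    (by
      rintro ((i | i) | (i | i)) ((j | j) | (j | j)) <;>
        simp [hypParity, hypGram, sgn, Matrix.one_apply, eq_comm] <;> split_ifs <;> simp)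

/-- The form `hypForm K m n ⊕ q₀`, where `q₀ (v₀, v₀) = 1` for an even basis vector `v₀`. -/
def hypFormPlus (m n : ℕ) :
    QuadForm (coordGrading K (Sum.elim (hypParity m n) (fun _ : Unit => 0))) :=
  gramForm (Sum.elim (hypParity m n) (fun _ : Unit => 0))
    (Matrix.fromBlocks (hypGram K m n) 0 0 1)
    (by
      rintro (((i | i) | (i | i)) | i) (((j | j) | (j | j)) | j) <;> simp [hypParity, hypGram])
    (by
      rintro (((i | i) | (i | i)) | i) (((j | j) | (j | j)) | j) <;>
        simp [hypParity, hypGram, sgn, Matrix.one_apply, eq_comm] <;> split_ifs <;> simp)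

end Standard

/-! ### The Lie superalgebra `osp(M, N)` -/

/-- `q` is a nondegenerate quadratic form on a super vector space of dimension `(M | N)`; then
`osp q` is the Lie superalgebra `osp(M, N)`. -/
structure IsOspForm {K : Type*} [Field K] {V : Type*} [AddCommGroup V] [Module K V]
    {𝒱 : ZMod 2 → Submodule K V} (q : QuadForm 𝒱) (M N : ℕ) : Prop where
  finite : Module.Finite K V
  nondegenerate : q.Nondegenerate
  finrank_even : Module.finrank K (𝒱 0) = M
  finrank_odd : Module.finrank K (𝒱 1) = N

/-- An even linear isometry of super vector spaces with quadratic forms. -/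
structure IsIsometry {K : Type*} [Field K] {V : Type*} [AddCommGroup V] [Module K V]
    {W : Type*} [AddCommGroup W] [Module K W] {𝒱 : ZMod 2 → Submodule K V}
    {𝒲 : ZMod 2 → Submodule K W} (q : QuadForm 𝒱) (r : QuadForm 𝒲) (φ : V ≃ₗ[K] W) : Prop where
  even : ∀ α, ∀ v ∈ 𝒱 α, φ v ∈ 𝒲 α
  isometry : ∀ u v, r.bilin (φ u) (φ v) = q.bilin u v

/-- `eosp q` is the Lie superalgebra `osp(M, N)`: the form `q` is nondegenerate on a super vector
space of dimension `(M | N)`, `eosp q` is all of `osp q`, and for every other nondegenerate form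
`r` on a super vector space of that dimension, `osp r` is the image of `eosp q` under the
isomorphism given by an even isometry. -/
structure EospIsOsp {K : Type u} [Field K] {V : Type w} [AddCommGroup V] [Module K V]
    {𝒱 : ZMod 2 → Submodule K V} [DirectSum.Decomposition 𝒱] (q : QuadForm 𝒱) (M N : ℕ) :
    Prop where
  isOspForm : IsOspForm q M N
  eosp_eq : eosp q = (osp q).toAddSubgroup
  unique : ∀ (W : Type v) [AddCommGroup W] [Module K W] (𝒲 : ZMod 2 → Submodule K W)
    [DirectSum.Decomposition 𝒲] (r : QuadForm 𝒲), IsOspForm r M N →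
    ∃ φ : V ≃ₗ[K] W, IsIsometry q r φ ∧
      (osp r : Set (Module.End K W)) = φ.conj '' (eosp q : Set (Module.End K V))

end

end Super

namespace Super

/-! ### Signs -/

/-! Part (1). Take a basis b_i of V and vectors c_i such that q(c_i, ·) is the dual basis. Skewness
of x in osp(q) gives 2x = ∑ E(x b_i, c_i), and absorbing 1/2 into the vectors x b_i shows that an
integral span already suffices. Uniqueness of the form: the even and odd parts are orthogonal; the
even part carries a symmetric form, equivalent to a sum of squares over an algebraically closed
field, and the odd part carries an alternating form, which has a symplectic basis. Isometries of the
two parts glue.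

Part (2). The properties of L that matter are collected in `IsCompleteCentral`. Restrict a
derivation d of L ⊗ A to L ⊗ 1 and contract the coefficients with a functional on A. Up to signs the
result is a derivation of L, hence inner; as L is finite-dimensional, these assemble to some z in L
⊗ A with d = ad z on L ⊗ 1 (`exists_tensorBracket_eq`). The difference d - ad z commutes up to sign
with ad(L ⊗ 1), so its contractions lie in the centroid of L and are scalars; therefore it is the
lift of a map Δ of A, and Δ is a derivation (`exists_tensorLift_eq`). The sum is direct because
lifts kill L ⊗ 1, whereas ad z does so only for z = 0.

That L has these properties needs no root system or Killing form. Nondegeneracy on a nonzero odd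
part gives odd vectors e, f with q(f, e) = 1, and E(e,e), h = E(e,f), E(f,f) span an sl₂. On V the
eigenvalues of h are 0 and ±1, so those of ad h are among 0, ±1, ±2. Weight 2 is the line through
E(e,e), weight 1 consists of the E(w,e) with w orthogonal to e and f, and E(f,f) together with all
E(u,e) generates L (`eq_top_of_mem`). A centroid element preserves the weight-2 line, so it is a
scalar there and then everywhere. A derivation is first made to vanish on h, which works because ad
h is annihilated by a separable polynomial, and then on the sl₂ by adding a multiple of ad h. On
weight 1 it now acts through a map t of the complement of e and f. Brackets of weight-1 elements
recover q there, so t lies in osp(q), and subtracting ad t leaves a derivation that kills the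
generators. -/

theorem sgn_comm (α β : ZMod 2) : sgn α β = sgn β α := by
  revert α β; decide

theorem sgn_zero_left (α : ZMod 2) : sgn 0 α = 1 := by
  revert α; decide

theorem sgn_zero_right (α : ZMod 2) : sgn α 0 = 1 := by
  revert α; decide

theorem sgn_mul_self (α β : ZMod 2) : sgn α β * sgn α β = 1 := by
  revert α β; decide

theorem sgn_smul_sgn_smul {M : Type*} [AddCommGroup M] (α β : ZMod 2) (x : M) :
    sgn α β • sgn α β • x = x := by
  rw [smul_smul, sgn_mul_self, one_smul]

section Gradings

variable {K : Type*} [Field K] {X : Type*} [AddCommGroup X] [Module K X]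

/-! ### Homogeneous endomorphisms and derivations -/

theorem mul_mem_endGrading {𝒳 : ZMod 2 → Submodule K X} {α β : ZMod 2} {f g : Module.End K X}
    (hf : f ∈ endGrading 𝒳 α) (hg : g ∈ endGrading 𝒳 β) : f * g ∈ endGrading 𝒳 (α + β) := by
  intro γ x hx
  rw [add_assoc]
  exact hf _ _ (hg _ _ hx)

theorem derDeg_le_der (𝒳 : ZMod 2 → Submodule K X) (μ : X →ₗ[K] X →ₗ[K] X) (α : ZMod 2) : derDeg 𝒳 μ α ≤ der 𝒳 μ :=
  le_iSup (derDeg 𝒳 μ) α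

/-- The multiplication `μ` makes the super vector space `𝒳` a left Leibniz superalgebra: left
multiplications are derivations. -/
structure IsLeibniz (𝒳 : ZMod 2 → Submodule K X) (μ : X →ₗ[K] X →ₗ[K] X) : Prop where
  graded : ∀ α β, ∀ x ∈ 𝒳 α, ∀ y ∈ 𝒳 β, μ x y ∈ 𝒳 (α + β)
  jacobi : ∀ α β, ∀ x ∈ 𝒳 α, ∀ y ∈ 𝒳 β, ∀ z,
    μ x (μ y z) = μ (μ x y) z + sgn α β • μ y (μ x z)

theorem IsLeibniz.ad_mem_derDeg {𝒳 : ZMod 2 → Submodule K X}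
    {μ : X →ₗ[K] X →ₗ[K] X} (h : IsLeibniz 𝒳 μ) {α : ZMod 2} {x : X}
    (hx : x ∈ 𝒳 α) : μ x ∈ derDeg 𝒳 μ α :=
  ⟨fun β y hy => h.graded α β x hx y hy, fun β y hy z => h.jacobi α β x hx y hy z⟩

variable (𝒳 : ZMod 2 → Submodule K X) [DirectSum.Decomposition 𝒳]

theorem superBracket_mem_endGrading {α β : ZMod 2} {f g : Module.End K X}
    (hf : f ∈ endGrading 𝒳 α) (hg : g ∈ endGrading 𝒳 β) :
    superBracket 𝒳 f g ∈ endGrading 𝒳 (α + β) := by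
  rw [superBracket_of_mem 𝒳 hf hg]
  refine sub_mem (mul_mem_endGrading hf hg) (zsmul_mem ?_ _)
  rw [add_comm]
  exact mul_mem_endGrading hg hf

/-- A map of degree `α` shifts homogeneous components. -/
theorem apply_part {Y : Type*} [AddCommGroup Y] [Module K Y] (𝒴 : ZMod 2 → Submodule K Y)
    [DirectSum.Decomposition 𝒴] {α : ZMod 2} (f : X →ₗ[K] Y)
    (hf : ∀ β, ∀ x ∈ 𝒳 β, f x ∈ 𝒴 (α + β)) (β : ZMod 2) (x : X) :
    f (part 𝒳 β x) = part 𝒴 (α + β) (f x) := by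
  have key : ∀ γ, ∀ x ∈ 𝒳 γ, (f ∘ₗ part 𝒳 β) x = (part 𝒴 (α + β) ∘ₗ f) x := by
    intro γ x hx
    simp only [LinearMap.comp_apply]
    by_cases h : γ = β
    · subst h
      rw [part_same _ hx, part_same _ (hf _ _ hx)]
    · rw [part_ne _ hx h, part_ne _ (hf _ _ hx) (by simpa using h), map_zero]
  exact LinearMap.congr_fun (end_ext 𝒳 key) x

/-- All derivations, the inner ones and the lifts from A are sums of homogeneous pieces, so for each
of them closure need only be checked on homogeneous elements. -/
theorem isSubalgebra_iSup (D : ZMod 2 → Submodule K (Module.End K X))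
    (hD : ∀ α, D α ≤ endGrading 𝒳 α)
    (hbr : ∀ α β, ∀ d ∈ D α, ∀ e ∈ D β, superBracket 𝒳 d e ∈ ⨆ γ, D γ) :
    IsSubalgebra 𝒳 (⨆ γ, D γ) where
  graded α d hd := by
    induction hd using Submodule.iSup_induction' with
    | mem β d hd =>
      by_cases h : β = α
      · subst h
        rw [part_same _ (hD _ hd)]
        exact Submodule.mem_iSup_of_mem _ hd
      · rw [part_ne _ (hD _ hd) h]
        exact zero_mem _
    | zero => rw [map_zero]; exact zero_mem _
    | add d e _ _ hd he => rw [map_add]; exact add_mem hd he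
  bracket_mem d hd e he := by
    induction hd using Submodule.iSup_induction' with
    | mem α d hd =>
      induction he using Submodule.iSup_induction' with
      | mem β e he => exact hbr α β d hd e he
      | zero => rw [map_zero]; exact zero_mem _
      | add e e' _ _ he he' => rw [map_add]; exact add_mem he he'
    | zero => rw [map_zero, LinearMap.zero_apply]; exact zero_mem _
    | add d d' _ _ hd hd' => rw [map_add, LinearMap.add_apply]; exact add_mem hd hd'

theorem superBracket_mem_derDeg {μ : X →ₗ[K] X →ₗ[K] X} {α β : ZMod 2} {d e : Module.End K X}
    (hd : d ∈ derDeg 𝒳 μ α) (he : e ∈ derDeg 𝒳 μ β) :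
    superBracket 𝒳 d e ∈ derDeg 𝒳 μ (α + β) := by
  refine ⟨superBracket_mem_endGrading 𝒳 hd.1 he.1, fun γ x hx y => ?_⟩
  rw [superBracket_of_mem 𝒳 hd.1 he.1]
  simp only [LinearMap.sub_apply, Module.End.mul_apply, LinearMap.smul_apply, hd.2 γ x hx,
    he.2 γ x hx, map_add, map_zsmul, hd.2 _ _ (he.1 γ x hx), he.2 _ _ (hd.1 γ x hx), map_sub,
    smul_add, smul_sub, smul_smul]
  -- The cross terms (d x)(e y) and (e x)(d y) occur twice each; these sign identities make them
  -- cancel.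
  have h1 : ∀ α β γ : ZMod 2, sgn α β * sgn α γ = sgn α (β + γ) := by decide
  have h2 : ∀ α β γ : ZMod 2, sgn α β * sgn β (α + γ) = sgn β γ := by decide
  have h3 : ∀ α β γ : ZMod 2, sgn (α + β) γ = sgn β γ * sgn α γ := by decide
  have h4 : ∀ α β γ : ZMod 2, sgn (α + β) γ * sgn α β = sgn α β * (sgn α γ * sgn β γ) := by decide
  rw [h4, h2, ← h1 α β γ, h3]
  abel

theorem isSubalgebra_der (μ : X →ₗ[K] X →ₗ[K] X) : IsSubalgebra 𝒳 (der 𝒳 μ) :=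
  isSubalgebra_iSup 𝒳 _ (fun _ _ h => h.1) fun _ _ _ hd _ he =>
    derDeg_le_der 𝒳 μ _ (superBracket_mem_derDeg 𝒳 hd he)

theorem part_mem_derDeg {μ : X →ₗ[K] X →ₗ[K] X} {d : Module.End K X} (hd : d ∈ der 𝒳 μ)
    (α : ZMod 2) : part (endGrading 𝒳) α d ∈ derDeg 𝒳 μ α := by
  rw [der] at hd
  induction hd using Submodule.iSup_induction' with
  | mem β d hd =>
    by_cases h : β = α
    · subst h
      rwa [part_same _ hd.1]
    · rw [part_ne _ hd.1 h]
      exact zero_mem _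
  | zero => rw [map_zero]; exact zero_mem _
  | add d e _ _ hd he => rw [map_add]; exact add_mem hd he

/-! ### Inner derivations -/

variable {𝒳}

theorem inner_eq_iSup (μ : X →ₗ[K] X →ₗ[K] X) : inner μ = ⨆ α, (𝒳 α).map μ := by
  apply le_antisymm
  · rintro _ ⟨x, rfl⟩
    rw [← sum_part 𝒳 x, map_sum]
    exact sum_mem fun α _ => Submodule.mem_iSup_of_mem α ⟨_, part_mem 𝒳 α x, rfl⟩
  · refine iSup_le fun α => ?_
    rintro _ ⟨x, _, rfl⟩
    exact ⟨x, rfl⟩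

theorem IsLeibniz.inner_le_der {μ : X →ₗ[K] X →ₗ[K] X} (h : IsLeibniz 𝒳 μ) : inner μ ≤ der 𝒳 μ := by
  rw [inner_eq_iSup (𝒳 := 𝒳)]
  refine iSup_le fun α => ?_
  rintro _ ⟨x, hx, rfl⟩
  exact derDeg_le_der 𝒳 μ α (h.ad_mem_derDeg hx)

/-- The derivation rule read as an identity of operators. It makes the inner derivations an ideal.
-/
theorem IsLeibniz.superBracket_ad {μ : X →ₗ[K] X →ₗ[K] X} (h : IsLeibniz 𝒳 μ) {d : Module.End K X}
    (hd : d ∈ der 𝒳 μ) (x : X) : superBracket 𝒳 d (μ x) = μ (d x) := by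
  have key : ∀ α β, ∀ d ∈ derDeg 𝒳 μ α, ∀ x ∈ 𝒳 β, superBracket 𝒳 d (μ x) = μ (d x) := by
    intro α β d hd x hx
    rw [superBracket_of_mem 𝒳 hd.1 (h.ad_mem_derDeg hx).1]
    ext y
    simp [hd.2 β x hx y]
  rw [der] at hd
  induction hd using Submodule.iSup_induction' with
  | mem α d hd =>
    conv_lhs => rw [← sum_part 𝒳 x]
    conv_rhs => rw [← sum_part 𝒳 x]
    simp only [map_sum]
    exact Finset.sum_congr rfl fun β _ => key α β d hd _ (part_mem 𝒳 β x)
  | zero => simp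
  | add d e _ _ hd he => simp [hd, he]

theorem IsLeibniz.isSubalgebra_inner {μ : X →ₗ[K] X →ₗ[K] X} (h : IsLeibniz 𝒳 μ) :
    IsSubalgebra 𝒳 (inner μ) := by
  have hl := h.inner_le_der
  have hs := fun d (hd : d ∈ der 𝒳 μ) => h.superBracket_ad hd
  rw [inner_eq_iSup (𝒳 := 𝒳)] at hl ⊢
  refine isSubalgebra_iSup 𝒳 _ ?_ ?_
  · rintro α _ ⟨x, hx, rfl⟩
    exact (h.ad_mem_derDeg hx).1
  · rintro α β _ ⟨x, hx, rfl⟩ _ ⟨y, hy, rfl⟩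
    rw [hs _ (derDeg_le_der 𝒳 μ α (h.ad_mem_derDeg hx))]
    exact Submodule.mem_iSup_of_mem (α + β) ⟨_, h.graded α β x hx y hy, rfl⟩

end Gradings

section Slice

variable {K : Type*} [Field K] {X : Type*} [AddCommGroup X] [Module K X]
  {A : Type*} [AddCommGroup A] [Module K A]

/-! ### Contracting the second factor of a tensor product -/

/-- The map `x ⊗ a ↦ φ a • x`. -/
noncomputable def slice (X : Type*) [AddCommGroup X] [Module K X] (φ : A →ₗ[K] K) :
    X ⊗[K] A →ₗ[K] X :=
  (TensorProduct.rid K X).toLinearMap ∘ₗ φ.lTensor X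

@[simp]
theorem slice_tmul (φ : A →ₗ[K] K) (x : X) (a : A) : slice X φ (x ⊗ₜ a) = φ a • x := by
  simp [slice]

/-- The map `x ⊗ a ↦ ξ x • a`. -/
noncomputable def sliceLeft (A : Type*) [AddCommGroup A] [Module K A] (ξ : X →ₗ[K] K) :
    X ⊗[K] A →ₗ[K] A :=
  (TensorProduct.lid K A).toLinearMap ∘ₗ ξ.rTensor A

@[simp]
theorem sliceLeft_tmul (ξ : X →ₗ[K] K) (x : X) (a : A) : sliceLeft A ξ (x ⊗ₜ a) = ξ x • a := by
  simp [sliceLeft]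

theorem apply_slice (φ : A →ₗ[K] K) (ξ : X →ₗ[K] K) (t : X ⊗[K] A) :
    ξ (slice X φ t) = φ (sliceLeft A ξ t) := by
  induction t using TensorProduct.induction_on with
  | zero => simp
  | add s t hs ht => simp only [map_add, hs, ht]
  | tmul x a => simp [mul_comm]

theorem slice_rTensor (φ : A →ₗ[K] K) (f : X →ₗ[K] X) (t : X ⊗[K] A) :
    slice X φ (f.rTensor A t) = f (slice X φ t) := by
  induction t using TensorProduct.induction_on with
  | zero => simp
  | add s t hs ht => simp only [map_add, hs, ht]
  | tmul x a => simp

/-- A basis of A turns X ⊗ A into a direct sum of copies of X whose coordinates are contractions. -/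
theorem eq_of_slice_eq {s t : X ⊗[K] A} (h : ∀ φ : A →ₗ[K] K, slice X φ s = slice X φ t) :
    s = t := by
  classical
  let b := Module.Basis.ofVectorSpace K A
  apply (TensorProduct.equivFinsuppOfBasisRight (M := X) b).injective
  ext i
  have key : ∀ t : X ⊗[K] A,
      TensorProduct.equivFinsuppOfBasisRight (M := X) b t i = slice X (b.coord i) t := by
    intro t
    induction t using TensorProduct.induction_on with
    | zero => simp
    | add s t hs ht => simp only [map_add, Finsupp.add_apply, hs, ht]
    | tmul x a => simp
  rw [key, key, h]

theorem tmul_right_injective {x : X} (hx : x ≠ 0) {a b : A} (h : x ⊗ₜ[K] a = x ⊗ₜ[K] b) :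
    a = b := by
  obtain ⟨ξ, hξ⟩ := Module.Projective.exists_dual_ne_zero K hx
  have h1 := congrArg (sliceLeft A ξ) h
  rw [sliceLeft_tmul, sliceLeft_tmul] at h1
  exact smul_right_injective A hξ h1

/-- A map `X → X ⊗ A` all of whose contractions are left multiplications is a left multiplication by
an element of `X ⊗ A`. -/
theorem exists_rTensor_eq [Module.Finite K X] (μ : X →ₗ[K] X →ₗ[K] X)
    (hμ : Function.Injective μ) (T : X →ₗ[K] X ⊗[K] A)
    (hT : ∀ φ : A →ₗ[K] K, slice X φ ∘ₗ T ∈ LinearMap.range μ) :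
    ∃ z : X ⊗[K] A, ∀ x, T x = (μ.flip x).rTensor A z := by
  obtain ⟨r, hr⟩ := LinearMap.exists_leftInverse_of_injective μ (LinearMap.ker_eq_bot.2 hμ)
  let b := Module.finBasis K X
  -- By finite-dimensionality T is the element ∑ b_i^* ⊗ T(b_i) of End X ⊗ A. All its contractions
  -- lie in the range of `μ`, so applying the left inverse `r` of `μ` to the first factor loses
  -- nothing.
  refine ⟨∑ i, (r ∘ₗ LinearMap.smulRightₗ (b.coord i)).rTensor A (T (b i)), fun x => ?_⟩
  refine eq_of_slice_eq fun φ => ?_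
  obtain ⟨z, hz⟩ := hT φ
  have h1 : ∑ i, LinearMap.smulRightₗ (b.coord i) (slice X φ (T (b i))) = slice X φ ∘ₗ T := by
    refine b.ext fun j => ?_
    simp [LinearMap.sum_apply, Finsupp.single_apply]
  rw [slice_rTensor, map_sum]
  simp only [slice_rTensor, LinearMap.comp_apply]
  rw [← map_sum, h1, ← hz, ← LinearMap.comp_apply (x := z), hr,
    LinearMap.id_apply, LinearMap.flip_apply, hz, LinearMap.comp_apply]

end Slice

section TensorBracket

variable {K : Type*} [Field K] {X : Type*} [AddCommGroup X] [Module K X]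
  {A : Type*} [Ring A] [Algebra K A]
  (𝒳 : ZMod 2 → Submodule K X) [DirectSum.Decomposition 𝒳]
  (𝒜 : ZMod 2 → Submodule K A) [GradedAlgebra 𝒜]

/-! ### The tensor product of a Leibniz superalgebra and a superextension -/

theorem tmul_mem_tensorGrading {𝒳 : ZMod 2 → Submodule K X} {𝒜 : ZMod 2 → Submodule K A}
    {α β : ZMod 2} {x : X} {a : A} (hx : x ∈ 𝒳 α) (ha : a ∈ 𝒜 β) :
    x ⊗ₜ[K] a ∈ tensorGrading 𝒳 𝒜 (α + β) :=
  Submodule.subset_span ⟨α, β, rfl, x, hx, a, ha, rfl⟩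

theorem tmul_one_mem_tensorGrading {𝒳 : ZMod 2 → Submodule K X} (𝒜 : ZMod 2 → Submodule K A)
    [GradedAlgebra 𝒜] {α : ZMod 2} {x : X} (hx : x ∈ 𝒳 α) :
    x ⊗ₜ[K] (1 : A) ∈ tensorGrading 𝒳 𝒜 α := by
  have := tmul_mem_tensorGrading hx (SetLike.GradedOne.one_mem (A := 𝒜))
  rwa [add_zero] at this

/-- Linear maps on a tensor product that agree on homogeneous pure tensors are equal. -/
theorem tensor_ext {Y : Type*} [AddCommGroup Y] [Module K Y] {f g : X ⊗[K] A →ₗ[K] Y}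
    (h : ∀ α β, ∀ x ∈ 𝒳 α, ∀ a ∈ 𝒜 β, f (x ⊗ₜ a) = g (x ⊗ₜ a)) : f = g := by
  refine end_ext (tensorGrading 𝒳 𝒜) fun γ t ht => ?_
  induction ht using Submodule.span_induction with
  | mem t h' =>
    obtain ⟨α, β, _, x, hx, a, ha, rfl⟩ := h'
    exact h α β x hx a ha
  | zero => simp
  | add s t _ _ hs ht => rw [map_add, map_add, hs, ht]
  | smul c t _ ht => rw [map_smul, map_smul, ht]

/-- To check that an element of `End (X ⊗ A)` is homogeneous it suffices to consider homogeneous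
pure tensors. -/
theorem mem_endGrading_tensor {Y : Type*} [AddCommGroup Y] [Module K Y]
    {𝒴 : ZMod 2 → Submodule K Y} {𝒳 : ZMod 2 → Submodule K X} {𝒜 : ZMod 2 → Submodule K A}
    {δ : ZMod 2} {f : X ⊗[K] A →ₗ[K] Y}
    (h : ∀ α β, ∀ x ∈ 𝒳 α, ∀ a ∈ 𝒜 β, f (x ⊗ₜ a) ∈ 𝒴 (δ + (α + β))) :
    ∀ γ, ∀ t ∈ tensorGrading 𝒳 𝒜 γ, f t ∈ 𝒴 (δ + γ) := by
  intro γ t ht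
  induction ht using Submodule.span_induction with
  | mem t h' =>
    obtain ⟨α, β, rfl, x, hx, a, ha, rfl⟩ := h'
    exact h α β x hx a ha
  | zero => simp
  | add s t _ _ hs ht => rw [map_add]; exact add_mem hs ht
  | smul c t _ ht => rw [map_smul]; exact Submodule.smul_mem _ c ht

theorem tensorBracket_tmul_even (μ : X →ₗ[K] X →ₗ[K] X) (x : X) (a : A) {y : X} (hy : y ∈ 𝒳 0)
    (b : A) : tensorBracket 𝒳 𝒜 μ (x ⊗ₜ a) (y ⊗ₜ b) = μ x y ⊗ₜ[K] (a * b) := by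
  conv_lhs => rw [← sum_part 𝒜 a, TensorProduct.tmul_sum, map_sum, LinearMap.sum_apply]
  conv_rhs => rw [← sum_part 𝒜 a, Finset.sum_mul, TensorProduct.tmul_sum]
  refine Finset.sum_congr rfl fun α _ => ?_
  rw [tensorBracket_tmul 𝒳 𝒜 μ x (part_mem 𝒜 α a) hy b, sgn_zero_right, one_smul]

theorem tensorBracket_one_tmul (μ : X →ₗ[K] X →ₗ[K] X) (x : X) (t : X ⊗[K] A) :
    tensorBracket 𝒳 𝒜 μ (x ⊗ₜ 1) t = (μ x).rTensor A t := by
  refine LinearMap.congr_fun (tensor_ext 𝒳 𝒜 (f := tensorBracket 𝒳 𝒜 μ (x ⊗ₜ 1)) ?_) t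
  intro α β y hy b hb
  rw [tensorBracket_tmul 𝒳 𝒜 μ x SetLike.GradedOne.one_mem hy b, sgn_zero_left, one_smul,
    one_mul, LinearMap.rTensor_tmul]

/-- Moving y past a coefficient costs a sign depending on the degree of that coefficient, so t has
to be split by coefficient degree. -/
theorem tensorBracket_tmul_one (μ : X →ₗ[K] X →ₗ[K] X) {γ : ZMod 2} {y : X} (hy : y ∈ 𝒳 γ)
    (t : X ⊗[K] A) : tensorBracket 𝒳 𝒜 μ t (y ⊗ₜ 1) =
      ∑ β, sgn β γ • (μ.flip y).rTensor A ((part 𝒜 β).lTensor X t) := by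
  have key : (tensorBracket 𝒳 𝒜 μ).flip (y ⊗ₜ 1) =
      ∑ β, sgn β γ • ((μ.flip y).rTensor A ∘ₗ (part 𝒜 β).lTensor X) := by
    refine tensor_ext 𝒳 𝒜 fun α β x hx a ha => ?_
    rw [LinearMap.flip_apply, tensorBracket_tmul 𝒳 𝒜 μ x ha hy, mul_one, LinearMap.sum_apply,
      Finset.sum_eq_single β]
    · simp [part_same 𝒜 ha]
    · intro δ _ hδ
      simp [part_ne 𝒜 ha hδ.symm]
    · simp
  have := LinearMap.congr_fun key t
  simpa only [LinearMap.flip_apply, LinearMap.sum_apply, LinearMap.smul_apply,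
    LinearMap.comp_apply] using this

theorem lTensor_part_comp (β β' : ZMod 2) (t : X ⊗[K] A) :
    (part 𝒜 β).lTensor X ((part 𝒜 β').lTensor X t) =
      if β = β' then (part 𝒜 β).lTensor X t else 0 := by
  rw [← LinearMap.comp_apply, ← LinearMap.lTensor_comp]
  split_ifs with h
  · subst h
    congr 2
    ext a
    exact part_same 𝒜 (part_mem 𝒜 β a)
  · have : part 𝒜 β ∘ₗ part 𝒜 β' = 0 := by
      ext a
      exact part_ne 𝒜 (part_mem 𝒜 β' a) (Ne.symm h)
    rw [this, LinearMap.lTensor_zero, LinearMap.zero_apply]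

theorem sum_lTensor_part (t : X ⊗[K] A) : ∑ β, (part 𝒜 β).lTensor X t = t := by
  induction t using TensorProduct.induction_on with
  | zero => simp
  | add s t hs ht => simp only [map_add, Finset.sum_add_distrib, hs, ht]
  | tmul x a =>
    simp only [LinearMap.lTensor_tmul]
    rw [← TensorProduct.tmul_sum, sum_part]

theorem lTensor_rTensor (f : X →ₗ[K] X) (g : A →ₗ[K] A) (t : X ⊗[K] A) :
    g.lTensor X (f.rTensor A t) = f.rTensor A (g.lTensor X t) := by
  rw [← LinearMap.comp_apply, LinearMap.lTensor_comp_rTensor, ← LinearMap.comp_apply,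
    LinearMap.rTensor_comp_lTensor]

variable {𝒳} in
theorem IsLeibniz.tensor {μ : X →ₗ[K] X →ₗ[K] X} (h : IsLeibniz 𝒳 μ) (h𝒜 : Supercommutative 𝒜) :
    IsLeibniz (tensorGrading 𝒳 𝒜) (tensorBracket 𝒳 𝒜 μ) where
  graded := by
    intro α β s hs t ht
    have key : ∀ α₁ α₂, ∀ x ∈ 𝒳 α₁, ∀ a ∈ 𝒜 α₂, ∀ β, ∀ t ∈ tensorGrading 𝒳 𝒜 β,
        tensorBracket 𝒳 𝒜 μ (x ⊗ₜ a) t ∈ tensorGrading 𝒳 𝒜 ((α₁ + α₂) + β) := by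
      intro α₁ α₂ x hx a ha
      refine mem_endGrading_tensor fun β₁ β₂ y hy b hb => ?_
      rw [tensorBracket_tmul 𝒳 𝒜 μ x ha hy b, add_add_add_comm]
      exact zsmul_mem (tmul_mem_tensorGrading (h.graded _ _ _ hx _ hy)
        (SetLike.GradedMul.mul_mem ha hb)) _
    induction hs using Submodule.span_induction with
    | mem s h' =>
      obtain ⟨α₁, α₂, rfl, x, hx, a, ha, rfl⟩ := h'
      exact key α₁ α₂ x hx a ha β t ht
    | zero => simp
    | add s s' _ _ hs hs' => rw [map_add, LinearMap.add_apply]; exact add_mem hs hs'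
    | smul c s _ hs => rw [map_smul, LinearMap.smul_apply]; exact Submodule.smul_mem _ c hs
  jacobi := by
    have key : ∀ α₁ α₂ β₁ β₂, ∀ x ∈ 𝒳 α₁, ∀ a ∈ 𝒜 α₂, ∀ y ∈ 𝒳 β₁, ∀ b ∈ 𝒜 β₂, ∀ r,
        tensorBracket 𝒳 𝒜 μ (x ⊗ₜ a) (tensorBracket 𝒳 𝒜 μ (y ⊗ₜ b) r) =
        tensorBracket 𝒳 𝒜 μ (tensorBracket 𝒳 𝒜 μ (x ⊗ₜ a) (y ⊗ₜ b)) r +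
        sgn (α₁ + α₂) (β₁ + β₂) • tensorBracket 𝒳 𝒜 μ (y ⊗ₜ b)
          (tensorBracket 𝒳 𝒜 μ (x ⊗ₜ a) r) := by
      intro α₁ α₂ β₁ β₂ x hx a ha y hy b hb r
      have hext : tensorBracket 𝒳 𝒜 μ (x ⊗ₜ a) ∘ₗ tensorBracket 𝒳 𝒜 μ (y ⊗ₜ b) =
          tensorBracket 𝒳 𝒜 μ (tensorBracket 𝒳 𝒜 μ (x ⊗ₜ a) (y ⊗ₜ b)) +
          sgn (α₁ + α₂) (β₁ + β₂) • (tensorBracket 𝒳 𝒜 μ (y ⊗ₜ b) ∘ₗ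
            tensorBracket 𝒳 𝒜 μ (x ⊗ₜ a)) := by
        refine tensor_ext 𝒳 𝒜 fun γ₁ γ₂ z hz c hc => ?_
        simp only [LinearMap.add_apply, LinearMap.smul_apply, LinearMap.comp_apply]
        rw [tensorBracket_tmul 𝒳 𝒜 μ y hb hz c, tensorBracket_tmul 𝒳 𝒜 μ x ha hz c,
          tensorBracket_tmul 𝒳 𝒜 μ x ha hy b]
        simp only [map_zsmul, LinearMap.smul_apply]
        -- Supercommutativity enters here: the last Jacobi term has coefficient `b * a * c`, the
        -- other two `a * b * c`.
        rw [tensorBracket_tmul 𝒳 𝒜 μ x ha (h.graded _ _ _ hy _ hz),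
          tensorBracket_tmul 𝒳 𝒜 μ y hb (h.graded _ _ _ hx _ hz),
          tensorBracket_tmul 𝒳 𝒜 μ _ (SetLike.GradedMul.mul_mem ha hb) hz,
          h.jacobi _ _ x hx y hy z, TensorProduct.add_tmul, ← mul_assoc b a c,
          h𝒜 _ _ b hb a ha, mul_assoc a b c]
        simp only [smul_mul_assoc, mul_assoc, TensorProduct.tmul_smul, TensorProduct.smul_tmul',
          smul_smul, smul_add]
        have e1 : ∀ a b y z : ZMod 2, sgn b z * sgn a (y + z) = sgn a y * sgn (a + b) z := by
          decide
        have e2 : ∀ a b x y z : ZMod 2, sgn b z * (sgn a (y + z) * sgn x y) =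
            sgn (x + a) (y + b) * (sgn a z * (sgn b (x + z) * sgn b a)) := by decide
        rw [← e1, e2]
      exact LinearMap.congr_fun hext r
    intro α β s hs t ht r
    induction hs using Submodule.span_induction with
    | mem s h' =>
      obtain ⟨α₁, α₂, rfl, x, hx, a, ha, rfl⟩ := h'
      induction ht using Submodule.span_induction with
      | mem s h' =>
        obtain ⟨β₁, β₂, rfl, y, hy, b, hb, rfl⟩ := h'
        exact key α₁ α₂ β₁ β₂ x hx a ha y hy b hb r
      | zero => simp
      | add t t' _ _ ht ht' =>
        simp only [map_add, LinearMap.add_apply, ht, ht', smul_add]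
        abel
      | smul c t _ ht =>
        simp only [map_smul, LinearMap.smul_apply, ht, smul_add]
        rw [smul_comm]
    | zero => simp
    | add s s' _ _ hs hs' =>
      simp only [map_add, LinearMap.add_apply, hs, hs', smul_add]
      abel
    | smul c s _ hs =>
      simp only [map_smul, LinearMap.smul_apply, hs, smul_add]
      rw [smul_comm]

/-! ### Extending derivations of the coefficient algebra -/

theorem tensorLift_mem_endGrading {α : ZMod 2} {Δ : Module.End K A} (hΔ : Δ ∈ endGrading 𝒜 α) :
    tensorLift 𝒳 𝒜 Δ ∈ endGrading (tensorGrading 𝒳 𝒜) α := by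
  refine mem_endGrading_tensor fun β γ x hx a ha => ?_
  rw [tensorLift_tmul 𝒳 𝒜 hΔ hx, add_left_comm]
  exact zsmul_mem (tmul_mem_tensorGrading hx (hΔ _ _ ha)) _

variable {𝒳} in
theorem IsLeibniz.tensorLift_mem_derDeg {μ : X →ₗ[K] X →ₗ[K] X} (h : IsLeibniz 𝒳 μ) {δ : ZMod 2}
    {Δ : Module.End K A} (hΔ : Δ ∈ derDeg 𝒜 (LinearMap.mul K A) δ) :
    tensorLift 𝒳 𝒜 Δ ∈ derDeg (tensorGrading 𝒳 𝒜) (tensorBracket 𝒳 𝒜 μ) δ := by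
  refine ⟨tensorLift_mem_endGrading 𝒳 𝒜 hΔ.1, fun γ s hs t => ?_⟩
  induction hs using Submodule.span_induction with
  | mem s h' =>
    obtain ⟨α₁, α₂, rfl, x, hx, a, ha, rfl⟩ := h'
    have hext : tensorLift 𝒳 𝒜 Δ ∘ₗ tensorBracket 𝒳 𝒜 μ (x ⊗ₜ a) =
        tensorBracket 𝒳 𝒜 μ (tensorLift 𝒳 𝒜 Δ (x ⊗ₜ a)) +
        sgn δ (α₁ + α₂) • (tensorBracket 𝒳 𝒜 μ (x ⊗ₜ a) ∘ₗ tensorLift 𝒳 𝒜 Δ) := by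
      refine tensor_ext 𝒳 𝒜 fun β₁ β₂ y hy b hb => ?_
      simp only [LinearMap.add_apply, LinearMap.smul_apply, LinearMap.comp_apply]
      rw [tensorBracket_tmul 𝒳 𝒜 μ x ha hy b, tensorLift_tmul 𝒳 𝒜 hΔ.1 hx,
        tensorLift_tmul 𝒳 𝒜 hΔ.1 hy]
      simp only [map_zsmul, LinearMap.smul_apply]
      have hΔm := hΔ.2 _ a ha b
      simp only [LinearMap.mul_apply'] at hΔm
      rw [tensorLift_tmul 𝒳 𝒜 hΔ.1 (h.graded _ _ _ hx _ hy),
        tensorBracket_tmul 𝒳 𝒜 μ x (hΔ.1 _ _ ha) hy, tensorBracket_tmul 𝒳 𝒜 μ x ha hy, hΔm,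
        TensorProduct.tmul_add]
      simp only [TensorProduct.tmul_smul, smul_smul, smul_add]
      have e1 : ∀ a d x y : ZMod 2, sgn a y * sgn d (x + y) = sgn d x * sgn (d + a) y := by
        decide
      have e2 : ∀ a d x y : ZMod 2, sgn a y * (sgn d (x + y) * sgn d a) =
          sgn d (x + a) * (sgn d y * sgn a y) := by
        decide
      rw [← e1, e2]
    exact LinearMap.congr_fun hext t
  | zero => simp
  | add s s' _ _ hs hs' =>
    simp only [map_add, LinearMap.add_apply, hs, hs', smul_add]
    abel
  | smul c s _ hs =>
    simp only [map_smul, LinearMap.smul_apply, hs, smul_add]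
    rw [smul_comm]

theorem tensorLift_superBracket (Δ Γ : Module.End K A) :
    tensorLift 𝒳 𝒜 (superBracket 𝒜 Δ Γ) =
      superBracket (tensorGrading 𝒳 𝒜) (tensorLift 𝒳 𝒜 Δ) (tensorLift 𝒳 𝒜 Γ) := by
  have key : ∀ α β, ∀ Δ ∈ endGrading 𝒜 α, ∀ Γ ∈ endGrading 𝒜 β,
      tensorLift 𝒳 𝒜 (superBracket 𝒜 Δ Γ) =
      superBracket (tensorGrading 𝒳 𝒜) (tensorLift 𝒳 𝒜 Δ) (tensorLift 𝒳 𝒜 Γ) := by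
    intro α β Δ hΔ Γ hΓ
    rw [superBracket_of_mem _ (tensorLift_mem_endGrading 𝒳 𝒜 hΔ)
      (tensorLift_mem_endGrading 𝒳 𝒜 hΓ)]
    refine tensor_ext 𝒳 𝒜 fun γ ε x hx a ha => ?_
    rw [tensorLift_tmul 𝒳 𝒜 (superBracket_mem_endGrading 𝒜 hΔ hΓ) hx,
      superBracket_of_mem _ hΔ hΓ]
    simp only [LinearMap.sub_apply, LinearMap.smul_apply, Module.End.mul_apply,
      tensorLift_tmul 𝒳 𝒜 hΔ hx, tensorLift_tmul 𝒳 𝒜 hΓ hx, map_zsmul, TensorProduct.tmul_sub,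
      TensorProduct.tmul_smul, smul_smul, smul_sub]
    have e1 : ∀ α β γ : ZMod 2, sgn (α + β) γ = sgn β γ * sgn α γ := by decide
    have e2 : ∀ α β γ : ZMod 2, sgn (α + β) γ * sgn α β = sgn α β * (sgn α γ * sgn β γ) := by
      decide
    rw [e2, e1]
  have key2 : ∀ α, ∀ Δ ∈ endGrading 𝒜 α, ∀ Γ, tensorLift 𝒳 𝒜 (superBracket 𝒜 Δ Γ) =
      superBracket (tensorGrading 𝒳 𝒜) (tensorLift 𝒳 𝒜 Δ) (tensorLift 𝒳 𝒜 Γ) := by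
    intro α Δ hΔ Γ
    have : tensorLift 𝒳 𝒜 ∘ₗ superBracket 𝒜 Δ =
        superBracket (tensorGrading 𝒳 𝒜) (tensorLift 𝒳 𝒜 Δ) ∘ₗ tensorLift 𝒳 𝒜 := by
      refine end_ext (endGrading 𝒜) fun β Γ hΓ => ?_
      rw [LinearMap.comp_apply, LinearMap.comp_apply, key α β Δ hΔ Γ hΓ]
    rw [← LinearMap.comp_apply, this, LinearMap.comp_apply]
  have key3 : tensorLift 𝒳 𝒜 ∘ₗ (superBracket 𝒜).flip Γ =
      (superBracket (tensorGrading 𝒳 𝒜)).flip (tensorLift 𝒳 𝒜 Γ) ∘ₗ tensorLift 𝒳 𝒜 := by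
    refine end_ext (endGrading 𝒜) fun α Δ hΔ => ?_
    rw [LinearMap.comp_apply, LinearMap.comp_apply, LinearMap.flip_apply, LinearMap.flip_apply,
      key2 α Δ hΔ]
  rw [← LinearMap.flip_apply, ← LinearMap.comp_apply, key3, LinearMap.comp_apply,
    LinearMap.flip_apply]

theorem tensorLift_tmul_even (Δ : Module.End K A) {x : X} (hx : x ∈ 𝒳 0) (a : A) :
    tensorLift 𝒳 𝒜 Δ (x ⊗ₜ a) = x ⊗ₜ Δ a := by
  rw [← sum_part (endGrading 𝒜) Δ]
  simp only [map_sum, LinearMap.sum_apply, TensorProduct.tmul_sum]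
  refine Finset.sum_congr rfl fun α _ => ?_
  rw [tensorLift_tmul 𝒳 𝒜 (part_mem _ _ _) hx, sgn_zero_right, one_smul]

theorem map_tensorLift_eq_iSup : (der 𝒜 (LinearMap.mul K A)).map (tensorLift 𝒳 𝒜) =
    ⨆ α, (derDeg 𝒜 (LinearMap.mul K A) α).map (tensorLift 𝒳 𝒜) := by
  rw [der, Submodule.map_iSup]

theorem isSubalgebra_map_tensorLift :
    IsSubalgebra (tensorGrading 𝒳 𝒜) ((der 𝒜 (LinearMap.mul K A)).map (tensorLift 𝒳 𝒜)) := by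
  rw [map_tensorLift_eq_iSup]
  refine isSubalgebra_iSup _ _ ?_ ?_
  · rintro α _ ⟨Δ, hΔ, rfl⟩
    exact tensorLift_mem_endGrading 𝒳 𝒜 hΔ.1
  · rintro α β _ ⟨Δ, hΔ, rfl⟩ _ ⟨Γ, hΓ, rfl⟩
    rw [← tensorLift_superBracket]
    exact Submodule.mem_iSup_of_mem (α + β) ⟨_, superBracket_mem_derDeg 𝒜 hΔ hΓ, rfl⟩

/-- Apply the derivation rule to 1 = 1 · 1. -/
theorem derDeg_apply_one {δ : ZMod 2} {Δ : Module.End K A}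
    (hΔ : Δ ∈ derDeg 𝒜 (LinearMap.mul K A) δ) : Δ 1 = 0 := by
  have := hΔ.2 0 1 SetLike.GradedOne.one_mem 1
  simpa [sgn_zero_right] using this

/-- This separates the lifts from the inner derivations. -/
theorem tensorLift_tmul_one {Δ : Module.End K A} (hΔ : Δ ∈ der 𝒜 (LinearMap.mul K A)) (x : X) :
    tensorLift 𝒳 𝒜 Δ (x ⊗ₜ 1) = 0 := by
  rw [← sum_part (endGrading 𝒜) Δ, ← sum_part 𝒳 x]
  simp only [map_sum, LinearMap.sum_apply, TensorProduct.sum_tmul]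
  refine Finset.sum_eq_zero fun α _ => Finset.sum_eq_zero fun β _ => ?_
  rw [tensorLift_tmul 𝒳 𝒜 (part_mem _ _ _) (part_mem _ _ _),
    derDeg_apply_one 𝒜 (part_mem_derDeg 𝒜 hΔ _), TensorProduct.tmul_zero, smul_zero]

end TensorBracket

section Semidirect

variable {K : Type*} [Field K] {X : Type*} [AddCommGroup X] [Module K X]
  {A : Type*} [Ring A] [Algebra K A]
  (𝒜 : ZMod 2 → Submodule K A) [GradedAlgebra 𝒜]

/-! ### Derivations of the tensor product with a superextension -/

/-- An arbitrary functional φ is not homogeneous; projecting the coefficients to degree β first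
makes the contraction homogeneous. -/
theorem slice_lTensor_part_mem (𝒳 : ZMod 2 → Submodule K X) (φ : A →ₗ[K] K) (β : ZMod 2) :
    ∀ δ, ∀ t ∈ tensorGrading 𝒳 𝒜 δ, slice X φ ((part 𝒜 β).lTensor X t) ∈ 𝒳 (β + δ) := by
  refine mem_endGrading_tensor (f := slice X φ ∘ₗ (part 𝒜 β).lTensor X)
    fun α γ x hx a ha => ?_
  simp only [LinearMap.comp_apply, LinearMap.lTensor_tmul, slice_tmul]
  by_cases h : γ = β
  · subst h
    have : ∀ γ α : ZMod 2, γ + (α + γ) = α := by decide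
    rw [this]
    exact Submodule.smul_mem _ _ hx
  · rw [part_ne _ ha h, map_zero, zero_smul]
    exact zero_mem _

variable {𝒳 : ZMod 2 → Submodule K X} [DirectSum.Decomposition 𝒳]

/-- A centreless Leibniz superalgebra without outer derivations whose only endomorphisms as a module
over itself are the scalars and whose even part is not abelian. -/
structure IsCompleteCentral (𝒳 : ZMod 2 → Submodule K X) (μ : X →ₗ[K] X →ₗ[K] X) : Prop
    extends IsLeibniz 𝒳 μ where
  injective : Function.Injective μ
  derDeg_le : ∀ α, derDeg 𝒳 μ α ≤ inner μ
  centroid : ∀ f : Module.End K X, (∀ x y, f (μ x y) = μ x (f y)) → ∃ c : K, ∀ x, f x = c • x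
  even_nonabelian : ∃ x ∈ 𝒳 0, ∃ y ∈ 𝒳 0, μ x y ≠ 0

/-- The sign change `x ↦ (-1) ^ (α |x|) x`. -/
noncomputable def signTwist (𝒳 : ZMod 2 → Submodule K X) [DirectSum.Decomposition 𝒳]
    (α : ZMod 2) : Module.End K X :=
  ∑ γ, sgn α γ • part 𝒳 γ

theorem signTwist_of_mem (α : ZMod 2) {γ : ZMod 2} {x : X} (hx : x ∈ 𝒳 γ) :
    signTwist 𝒳 α x = sgn α γ • x := by
  rw [signTwist, LinearMap.sum_apply, Finset.sum_eq_single γ]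
  · rw [LinearMap.smul_apply, part_same _ hx]
  · intro δ _ hδ
    rw [LinearMap.smul_apply, part_ne _ hx hδ.symm, smul_zero]
  · simp

/-- The contractions of the restriction of a derivation of `X ⊗ A` to `X ⊗ 1` are derivations. -/
theorem slice_comp_mem_derDeg {μ : X →ₗ[K] X →ₗ[K] X} (h : IsLeibniz 𝒳 μ) {α : ZMod 2}
    {d : Module.End K (X ⊗[K] A)}
    (hd : d ∈ derDeg (tensorGrading 𝒳 𝒜) (tensorBracket 𝒳 𝒜 μ) α) (β : ZMod 2)
    (φ : A →ₗ[K] K) :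
    slice X φ ∘ₗ (part 𝒜 β).lTensor X ∘ₗ d ∘ₗ (TensorProduct.mk K X A).flip 1 ∘ₗ signTwist 𝒳 β ∈
      derDeg 𝒳 μ (α + β) := by
  set S := slice X φ ∘ₗ (part 𝒜 β).lTensor X with hS
  set D := slice X φ ∘ₗ (part 𝒜 β).lTensor X ∘ₗ d ∘ₗ (TensorProduct.mk K X A).flip 1 ∘ₗ
    signTwist 𝒳 β with hDdef
  have hD : ∀ γ, ∀ x ∈ 𝒳 γ, D x = sgn β γ • S (d (x ⊗ₜ 1)) := by
    intro γ x hx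
    simp only [hDdef, hS, LinearMap.comp_apply, signTwist_of_mem β hx, map_zsmul,
      LinearMap.flip_apply, TensorProduct.mk_apply]
  refine ⟨fun γ x hx => ?_, fun γ x hx y => ?_⟩
  · rw [hD γ x hx]
    have h1 := slice_lTensor_part_mem 𝒜 𝒳 φ β _ _ (hd.1 γ _ (tmul_one_mem_tensorGrading 𝒜 hx))
    rw [add_comm α, add_assoc]
    exact zsmul_mem h1 _
  -- On coefficients of degree β, right multiplication by y ⊗ 1 contracts to right multiplication by
  -- y up to the sign that `signTwist` is there to cancel.
  · have hright : ∀ δ, ∀ y ∈ 𝒳 δ, ∀ t, S (tensorBracket 𝒳 𝒜 μ t (y ⊗ₜ 1)) =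
        sgn β δ • μ (S t) y := by
      intro δ y hy t
      rw [tensorBracket_tmul_one 𝒳 𝒜 μ hy]
      simp only [hS, LinearMap.comp_apply, map_sum, map_zsmul, lTensor_rTensor, slice_rTensor,
        lTensor_part_comp]
      rw [Finset.sum_eq_single β]
      · simp
      · intro γ _ hγ
        simp [hγ.symm]
      · simp
    have hleft : ∀ x t, S (tensorBracket 𝒳 𝒜 μ (x ⊗ₜ 1) t) = μ x (S t) := by
      intro x t
      rw [tensorBracket_one_tmul]
      simp only [hS, LinearMap.comp_apply, lTensor_rTensor, slice_rTensor]
    have hext : D ∘ₗ μ x = μ (D x) + sgn (α + β) γ • (μ x ∘ₗ D) := by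
      refine end_ext 𝒳 fun δ y hy => ?_
      simp only [LinearMap.add_apply, LinearMap.smul_apply, LinearMap.comp_apply]
      rw [hD _ _ (h.graded _ _ _ hx _ hy), hD _ x hx, hD _ y hy]
      have h1 : μ x y ⊗ₜ[K] (1 : A) = tensorBracket 𝒳 𝒜 μ (x ⊗ₜ 1) (y ⊗ₜ 1) := by
        rw [tensorBracket_one_tmul, LinearMap.rTensor_tmul]
      rw [h1, hd.2 γ _ (tmul_one_mem_tensorGrading 𝒜 hx), map_add, map_zsmul, hright δ y hy, hleft]
      simp only [map_zsmul, LinearMap.smul_apply, smul_add, smul_smul]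
      have e1 : ∀ β γ δ : ZMod 2, sgn β (γ + δ) * sgn β δ = sgn β γ := by decide
      have e2 : ∀ α β γ δ : ZMod 2, sgn β (γ + δ) * sgn α γ = sgn (α + β) γ * sgn β δ := by
        decide
      rw [e1, e2]
    have := LinearMap.congr_fun hext y
    simpa only [LinearMap.add_apply, LinearMap.smul_apply, LinearMap.comp_apply] using this

theorem eq_on_tmul_one {Y : Type*} [AddCommGroup Y] [Module K Y]
    {f g : X ⊗[K] A →ₗ[K] Y} (h : ∀ γ, ∀ x ∈ 𝒳 γ, f (x ⊗ₜ 1) = g (x ⊗ₜ 1)) (x : X) :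
    f (x ⊗ₜ 1) = g (x ⊗ₜ 1) := by
  rw [← sum_part 𝒳 x]
  simp only [TensorProduct.sum_tmul, map_sum]
  exact Finset.sum_congr rfl fun γ _ => h γ _ (part_mem _ _ _)

variable {𝒜} in
/-- A derivation of `X ⊗ A` agrees with an inner derivation on `X ⊗ 1`. -/
theorem IsCompleteCentral.exists_tensorBracket_eq [Module.Finite K X] {μ : X →ₗ[K] X →ₗ[K] X}
    (h : IsCompleteCentral 𝒳 μ) {α : ZMod 2} {d : Module.End K (X ⊗[K] A)}
    (hd : d ∈ derDeg (tensorGrading 𝒳 𝒜) (tensorBracket 𝒳 𝒜 μ) α) (h𝒜 : Supercommutative 𝒜) :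
    ∃ z ∈ tensorGrading 𝒳 𝒜 α, ∀ x, d (x ⊗ₜ 1) = tensorBracket 𝒳 𝒜 μ z (x ⊗ₜ 1) := by
  have h1 : ∀ β, ∃ z : X ⊗[K] A, ∀ x, (part 𝒜 β).lTensor X (d (signTwist 𝒳 β x ⊗ₜ 1)) =
      (μ.flip x).rTensor A z := by
    intro β
    obtain ⟨z, hz⟩ := exists_rTensor_eq μ h.injective
      ((part 𝒜 β).lTensor X ∘ₗ d ∘ₗ (TensorProduct.mk K X A).flip 1 ∘ₗ signTwist 𝒳 β)
      fun φ => h.derDeg_le _ (slice_comp_mem_derDeg 𝒜 h.toIsLeibniz hd β φ)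
    exact ⟨z, hz⟩
  choose Z hZ using h1
  -- `Z β` comes without control of its coefficients, so only those of degree β are kept; the sign
  -- of right multiplication by x ⊗ 1 then undoes the twist.
  have h2 : ∀ γ, ∀ x ∈ 𝒳 γ, d (x ⊗ₜ 1) =
      tensorBracket 𝒳 𝒜 μ (∑ β, (part 𝒜 β).lTensor X (Z β)) (x ⊗ₜ 1) := by
    intro γ x hx
    rw [tensorBracket_tmul_one 𝒳 𝒜 μ hx]
    conv_lhs => rw [← sum_lTensor_part 𝒜 (d (x ⊗ₜ 1))]
    refine Finset.sum_congr rfl fun β _ => ?_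
    rw [map_sum, Finset.sum_eq_single β]
    · rw [lTensor_part_comp, if_pos rfl, ← lTensor_rTensor, ← hZ β x, lTensor_part_comp, if_pos rfl,
        signTwist_of_mem β hx, ← TensorProduct.smul_tmul', map_zsmul, map_zsmul, sgn_smul_sgn_smul]
    · intro β' _ hβ'
      rw [lTensor_part_comp, if_neg hβ'.symm]
    · simp
  have hT := h.toIsLeibniz.tensor 𝒜 h𝒜
  -- Since d has degree α, the components of the sum in other degrees act trivially on X ⊗ 1 and can
  -- be dropped.
  refine ⟨part (tensorGrading 𝒳 𝒜) α (∑ β, (part 𝒜 β).lTensor X (Z β)), part_mem _ _ _, ?_⟩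
  refine eq_on_tmul_one (𝒳 := 𝒳) (f := d)
    (g := tensorBracket 𝒳 𝒜 μ (part (tensorGrading 𝒳 𝒜) α _)) fun γ x hx => ?_
  have hx' := tmul_one_mem_tensorGrading 𝒜 hx
  have h3 := apply_part (tensorGrading 𝒳 𝒜) (tensorGrading 𝒳 𝒜) (α := γ)
    ((tensorBracket 𝒳 𝒜 μ).flip (x ⊗ₜ 1))
    (fun β t ht => by
      rw [LinearMap.flip_apply, add_comm]
      exact hT.graded _ _ _ ht _ hx') α (∑ β, (part 𝒜 β).lTensor X (Z β))
  simp only [LinearMap.flip_apply] at h3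
  rw [h3, ← h2 γ x hx, add_comm γ α, part_same _ (hd.1 _ _ hx')]

variable {𝒜} in
/-- A derivation of `X ⊗ A` that vanishes on `X ⊗ 1` is induced by a derivation of `A`. -/
theorem IsCompleteCentral.exists_tensorLift_eq {μ : X →ₗ[K] X →ₗ[K] X}
    (h : IsCompleteCentral 𝒳 μ) {α : ZMod 2} {d : Module.End K (X ⊗[K] A)}
    (hd : d ∈ derDeg (tensorGrading 𝒳 𝒜) (tensorBracket 𝒳 𝒜 μ) α)
    (hd1 : ∀ x : X, d (x ⊗ₜ 1) = 0) :
    ∃ Δ ∈ derDeg 𝒜 (LinearMap.mul K A) α, tensorLift 𝒳 𝒜 Δ = d := by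
  obtain ⟨x₀, hx₀, y₀, hy₀, hw₀⟩ := h.even_nonabelian
  have hw₀' : μ x₀ y₀ ∈ 𝒳 0 := by
    have := h.graded _ _ _ hx₀ _ hy₀
    rwa [add_zero] at this
  obtain ⟨ξ', hξ'⟩ := Module.Projective.exists_dual_ne_zero K hw₀
  set ξ := (ξ' (μ x₀ y₀))⁻¹ • ξ' with hξdef
  have hξ : ξ (μ x₀ y₀) = 1 := by
    rw [hξdef, LinearMap.smul_apply, smul_eq_mul, inv_mul_cancel₀ hξ']
  -- Δ is read off at one even vector. Choosing a nonzero product of even elements makes the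
  -- derivation rule for Δ visible later, without signs.
  set Δ : Module.End K A := sliceLeft A ξ ∘ₗ d ∘ₗ TensorProduct.mk K X A (μ x₀ y₀) with hΔ
  have hadx : ∀ γ, ∀ x ∈ 𝒳 γ, ∀ t, d (tensorBracket 𝒳 𝒜 μ (x ⊗ₜ 1) t) =
      sgn α γ • tensorBracket 𝒳 𝒜 μ (x ⊗ₜ 1) (d t) := by
    intro γ x hx t
    rw [hd.2 γ _ (tmul_one_mem_tensorGrading 𝒜 hx), hd1, map_zero, LinearMap.zero_apply, zero_add]
  have key : ∀ y b, d (signTwist 𝒳 α y ⊗ₜ b) = y ⊗ₜ Δ b := by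
    intro y b
    refine eq_of_slice_eq fun φ => ?_
    -- The twist removes the sign with which d commutes with ad(x ⊗ 1), so f commutes with every ad
    -- x on the nose and is a scalar.
    set f : Module.End K X :=
      slice X φ ∘ₗ d ∘ₗ (TensorProduct.mk K X A).flip b ∘ₗ signTwist 𝒳 α with hf
    have hfa : ∀ y, f y = slice X φ (d (signTwist 𝒳 α y ⊗ₜ b)) := fun y => rfl
    have hcomm : ∀ γ, ∀ x ∈ 𝒳 γ, ∀ δ, ∀ y ∈ 𝒳 δ, f (μ x y) = μ x (f y) := by
      intro γ x hx δ y hy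
      have h1 : d (μ x y ⊗ₜ[K] b) = sgn α γ • tensorBracket 𝒳 𝒜 μ (x ⊗ₜ 1) (d (y ⊗ₜ b)) := by
        rw [← hadx γ x hx, tensorBracket_one_tmul, LinearMap.rTensor_tmul]
      have e : ∀ α γ δ : ZMod 2, sgn α (γ + δ) * sgn α γ = sgn α δ := by decide
      rw [hfa, hfa, signTwist_of_mem α (h.graded _ _ _ hx _ hy), signTwist_of_mem α hy]
      simp only [← TensorProduct.smul_tmul', map_zsmul]
      rw [h1, map_zsmul, smul_smul, e, tensorBracket_one_tmul, slice_rTensor]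
    have hcomm' : ∀ x y, f (μ x y) = μ x (f y) := by
      intro x y
      rw [← sum_part 𝒳 x, ← sum_part 𝒳 y]
      simp only [map_sum, LinearMap.sum_apply]
      exact Finset.sum_congr rfl fun γ _ => Finset.sum_congr rfl fun δ _ =>
        hcomm _ _ (part_mem _ _ _) _ _ (part_mem _ _ _)
    obtain ⟨c, hc⟩ := h.centroid f hcomm'
    -- Evaluating at `μ x₀ y₀`, where ξ equals 1, identifies the scalar.
    have hc' : c = φ (Δ b) := by
      have h1 := congrArg ξ (hc (μ x₀ y₀))
      rw [map_smul, hξ, smul_eq_mul, mul_one, hfa, signTwist_of_mem α hw₀', sgn_zero_right,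
        one_smul, apply_slice] at h1
      rw [← h1, hΔ]
      rfl
    rw [← hfa, hc, hc', slice_tmul]
  have keyeven : ∀ y ∈ 𝒳 0, ∀ b, d (y ⊗ₜ b) = y ⊗ₜ Δ b := by
    intro y hy b
    rw [← key, signTwist_of_mem α hy, sgn_zero_right, one_smul]
  have hΔdeg : Δ ∈ endGrading 𝒜 α := by
    intro β b hb
    have h1 := hd.1 _ _ (tmul_mem_tensorGrading hw₀' hb)
    rw [keyeven _ hw₀', zero_add] at h1
    have h2 : part (tensorGrading 𝒳 𝒜) (α + β) (μ x₀ y₀ ⊗ₜ Δ b) =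
        μ x₀ y₀ ⊗ₜ part 𝒜 (α + β) (Δ b) := by
      have h3 := apply_part 𝒜 (tensorGrading 𝒳 𝒜) (α := 0) (TensorProduct.mk K X A (μ x₀ y₀))
        (fun γ a ha => tmul_mem_tensorGrading hw₀' ha) (α + β) (Δ b)
      rw [zero_add] at h3
      exact h3.symm
    rw [part_same _ h1] at h2
    rw [tmul_right_injective hw₀ h2]
    exact part_mem _ _ _
  refine ⟨Δ, ⟨hΔdeg, fun β a ha b => ?_⟩, ?_⟩
  -- Apply d to [x₀ ⊗ a, y₀ ⊗ b] = [x₀, y₀] ⊗ ab and cancel the nonzero factor [x₀, y₀].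
  · have h1 := hd.2 β (x₀ ⊗ₜ a) (by
      have := tmul_mem_tensorGrading hx₀ ha
      rwa [zero_add] at this) (y₀ ⊗ₜ b)
    rw [tensorBracket_tmul_even 𝒳 𝒜 μ x₀ a hy₀, keyeven _ hw₀', keyeven _ hx₀, keyeven _ hy₀,
      tensorBracket_tmul_even 𝒳 𝒜 μ _ _ hy₀, tensorBracket_tmul_even 𝒳 𝒜 μ _ _ hy₀,
      ← TensorProduct.tmul_smul, ← TensorProduct.tmul_add] at h1
    exact tmul_right_injective hw₀ h1
  · refine tensor_ext 𝒳 𝒜 fun γ β x hx a _ => ?_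
    rw [tensorLift_tmul 𝒳 𝒜 hΔdeg hx, ← key, signTwist_of_mem α hx, ← TensorProduct.smul_tmul',
      map_zsmul, sgn_smul_sgn_smul]

/-- Each contraction of each coefficient-degree component of z annihilates X up to sign, hence is
zero because X is centreless. -/
theorem IsCompleteCentral.eq_zero_of_tensorBracket_tmul_one {μ : X →ₗ[K] X →ₗ[K] X}
    (h : IsCompleteCentral 𝒳 μ) {z : X ⊗[K] A}
    (hz : ∀ x, tensorBracket 𝒳 𝒜 μ z (x ⊗ₜ 1) = 0) : z = 0 := by
  rw [← sum_lTensor_part 𝒜 z]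
  refine Finset.sum_eq_zero fun β _ => ?_
  refine eq_of_slice_eq fun φ => ?_
  apply h.injective
  rw [map_zero, map_zero]
  refine end_ext 𝒳 fun γ x hx => ?_
  have h1 := congrArg (fun t => slice X φ ((part 𝒜 β).lTensor X t)) (hz x)
  simp only [tensorBracket_tmul_one 𝒳 𝒜 μ hx, map_sum, map_zsmul, lTensor_rTensor,
    slice_rTensor, lTensor_part_comp, map_zero] at h1
  rw [Finset.sum_eq_single β] at h1
  · rw [if_pos rfl] at h1
    have h2 := congrArg (sgn β γ • ·) h1
    simp only [sgn_smul_sgn_smul, smul_zero] at h2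
    exact h2
  · intro β' _ hβ'
    rw [if_neg hβ'.symm]
    simp
  · simp

/-- The derivations of `X ⊗ A` are the semidirect product of the inner derivations and the
derivations of `A`. -/
theorem IsCompleteCentral.isSemidirect [Module.Finite K X] {μ : X →ₗ[K] X →ₗ[K] X}
    (h : IsCompleteCentral 𝒳 μ) (h𝒜 : Supercommutative 𝒜) :
    IsSemidirect (tensorGrading 𝒳 𝒜) (der (tensorGrading 𝒳 𝒜) (tensorBracket 𝒳 𝒜 μ))
      (inner (tensorBracket 𝒳 𝒜 μ)) ((der 𝒜 (LinearMap.mul K A)).map (tensorLift 𝒳 𝒜)) where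
  subalgebra := isSubalgebra_der _ _
  ideal_subalgebra := (h.toIsLeibniz.tensor 𝒜 h𝒜).isSubalgebra_inner
  ideal := by
    rintro d hd _ ⟨z, rfl⟩
    exact ⟨d z, ((h.toIsLeibniz.tensor 𝒜 h𝒜).superBracket_ad hd z).symm⟩
  complement_subalgebra := isSubalgebra_map_tensorLift 𝒳 𝒜
  disjoint := by
    rw [eq_bot_iff]
    rintro _ ⟨⟨z, rfl⟩, ⟨Δ, hΔ, hz⟩⟩
    have : z = 0 := h.eq_zero_of_tensorBracket_tmul_one 𝒜 fun x => by
      rw [← hz, tensorLift_tmul_one 𝒳 𝒜 hΔ]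
    rw [this, map_zero]
    exact zero_mem _
  sup_eq := by
    apply le_antisymm
    · refine sup_le (h.toIsLeibniz.tensor 𝒜 h𝒜).inner_le_der ?_
      rw [map_tensorLift_eq_iSup]
      refine iSup_le fun α => ?_
      rintro _ ⟨Δ, hΔ, rfl⟩
      exact derDeg_le_der _ _ α (h.toIsLeibniz.tensorLift_mem_derDeg 𝒜 hΔ)
    · refine iSup_le fun α d hd => ?_
      obtain ⟨z, hz, hzd⟩ := h.exists_tensorBracket_eq hd h𝒜
      obtain ⟨Δ, hΔ, hΔd⟩ := h.exists_tensorLift_eq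
        (sub_mem hd ((h.toIsLeibniz.tensor 𝒜 h𝒜).ad_mem_derDeg hz))
        (fun x => by rw [LinearMap.sub_apply, hzd, sub_self])
      rw [← add_sub_cancel (tensorBracket 𝒳 𝒜 μ z) d, ← hΔd]
      exact Submodule.add_mem_sup ⟨z, rfl⟩ ⟨Δ, derDeg_le_der 𝒜 _ α hΔ, rfl⟩

theorem IsCompleteCentral.isEmbedding {μ : X →ₗ[K] X →ₗ[K] X} (h : IsCompleteCentral 𝒳 μ) :
    IsEmbedding 𝒜 (der 𝒜 (LinearMap.mul K A)) (tensorGrading 𝒳 𝒜) (tensorLift 𝒳 𝒜) where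
  even := by
    intro α d _ hd
    exact tensorLift_mem_endGrading 𝒳 𝒜 hd
  bracket := by
    intro d _ e _
    rw [tensorLift_superBracket]
  injective := by
    intro Δ _ h0
    obtain ⟨x₀, hx₀, y₀, hy₀, hw₀⟩ := h.even_nonabelian
    have hw₀' : μ x₀ y₀ ∈ 𝒳 0 := by
      have := h.graded _ _ _ hx₀ _ hy₀
      rwa [add_zero] at this
    ext a
    apply tmul_right_injective (K := K) hw₀
    rw [← tensorLift_tmul_even 𝒳 𝒜 Δ hw₀', h0, LinearMap.zero_apply, LinearMap.zero_apply,
      TensorProduct.tmul_zero]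

end Semidirect

section SuperBracket

variable {K : Type*} [Field K] {X : Type*} [AddCommGroup X] [Module K X]
  (𝒳 : ZMod 2 → Submodule K X) [DirectSum.Decomposition 𝒳]

/-! ### The super commutator -/

theorem superBracket_of_even_left {f : Module.End K X} (hf : f ∈ endGrading 𝒳 0)
    (g : Module.End K X) : superBracket 𝒳 f g = f * g - g * f := by
  rw [← sum_part (endGrading 𝒳) g, map_sum, Finset.mul_sum, Finset.sum_mul,
    ← Finset.sum_sub_distrib]
  refine Finset.sum_congr rfl fun β _ => ?_
  rw [superBracket_of_mem 𝒳 hf (part_mem _ β g), sgn_zero_left, one_smul]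

theorem superBracket_of_even_right {f : Module.End K X} (hf : f ∈ endGrading 𝒳 0)
    (g : Module.End K X) : superBracket 𝒳 g f = g * f - f * g := by
  rw [← sum_part (endGrading 𝒳) g, map_sum, LinearMap.sum_apply, Finset.mul_sum, Finset.sum_mul,
    ← Finset.sum_sub_distrib]
  refine Finset.sum_congr rfl fun β _ => ?_
  rw [superBracket_of_mem 𝒳 (part_mem _ β g) hf, sgn_zero_right, one_smul]

theorem superBracket_jacobi {α β : ZMod 2} {f g : Module.End K X} (hf : f ∈ endGrading 𝒳 α)
    (hg : g ∈ endGrading 𝒳 β) (k : Module.End K X) :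
    superBracket 𝒳 f (superBracket 𝒳 g k) = superBracket 𝒳 (superBracket 𝒳 f g) k +
      sgn α β • superBracket 𝒳 g (superBracket 𝒳 f k) := by
  have key : superBracket 𝒳 f ∘ₗ superBracket 𝒳 g = superBracket 𝒳 (superBracket 𝒳 f g) +
      sgn α β • (superBracket 𝒳 g ∘ₗ superBracket 𝒳 f) := by
    refine end_ext (endGrading 𝒳) fun γ k hk => ?_
    simp only [LinearMap.add_apply, LinearMap.smul_apply, LinearMap.comp_apply]
    rw [superBracket_of_mem 𝒳 hf (superBracket_mem_endGrading 𝒳 hg hk),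
      superBracket_of_mem 𝒳 hg (superBracket_mem_endGrading 𝒳 hf hk),
      superBracket_of_mem 𝒳 (superBracket_mem_endGrading 𝒳 hf hg) hk,
      superBracket_of_mem 𝒳 hf hg, superBracket_of_mem 𝒳 hg hk, superBracket_of_mem 𝒳 hf hk]
    have e1 : ∀ α β γ : ZMod 2, sgn α (β + γ) = sgn α β * sgn α γ := by decide
    have e2 : ∀ α β γ : ZMod 2, sgn (α + β) γ = sgn α γ * sgn β γ := by decide
    have e3 : ∀ α β : ZMod 2, sgn α β = 1 ∨ sgn α β = -1 := by decide
    rw [e1, e1, e2, sgn_comm β α]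
    -- Once the three signs are fixed, the claim is an identity in an associative ring.
    rcases e3 α β with h1 | h1 <;> rcases e3 α γ with h2 | h2 <;> rcases e3 β γ with h3 | h3 <;>
      rw [h1, h2, h3] <;> noncomm_ring
  rw [← LinearMap.comp_apply, key, LinearMap.add_apply, LinearMap.smul_apply, LinearMap.comp_apply]

end SuperBracket

section Orthosymplectic

variable {K : Type*} [Field K] {V : Type*} [AddCommGroup V] [Module K V]
  {𝒱 : ZMod 2 → Submodule K V} [DirectSum.Decomposition 𝒱]

/-! ### The maps `E u v` -/

theorem ospBracket_coe (q : QuadForm 𝒱) (x y : osp q) :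
    (ospBracket q x y : Module.End K V) = superBracket 𝒱 (x : Module.End K V) y := rfl

theorem isLeibniz_osp (q : QuadForm 𝒱) : IsLeibniz (ospGrading q) (ospBracket q) := by
  constructor
  · intro α β x hx y hy
    exact superBracket_mem_endGrading 𝒱 hx hy
  · intro α β x hx y hy z
    apply Subtype.ext
    rw [Submodule.coe_add, AddSubgroupClass.coe_zsmul]
    have h := superBracket_jacobi 𝒱 (show (x : Module.End K V) ∈ endGrading 𝒱 α from hx)
      (show (y : Module.End K V) ∈ endGrading 𝒱 β from hy) z
    simp only [ospBracket_coe]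
    exact h

/-- Pairing with w' leaves only the component of v of the degree of w', so the sign depends on w and
w' alone and u, v may be arbitrary. -/
theorem bilin_elemE (q : QuadForm 𝒱) (u v : V) {α β : ZMod 2} {w w' : V} (hw : w ∈ 𝒱 α)
    (hw' : w' ∈ 𝒱 β) : q.bilin (elemE q u v w) w' =
      q.bilin v w * q.bilin u w' - sgn α β • (q.bilin v w' * q.bilin u w) := by
  simp only [elemE, LinearMap.sub_apply, LinearMap.sum_apply, LinearMap.smul_apply,
    LinearMap.smulRight_apply, LinearMap.comp_apply, map_sub, map_sum, map_zsmul, map_smul,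
    smul_eq_mul]
  congr 1
  have h1 : ∀ γ, q.bilin (part 𝒱 γ v) w' = if γ = β then q.bilin v w' else 0 := by
    intro γ
    split_ifs with h
    · subst h
      conv_rhs => rw [← sum_part 𝒱 v, map_sum, LinearMap.sum_apply]
      rw [Finset.sum_eq_single γ]
      · intro δ _ hδ
        exact q.even δ γ _ (part_mem _ _ _) _ hw' hδ
      · simp
    · exact q.even γ β _ (part_mem _ _ _) _ hw' h
  rw [Finset.sum_eq_single β, Finset.sum_eq_single α]
  · rw [part_same _ hw, h1, if_pos rfl, sgn_comm, mul_comm]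
  · intro γ _ hγ
    rw [part_ne _ hw hγ.symm, map_zero, zero_mul, smul_zero]
  · simp
  · intro γ _ hγ
    refine Finset.sum_eq_zero fun δ _ => ?_
    rw [h1, if_neg hγ, mul_zero, smul_zero]
  · simp

theorem elemE_mem_osp (q : QuadForm 𝒱) (u v : V) : elemE q u v ∈ osp q := by
  intro α β w hw w' hw'
  rw [bilin_elemE q u v hw hw', bilin_elemE q u v hw' hw, smul_sub, sgn_comm β α,
    sgn_smul_sgn_smul]
  abel

/-- The map `E u v` as an element of `osp q`, bilinear in `u` and `v`. -/
noncomputable def ospE (q : QuadForm 𝒱) : V →ₗ[K] V →ₗ[K] osp q :=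
  LinearMap.mk₂ K (fun u v => ⟨elemE q u v, elemE_mem_osp q u v⟩)
    (fun u u' v => Subtype.ext (by
      ext w
      simp only [elemE, map_add, LinearMap.sub_apply, LinearMap.sum_apply, LinearMap.smul_apply,
        LinearMap.smulRight_apply, LinearMap.comp_apply, LinearMap.add_apply, smul_add, add_smul,
        Finset.sum_add_distrib, Submodule.coe_add]
      abel))
    (fun c u v => Subtype.ext (by
      ext w
      simp only [elemE, map_smul, LinearMap.sub_apply, LinearMap.sum_apply, LinearMap.smul_apply,
        LinearMap.smulRight_apply, LinearMap.comp_apply, smul_sub, Finset.smul_sum,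
        Submodule.coe_smul, smul_eq_mul, mul_smul]
      congr 1
      · rw [smul_comm]
      · exact Finset.sum_congr rfl fun α _ => Finset.sum_congr rfl fun β _ => smul_comm _ _ _))
    (fun u v v' => Subtype.ext (by
      ext w
      simp only [elemE, map_add, LinearMap.sub_apply, LinearMap.sum_apply, LinearMap.smul_apply,
        LinearMap.smulRight_apply, LinearMap.comp_apply, LinearMap.add_apply, smul_add, add_smul,
        Finset.sum_add_distrib, Submodule.coe_add]
      abel))
    (fun c u v => Subtype.ext (by
      ext w
      simp only [elemE, map_smul, LinearMap.sub_apply, LinearMap.sum_apply, LinearMap.smul_apply,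
        LinearMap.smulRight_apply, LinearMap.comp_apply, smul_sub, Finset.smul_sum,
        Submodule.coe_smul, smul_eq_mul, mul_smul]
      congr 1
      refine Finset.sum_congr rfl fun α _ => Finset.sum_congr rfl fun β _ => ?_
      rw [smul_comm (q.bilin u _) c, smul_comm c (sgn α β)]))

theorem ospE_coe (q : QuadForm 𝒱) (u v : V) : (ospE q u v : Module.End K V) = elemE q u v := rfl

theorem ospE_apply (q : QuadForm 𝒱) (u : V) {α β : ZMod 2} {v w : V} (hv : v ∈ 𝒱 α)
    (hw : w ∈ 𝒱 β) : (ospE q u v : Module.End K V) w =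
      q.bilin v w • u - sgn α β • (q.bilin u w • v) :=
  elemE_apply_of_mem q u hv hw

theorem ospE_mem (q : QuadForm 𝒱) {α β : ZMod 2} {u v : V} (hu : u ∈ 𝒱 α) (hv : v ∈ 𝒱 β) :
    ospE q u v ∈ ospGrading q (α + β) := by
  intro γ w hw
  change (ospE q u v : Module.End K V) w ∈ _
  rw [ospE_apply q u hv hw]
  refine sub_mem ?_ (zsmul_mem ?_ _)
  · by_cases h : β = γ
    · subst h
      have : ∀ α β : ZMod 2, α + β + β = α := by decide
      rw [this]
      exact Submodule.smul_mem _ _ hu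
    · rw [q.even _ _ _ hv _ hw h, zero_smul]
      exact zero_mem _
  · by_cases h : α = γ
    · subst h
      have : ∀ α β : ZMod 2, α + β + α = β := by decide
      rw [this]
      exact Submodule.smul_mem _ _ hv
    · rw [q.even _ _ _ hu _ hw h, zero_smul]
      exact zero_mem _

theorem ospE_swap (q : QuadForm 𝒱) {α β : ZMod 2} {u v : V} (hu : u ∈ 𝒱 α) (hv : v ∈ 𝒱 β) :
    ospE q v u = -(sgn α β • ospE q u v) := by
  refine Subtype.ext (end_ext 𝒱 fun γ w hw => ?_)
  rw [ospE_apply q v hu hw]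
  change _ = -(sgn α β • (ospE q u v : Module.End K V) w)
  rw [ospE_apply q u hv hw, smul_sub, neg_sub, smul_smul]
  congr 1
  · by_cases h : α = γ
    · subst h
      rw [sgn_comm β α, sgn_mul_self, one_smul]
    · rw [q.even _ _ _ hu _ hw h, zero_smul, smul_zero]
  · by_cases h : β = γ
    · subst h
      rfl
    · rw [q.even _ _ _ hv _ hw h, zero_smul, smul_zero, smul_zero]

/-- E is equivariant because it is built from q, which x preserves infinitesimally. Nearly all later
bracket computations reduce to this formula. -/
theorem ospBracket_ospE (q : QuadForm 𝒱) {γ α : ZMod 2} {x : osp q} (hx : x ∈ ospGrading q γ)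
    {u : V} (hu : u ∈ 𝒱 α) (v : V) : ospBracket q x (ospE q u v) =
      ospE q ((x : Module.End K V) u) v + sgn γ α • ospE q u ((x : Module.End K V) v) := by
  have key : ospBracket q x ∘ₗ ospE q u = ospE q ((x : Module.End K V) u) +
      sgn γ α • (ospE q u ∘ₗ (x : Module.End K V)) := by
    refine end_ext 𝒱 fun β v hv => Subtype.ext (end_ext 𝒱 fun δ w hw => ?_)
    have hxm := (osp_homogeneous q hx).1 x.2
    change superBracket 𝒱 (x : Module.End K V) (ospE q u v : Module.End K V) w =
      (ospE q ((x : Module.End K V) u) v : Module.End K V) w +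
      sgn γ α • (ospE q u ((x : Module.End K V) v) : Module.End K V) w
    have hx' : (x : Module.End K V) ∈ endGrading 𝒱 γ := hx
    have hE : (ospE q u v : Module.End K V) ∈ endGrading 𝒱 (α + β) := ospE_mem q hu hv
    rw [superBracket_of_mem 𝒱 hx' hE, ospE_apply q _ hv hw,
      ospE_apply q _ (hx' _ _ hv) hw]
    simp only [LinearMap.sub_apply, LinearMap.smul_apply, Module.End.mul_apply]
    rw [ospE_apply q u hv hw, ospE_apply q u hv (hx' _ _ hw)]
    have h1 : q.bilin ((x : Module.End K V) u) w = -(sgn γ α • q.bilin u ((x : Module.End K V) w)) :=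
      eq_neg_of_add_eq_zero_left (hxm _ _ _ hu _ hw)
    have h2 : q.bilin ((x : Module.End K V) v) w = -(sgn γ β • q.bilin v ((x : Module.End K V) w)) :=
      eq_neg_of_add_eq_zero_left (hxm _ _ _ hv _ hw)
    rw [h1, h2]
    -- The two signs differ in general, but q(u, w) vanishes unless α = δ, where they agree.
    have h3 : sgn γ α • sgn (γ + β) δ • q.bilin u w • (x : Module.End K V) v =
        sgn β δ • q.bilin u w • (x : Module.End K V) v := by
      by_cases h : α = δ
      · subst h
        have e0 : ∀ α β γ : ZMod 2, sgn γ α * sgn (γ + β) α = sgn β α := by decide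
        rw [smul_smul, e0]
      · rw [q.even _ _ _ hu _ hw h, zero_smul, smul_zero, smul_zero, smul_zero]
    simp only [map_sub, map_smul, map_zsmul, smul_sub, neg_smul, smul_neg, smul_assoc]
    rw [h3]
    have e1 : ∀ α β γ : ZMod 2, sgn γ (α + β) = sgn γ α * sgn γ β := by decide
    have e2 : sgn γ (α + β) • sgn β (γ + δ) • q.bilin u ((x : Module.End K V) w) • v =
        sgn β δ • sgn γ α • q.bilin u ((x : Module.End K V) w) • v := by
      have e0 : ∀ α β γ δ : ZMod 2, sgn γ (α + β) * sgn β (γ + δ) = sgn β δ * sgn γ α := by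
        decide
      rw [smul_smul, smul_smul, e0]
    rw [e2, e1, mul_smul]
    abel
  have := LinearMap.congr_fun key v
  exact this

theorem ospBracket_ospE_of_even (q : QuadForm 𝒱) {x : osp q} (hx : x ∈ ospGrading q 0)
    (u v : V) : ospBracket q x (ospE q u v) =
      ospE q ((x : Module.End K V) u) v + ospE q u ((x : Module.End K V) v) := by
  rw [← sum_part 𝒱 u]
  simp only [map_sum, LinearMap.sum_apply, ← Finset.sum_add_distrib]
  refine Finset.sum_congr rfl fun α _ => ?_
  rw [ospBracket_ospE q hx (part_mem _ _ _), sgn_zero_left, one_smul]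

/-! ### `osp q` is spanned by the maps `E u v` -/

/-- With q(c_i, ·) dual to b_i, pairing the right side on w with w' gives q(x w, w') -
(-1)^(|w||w'|) q(x w', w), and skewness makes this 2 q(x w, w'). -/
theorem QuadForm.Nondegenerate.exists_two_smul_eq_sum [Module.Finite K V] {q : QuadForm 𝒱}
    (hq : q.Nondegenerate) : ∃ (n : ℕ) (b c : Fin n → V), ∀ x : osp q,
      (2 : K) • x = ∑ i, ospE q ((x : Module.End K V) (b i)) (c i) := by
  let b := Module.finBasis K V
  have hinj : Function.Injective q.bilin := by
    rw [injective_iff_map_eq_zero]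
    exact fun u hu => hq u fun v => by rw [hu, LinearMap.zero_apply]
  have hsurj : Function.Surjective q.bilin :=
    (LinearMap.injective_iff_surjective_of_finrank_eq_finrank
      (Subspace.dual_finrank_eq (K := K) (V := V)).symm).1 hinj
  choose c hc using fun i => hsurj (b.coord i)
  refine ⟨_, b, c, fun x => Subtype.ext (end_ext 𝒱 fun α w hw => ?_)⟩
  rw [← sub_eq_zero]
  suffices key : q.bilin (((2 : K) • x : osp q).1 w -
      (∑ i, ospE q ((x : Module.End K V) (b i)) (c i) : osp q).1 w) = 0 from
    hq _ fun w' => by rw [key, LinearMap.zero_apply]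
  refine end_ext 𝒱 fun β w' hw' => ?_
  rw [Submodule.coe_smul, AddSubmonoidClass.coe_finsetSum, LinearMap.sum_apply]
  simp only [ospE_coe, map_sub, map_sum, LinearMap.sub_apply, LinearMap.sum_apply,
    bilin_elemE q _ _ hw hw', hc, Finset.sum_sub_distrib, LinearMap.zero_apply,
    LinearMap.smul_apply, map_smul, smul_eq_mul]
  have h1 : ∀ w w', ∑ i, b.coord i w * q.bilin ((x : Module.End K V) (b i)) w' =
      q.bilin ((x : Module.End K V) w) w' := by
    intro w w'
    conv_rhs => rw [← b.sum_repr w]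
    simp only [map_sum, map_smul, LinearMap.sum_apply, LinearMap.smul_apply, smul_eq_mul,
      Module.Basis.coord_apply]
  rw [← Finset.smul_sum, h1, h1]
  have := x.2 α β w hw w' hw'
  linear_combination this

theorem QuadForm.Nondegenerate.ospE_ext [Module.Finite K V] (h2 : (2 : K) ≠ 0) {q : QuadForm 𝒱}
    (hq : q.Nondegenerate) {N : Submodule K (osp q)}
    (hN : ∀ α β, ∀ u ∈ 𝒱 α, ∀ v ∈ 𝒱 β, ospE q u v ∈ N) : N = ⊤ := by
  have hN' : ∀ u v, ospE q u v ∈ N := by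
    intro u v
    rw [← sum_part 𝒱 u, ← sum_part 𝒱 v]
    simp only [map_sum, LinearMap.sum_apply]
    exact sum_mem fun α _ => sum_mem fun β _ => hN _ _ _ (part_mem _ _ _) _ (part_mem _ _ _)
  rw [eq_top_iff]
  intro x _
  obtain ⟨n, b, c, hbc⟩ := hq.exists_two_smul_eq_sum
  rw [← inv_smul_smul₀ h2 x, hbc]
  exact Submodule.smul_mem _ _ (sum_mem fun i _ => hN' _ _)

/-- Applying the dual basis formula to x/2 puts all scalars into the vectors, so integer
coefficients are enough. -/
theorem QuadForm.Nondegenerate.eosp_eq [Module.Finite K V] (h2 : (2 : K) ≠ 0) {q : QuadForm 𝒱}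
    (hq : q.Nondegenerate) : eosp q = (osp q).toAddSubgroup := by
  apply le_antisymm
  · rw [eosp, AddSubgroup.closure_le]
    rintro _ ⟨α, β, u, hu, v, hv, rfl⟩
    exact elemE_mem_osp q u v
  · intro x hx
    obtain ⟨n, b, c, hbc⟩ := hq.exists_two_smul_eq_sum
    have hmem : ∀ u v, (ospE q u v : Module.End K V) ∈ eosp q := by
      intro u v
      rw [← sum_part 𝒱 u, ← sum_part 𝒱 v]
      rw [map_sum, AddSubmonoidClass.coe_finsetSum]
      refine sum_mem fun β _ => ?_
      rw [map_sum, LinearMap.sum_apply, AddSubmonoidClass.coe_finsetSum]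
      refine sum_mem fun α _ => AddSubgroup.subset_closure
        ⟨α, β, _, part_mem 𝒱 α u, _, part_mem 𝒱 β v, ?_⟩
      rw [ospE_coe]
    have h1 := hbc ⟨(2 : K)⁻¹ • x, Submodule.smul_mem _ _ hx⟩
    have h3 := congrArg (Subtype.val) h1
    rw [Submodule.coe_smul, smul_inv_smul₀ h2] at h3
    rw [h3, AddSubmonoidClass.coe_finsetSum]
    exact sum_mem fun i _ => hmem _ _

end Orthosymplectic

section Quintic

variable {K : Type*} [Field K] {X : Type*} [AddCommGroup X] [Module K X]

/-! ### Semisimple inner derivations -/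

/-- The endomorphism `T` is annihilated by the separable polynomial
`t (t - 1) (t + 1) (t - 2) (t + 2)`. -/
def IsQuintic (T : Module.End K X) : Prop :=
  ∀ x, T (T (T (T (T x)))) = (5 : K) • T (T (T x)) - (4 : K) • T x

theorem IsQuintic.of_injective {Z : Type*} [AddCommGroup Z] [Module K Z] {T : Module.End K X}
    (ι : X →ₗ[K] Z) (hι : Function.Injective ι) (T' : Module.End K Z)
    (hT : ∀ x, ι (T x) = T' (ι x)) (hT' : IsQuintic T') : IsQuintic T := by
  intro x
  apply hι
  simp only [map_sub, map_smul, hT]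
  exact hT' _

/-- If `[D, T] = Y` commutes with `T` and `T` is annihilated by a separable polynomial, then
`Y = 0`. -/
theorem IsQuintic.eq_zero [CharZero K] {T D Y : Module.End K X} (hq : IsQuintic T)
    (hDT : ∀ x, D (T x) = Y x + T (D x)) (hTY : ∀ x, T (Y x) = Y (T x)) : Y = 0 := by
  have hq' : ∀ x, T (T (T (T (T x)))) = (5 : K) • T (T (T x)) - (4 : K) • T x := hq
  ext1 x
  rw [LinearMap.zero_apply]
  set w := Y x with hw
  -- With p(t) = t⁵ - 5t³ + 4t, commuting D past p(T) = 0 gives p'(T) Y = 0, as Y commutes with T.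
  have h1 : (5 : K) • T (T (T (T w))) - (15 : K) • T (T w) + (4 : K) • w = 0 := by
    have h2 := congrArg D (hq x)
    simp only [map_sub, map_smul, hDT, map_add, ← hTY, ← hw] at h2
    rw [hq' (D x), ← sub_eq_zero] at h2
    rw [← h2]
    module
  -- From here the Euclidean algorithm for the coprime polynomials p and p' is run on w until w = 0.
  have h2 : T (T (T w)) = (8 / 5 : K) • T w := by
    have h3 := congrArg T h1
    simp only [map_add, map_sub, map_smul, hq', map_zero] at h3
    have h4 : (10 : K) • (T (T (T w)) - (8 / 5 : K) • T w) = 0 := by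
      rw [← h3]
      module
    exact sub_eq_zero.1 ((smul_eq_zero.1 h4).resolve_left (by norm_num))
  have h3 : T (T w) = (4 / 7 : K) • w := by
    rw [h2, map_smul] at h1
    have h4 : (7 : K) • (T (T w) - (4 / 7 : K) • w) = 0 := by
      rw [← neg_eq_zero, ← h1]
      module
    exact sub_eq_zero.1 ((smul_eq_zero.1 h4).resolve_left (by norm_num))
  have h4 : T w = 0 := by
    rw [h3, map_smul] at h2
    have h5 : (36 / 35 : K) • T w = 0 := by
      rw [← sub_eq_zero, ← neg_eq_zero] at h2
      rw [← h2]
      module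
    exact (smul_eq_zero.1 h5).resolve_left (by norm_num)
  rw [h4, map_zero] at h3
  exact (smul_eq_zero.1 h3.symm).resolve_left (by norm_num)

variable {𝒳 : ZMod 2 → Submodule K X} {μ : X →ₗ[K] X →ₗ[K] X}

theorem derDeg_bracket_even {δ : ZMod 2} {D : Module.End K X} (hD : D ∈ derDeg 𝒳 μ δ) {x : X}
    (hx : x ∈ 𝒳 0) (y : X) : D (μ x y) = μ (D x) y + μ x (D y) := by
  rw [hD.2 0 x hx y, sgn_zero_right, one_smul]

theorem mem_inner_of_add_mem {D : Module.End K X} {z : X} (h : D + μ z ∈ inner μ) :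
    D ∈ inner μ := by
  obtain ⟨t, ht⟩ := h
  exact ⟨t - z, by rw [map_sub, ht, add_sub_cancel_right]⟩

theorem add_ad_neg_apply_eq_zero {D : Module.End K X} {t x : X} (h : D x = μ t x) :
    (D + μ (-t)) x = 0 := by
  rw [LinearMap.add_apply, map_neg, LinearMap.neg_apply, h, add_neg_cancel]

theorem mem_inner_of_add_ad_neg_eq_zero {D : Module.End K X} {t : X} (h : D + μ (-t) = 0) :
    D ∈ inner μ :=
  mem_inner_of_add_mem (z := -t) (h ▸ zero_mem _)

/-- In a centreless Leibniz superalgebra every derivation can be changed by an inner derivation so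
as to vanish at a given even semisimple element. -/
theorem IsLeibniz.exists_inner_apply_eq_zero [CharZero K] (hμ : IsLeibniz 𝒳 μ)
    (hinj : Function.Injective μ) {h : X} (hh : h ∈ 𝒳 0) (hq : IsQuintic (μ h))
    (hskew : ∀ z, μ z h = -μ h z) {δ : ZMod 2} {D : Module.End K X} (hD : D ∈ derDeg 𝒳 μ δ) :
    ∃ z ∈ 𝒳 δ, (D + μ z) h = 0 := by
  have hTδ : ∀ x ∈ 𝒳 δ, μ h x ∈ 𝒳 δ := by
    intro x hx
    have := hμ.graded _ _ _ hh _ hx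
    rwa [zero_add] at this
  have hDh : ∀ D ∈ derDeg 𝒳 μ δ, D h ∈ 𝒳 δ := by
    intro D hD
    have := hD.1 _ _ hh
    rwa [add_zero] at this
  have hy := hDh D hD
  -- For T = ad h this z satisfies D h - T z = (T⁴ - 5T² + 4)(D h)/4, the component of D h in the
  -- kernel of T. By skewness that is the value at h of D + ad z.
  have hz : (5 / 4 : K) • μ h (D h) - (1 / 4 : K) • μ h (μ h (μ h (D h))) ∈ 𝒳 δ :=
    sub_mem (Submodule.smul_mem _ _ (hTδ _ hy))
      (Submodule.smul_mem _ _ (hTδ _ (hTδ _ (hTδ _ hy))))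
  refine ⟨_, hz, ?_⟩
  have hD' := add_mem hD (hμ.ad_mem_derDeg hz)
  set D' := D + μ ((5 / 4 : K) • μ h (D h) - (1 / 4 : K) • μ h (μ h (μ h (D h)))) with hD'def
  have h1 : μ h (D' h) = 0 := by
    have hq' : ∀ x, μ h (μ h (μ h (μ h (μ h x)))) =
      (5 : K) • μ h (μ h (μ h x)) - (4 : K) • μ h x := hq
    rw [hD'def, LinearMap.add_apply, hskew]
    simp only [map_add, map_neg, map_sub, map_smul, hq']
    module
  -- Now ad(D' h) = [D', ad h] commutes with ad h, so separability makes it zero, and D' h = 0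
  -- because X is centreless.
  apply hinj
  rw [map_zero]
  refine hq.eq_zero (derDeg_bracket_even hD' hh) fun x => ?_
  have h2 := hμ.jacobi 0 δ h hh _ (hDh D' hD') x
  rwa [h1, map_zero, LinearMap.zero_apply, zero_add, sgn_zero_left, one_smul] at h2

end Quintic

section OddPair

variable {K : Type*} [Field K] {V : Type*} [AddCommGroup V] [Module K V]
  {𝒱 : ZMod 2 → Submodule K V}

theorem zmod_two_eq (β : ZMod 2) : β = 0 ∨ β = 1 := by
  revert β; decide

theorem sgn_one_one : sgn 1 1 = -1 := by decide

/-! ### Symplectic pairs of odd vectors -/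

/-- A pair of odd vectors spanning a symplectic plane. -/
structure IsOddPair (q : QuadForm 𝒱) (e f : V) : Prop where
  left_mem : e ∈ 𝒱 1
  right_mem : f ∈ 𝒱 1
  pair : q.bilin f e = 1

theorem IsOddPair.left_ne_zero {q : QuadForm 𝒱} {e f : V} (p : IsOddPair q e f) : e ≠ 0 := by
  rintro rfl
  have := p.pair
  rw [map_zero] at this
  exact zero_ne_one this

variable [DirectSum.Decomposition 𝒱]

theorem QuadForm.bilin_odd_right (q : QuadForm 𝒱) {v : V} (hv : v ∈ 𝒱 1) (w : V) :
    q.bilin w v = -q.bilin v w := by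
  have key : q.bilin.flip v = -q.bilin v := by
    refine end_ext 𝒱 fun β w hw => ?_
    rw [LinearMap.flip_apply, LinearMap.neg_apply, q.supersymm β 1 w hw v hv]
    rcases zmod_two_eq β with rfl | rfl
    · rw [q.even 1 0 v hv w hw (by decide), smul_zero, neg_zero]
    · rw [sgn_one_one, neg_one_smul]
  exact LinearMap.congr_fun key w

theorem QuadForm.ospE_odd_apply (q : QuadForm 𝒱) {a b : V} (ha : a ∈ 𝒱 1) (hb : b ∈ 𝒱 1) (v : V) :
    (ospE q a b).1 v = q.bilin b v • a + q.bilin a v • b := by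
  have key : (ospE q a b).1 = (q.bilin b).smulRight a + (q.bilin a).smulRight b := by
    refine end_ext 𝒱 fun β v hv => ?_
    rw [ospE_apply q a hb hv, LinearMap.add_apply, LinearMap.smulRight_apply,
      LinearMap.smulRight_apply]
    rcases zmod_two_eq β with rfl | rfl
    · rw [q.even 1 0 a ha v hv (by decide), zero_smul, smul_zero, sub_zero, add_zero]
    · rw [sgn_one_one, neg_one_smul, sub_neg_eq_add]
  rw [key]
  rfl

namespace IsOddPair

variable {q : QuadForm 𝒱} {e f : V} (p : IsOddPair q e f)
include p

theorem pair' : q.bilin e f = -1 := by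
  rw [q.bilin_odd_right p.right_mem, p.pair]

theorem left_self [CharZero K] : q.bilin e e = 0 := by
  have := q.bilin_odd_right p.left_mem e
  linear_combination (1 / 2 : K) * this

theorem right_self [CharZero K] : q.bilin f f = 0 := by
  have := q.bilin_odd_right p.right_mem f
  linear_combination (1 / 2 : K) * this

/-- This reverses the sign of the weights, so statements about weight 2 also yield those about
weight -2. -/
theorem swap : IsOddPair q f (-e) :=
  ⟨p.right_mem, neg_mem p.left_mem, by rw [map_neg, LinearMap.neg_apply, p.pair', neg_neg]⟩

theorem h_mem : ospE q e f ∈ ospGrading q 0 := by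
  have := ospE_mem q p.left_mem p.right_mem
  rwa [show (1 + 1 : ZMod 2) = 0 by decide] at this

theorem ee_mem : ospE q e e ∈ ospGrading q 0 := by
  have := ospE_mem q p.left_mem p.left_mem
  rwa [show (1 + 1 : ZMod 2) = 0 by decide] at this

theorem ff_mem : ospE q f f ∈ ospGrading q 0 := by
  have := ospE_mem q p.right_mem p.right_mem
  rwa [show (1 + 1 : ZMod 2) = 0 by decide] at this

theorem ospE_right_left : ospE q f e = ospE q e f := by
  rw [ospE_swap q p.left_mem p.right_mem, sgn_one_one, neg_smul, one_smul, neg_neg]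

theorem h_apply (v : V) : (ospE q e f).1 v = q.bilin f v • e + q.bilin e v • f :=
  q.ospE_odd_apply p.left_mem p.right_mem v

theorem h_left [CharZero K] : (ospE q e f).1 e = e := by
  rw [p.h_apply, p.pair, p.left_self, one_smul, zero_smul, add_zero]

theorem h_right [CharZero K] : (ospE q e f).1 f = -f := by
  rw [p.h_apply, p.pair', p.right_self, zero_smul, neg_one_smul, zero_add]

theorem h_h_apply [CharZero K] (v : V) :
    (ospE q e f).1 ((ospE q e f).1 v) = q.bilin f v • e - q.bilin e v • f := by
  rw [p.h_apply v, map_add, map_smul, map_smul, p.h_left, p.h_right, smul_neg, sub_eq_add_neg]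

theorem h_h_h_apply [CharZero K] (v : V) :
    (ospE q e f).1 ((ospE q e f).1 ((ospE q e f).1 v)) = (ospE q e f).1 v := by
  rw [p.h_h_apply v, map_sub, map_smul, map_smul, p.h_left, p.h_right, p.h_apply, smul_neg,
    sub_neg_eq_add]

theorem ee_apply (v : V) : (ospE q e e).1 v = (2 * q.bilin e v) • e := by
  rw [q.ospE_odd_apply p.left_mem p.left_mem, ← add_smul, two_mul]

theorem ff_apply (v : V) : (ospE q f f).1 v = (2 * q.bilin f v) • f := by
  rw [q.ospE_odd_apply p.right_mem p.right_mem, ← add_smul, two_mul]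

theorem ospE_left_apply_right (u : V) : (ospE q u e).1 f = -u + q.bilin u f • e := by
  rw [ospE_apply q u p.left_mem p.right_mem, p.pair', sgn_one_one, neg_one_smul, neg_one_smul,
    sub_neg_eq_add]

theorem ospE_right_apply_left (u : V) : (ospE q u f).1 e = u + q.bilin u e • f := by
  rw [ospE_apply q u p.right_mem p.left_mem, p.pair, sgn_one_one, neg_one_smul, one_smul,
    sub_neg_eq_add]

/-- The projection onto the orthogonal complement of the span of `e` and `f`. -/
theorem eq_proj_add [CharZero K] (v : V) :
    v = (v - (ospE q e f).1 ((ospE q e f).1 v)) + q.bilin f v • e - q.bilin e v • f := by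
  rw [p.h_h_apply]
  abel

/-! ### Brackets with the sl₂ of a symplectic pair, and its weight spaces -/

theorem bracket_h_apply (x : osp q) (v : V) : (ospBracket q (ospE q e f) x).1 v =
    (ospE q e f).1 (x.1 v) - x.1 ((ospE q e f).1 v) := by
  have h1 : (ospE q e f).1 ∈ endGrading 𝒱 0 := p.h_mem
  rw [ospBracket_coe, superBracket_of_even_left 𝒱 h1]
  rfl

/-- On End V, ad h is the difference of left and right multiplication by h. These commute and, since
h³ = h, have eigenvalues 0, ±1, so the difference has eigenvalues among 0, ±1, ±2. -/
theorem isQuintic_bracket_h [CharZero K] : IsQuintic (ospBracket q (ospE q e f)) := by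
  refine IsQuintic.of_injective (osp q).subtype Subtype.val_injective
    (LinearMap.mulLeft K (ospE q e f).1 - LinearMap.mulRight K (ospE q e f).1) (fun x => ?_)
    fun x => LinearMap.ext fun v => ?_
  · exact LinearMap.ext fun v => p.bracket_h_apply x v
  · simp only [LinearMap.sub_apply, LinearMap.mulLeft_apply, LinearMap.mulRight_apply,
      Module.End.mul_apply, LinearMap.smul_apply, map_sub, p.h_h_h_apply]
    module

/-- Brackets with `h = E e f` in terms of the values at `e` and `f`. -/
theorem bracket_h_eq (x : osp q) : ospBracket q (ospE q e f) x =
    -ospE q (x.1 e) f - ospE q (x.1 f) e := by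
  have key : ∀ γ, ∀ x ∈ ospGrading q γ, ospBracket q (ospE q e f) x =
      -ospE q (x.1 e) f - ospE q (x.1 f) e := by
    intro γ x hx
    have hx' : x.1 ∈ endGrading 𝒱 γ := hx
    have h1 : ospBracket q (ospE q e f) x = -ospBracket q x (ospE q e f) := by
      have h0 : (ospE q e f).1 ∈ endGrading 𝒱 0 := p.h_mem
      apply Subtype.ext
      rw [Submodule.coe_neg, ospBracket_coe, ospBracket_coe, superBracket_of_mem 𝒱 h0 hx',
        superBracket_of_mem 𝒱 hx' h0, sgn_zero_left, sgn_zero_right, one_smul, one_smul, neg_sub]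
    rw [h1, ospBracket_ospE q hx p.left_mem, ospE_swap q (hx' _ _ p.right_mem) p.left_mem,
      smul_neg, smul_smul]
    have e1 : sgn γ 1 * sgn (γ + 1) 1 = -1 := by
      clear * -
      revert γ
      decide
    rw [e1, neg_one_smul, neg_neg, neg_add, sub_eq_add_neg]
  have key2 : ospBracket q (ospE q e f) =
      -((ospE q).flip f ∘ₗ LinearMap.applyₗ e ∘ₗ (osp q).subtype) -
        (ospE q).flip e ∘ₗ LinearMap.applyₗ f ∘ₗ (osp q).subtype :=
    end_ext (ospGrading q) fun γ x hx => key γ x hx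
  rw [key2]
  rfl

/-- The terms E(x e, e) and ±E(e, x e) coincide by super antisymmetry of E. Thus the bracket with
E(e,e) detects x e. -/
theorem bracket_ee_eq (x : osp q) :
    ospBracket q x (ospE q e e) = (2 : K) • ospE q (x.1 e) e := by
  have key : ∀ γ, ∀ x ∈ ospGrading q γ,
      ospBracket q x (ospE q e e) = (2 : K) • ospE q (x.1 e) e := by
    intro γ x hx
    have hx' : x.1 ∈ endGrading 𝒱 γ := hx
    rw [ospBracket_ospE q hx p.left_mem, ospE_swap q (hx' _ _ p.left_mem) p.left_mem,
      smul_neg, smul_smul]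
    have e1 : sgn γ 1 * sgn (γ + 1) 1 = -1 := by
      clear * -
      revert γ
      decide
    rw [e1, neg_one_smul, neg_neg, two_smul]
  have key2 : (ospBracket q).flip (ospE q e e) =
      (2 : K) • ((ospE q).flip e ∘ₗ LinearMap.applyₗ e ∘ₗ (osp q).subtype) :=
    end_ext (ospGrading q) fun γ x hx => key γ x hx
  rw [← LinearMap.flip_apply, key2]
  rfl

theorem bracket_h_ospE (u v : V) : ospBracket q (ospE q e f) (ospE q u v) =
    ospE q ((ospE q e f).1 u) v + ospE q u ((ospE q e f).1 v) :=
  ospBracket_ospE_of_even q p.h_mem u v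

theorem bracket_h_h [CharZero K] : ospBracket q (ospE q e f) (ospE q e f) = 0 := by
  rw [p.bracket_h_ospE, p.h_left, p.h_right, map_neg, add_neg_cancel]

theorem bracket_h_ee [CharZero K] :
    ospBracket q (ospE q e f) (ospE q e e) = (2 : K) • ospE q e e := by
  rw [p.bracket_h_ospE, p.h_left, two_smul]

theorem bracket_h_ff [CharZero K] :
    ospBracket q (ospE q e f) (ospE q f f) = -((2 : K) • ospE q f f) := by
  rw [p.bracket_h_ospE, p.h_right, map_neg, map_neg, LinearMap.neg_apply, two_smul, neg_add]

theorem bracket_ee_ff : ospBracket q (ospE q e e) (ospE q f f) = -((4 : K) • ospE q e f) := by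
  rw [ospBracket_ospE_of_even q p.ee_mem, p.ee_apply, p.pair', map_smul, map_smul,
    LinearMap.smul_apply, p.ospE_right_left]
  module

/-- Evaluation at f shows that u = q(u, f) e; pairing this with f gives q(u, f) = -q(u, f). -/
theorem eq_zero_of_ospE_left [CharZero K] {u : V} (hu : ospE q u e = 0) : u = 0 := by
  have h1 := p.ospE_left_apply_right u
  rw [hu] at h1
  have h2 : u = q.bilin u f • e := by
    rw [Submodule.coe_zero, LinearMap.zero_apply] at h1
    rw [← sub_eq_zero, ← neg_eq_zero, h1]
    abel
  have h3 : q.bilin u f = -q.bilin u f := by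
    conv_lhs => rw [h2]
    rw [map_smul, LinearMap.smul_apply, p.pair', smul_eq_mul, mul_neg_one]
  have h4 : q.bilin u f = 0 := by linear_combination (1 / 2 : K) * h3
  rw [h2, h4, zero_smul]

theorem ee_ne_zero [CharZero K] : ospE q e e ≠ 0 := fun h =>
  p.left_ne_zero (p.eq_zero_of_ospE_left h)

theorem h_ne_zero [CharZero K] : ospE q e f ≠ 0 := by
  intro h
  have := p.h_left
  rw [h] at this
  exact p.left_ne_zero this.symm

/-- The centre of `osp q` is trivial. -/
theorem injective [CharZero K] : Function.Injective (ospBracket q) := by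
  rw [injective_iff_map_eq_zero]
  intro y hy
  have hpart : ∀ γ, ospBracket q (part (ospGrading q) γ y) = 0 := by
    intro γ
    refine end_ext (ospGrading q) fun β x hx => ?_
    have h1 := apply_part (ospGrading q) (ospGrading q) (α := β) ((ospBracket q).flip x)
      (fun γ z hz => by
        rw [LinearMap.flip_apply, add_comm]
        exact (isLeibniz_osp q).graded _ _ _ hz _ hx) γ y
    rw [LinearMap.flip_apply, LinearMap.flip_apply, hy, LinearMap.zero_apply, map_zero] at h1
    rw [h1, LinearMap.zero_apply]
  have key : ∀ γ, ∀ y ∈ ospGrading q γ, ospBracket q y = 0 → y = 0 := by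
    intro γ y hyγ hy
    -- The bracket of y with E(e,e) forces y e = 0; then the bracket with E(u,e) is E(y u, e), which
    -- forces y u = 0.
    have hye : y.1 e = 0 := by
      apply p.eq_zero_of_ospE_left
      have h1 := p.bracket_ee_eq y
      rw [hy, LinearMap.zero_apply] at h1
      exact (smul_eq_zero.1 h1.symm).resolve_left two_ne_zero
    refine Subtype.ext (end_ext 𝒱 fun α u hu => ?_)
    rw [Submodule.coe_zero, LinearMap.zero_apply]
    apply p.eq_zero_of_ospE_left
    have h1 := ospBracket_ospE q hyγ hu e
    rw [hy, LinearMap.zero_apply, hye, map_zero, smul_zero, add_zero] at h1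
    exact h1.symm
  rw [← sum_part (ospGrading q) y]
  exact Finset.sum_eq_zero fun γ _ => key γ _ (part_mem _ _ _) (hpart γ)

/-- The elements of weight `2` are the multiples of `E e e`. -/
theorem exists_eq_smul_ee [CharZero K] {x : osp q}
    (hx : ospBracket q (ospE q e f) x = (2 : K) • x) : ∃ c : K, x = c • ospE q e e := by
  have h1 : ∀ v, (ospE q e f).1 (x.1 v) = x.1 ((ospE q e f).1 v) + (2 : K) • x.1 v := by
    intro v
    have h2 := p.bracket_h_apply x v
    rw [hx, Submodule.coe_smul, LinearMap.smul_apply] at h2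
    rw [h2]
    abel
  -- The vector x e would have h-eigenvalue 1 + 2 = 3, while h³ = h on V; the constant is 24 = 3³ -
  -- 3.
  have hxe : x.1 e = 0 := by
    have h2 := h1 e
    rw [p.h_left] at h2
    have h3 := p.h_h_h_apply (x.1 e)
    simp only [h2, map_add, map_smul] at h3
    have h4 : (24 : K) • x.1 e = 0 := by
      rw [← sub_eq_zero] at h3
      rw [← h3]
      module
    exact (smul_eq_zero.1 h4).resolve_left (by norm_num)
  -- The vector x f has weight -1 + 2 = 1, so it is a multiple of e, and x is recovered from its
  -- values at e and f.
  have hxf : (ospE q e f).1 (x.1 f) = x.1 f := by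
    rw [h1, p.h_right, map_neg, two_smul]
    abel
  have hxf' : x.1 f = q.bilin f (x.1 f) • e := by
    have h3 := p.h_h_apply (x.1 f)
    rw [hxf, hxf] at h3
    have h4 := p.h_apply (x.1 f)
    rw [hxf] at h4
    have h5 : (2 : K) • x.1 f = (2 : K) • q.bilin f (x.1 f) • e := by
      conv_lhs => rw [two_smul]
      nth_rewrite 1 [h3]
      nth_rewrite 3 [h4]
      module
    exact smul_right_injective V (two_ne_zero (α := K)) h5
  refine ⟨-(q.bilin f (x.1 f)) / 2, ?_⟩
  have h3 := p.bracket_h_eq x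
  rw [hx, hxe, map_zero, LinearMap.zero_apply, neg_zero, zero_sub, hxf', map_smul,
    LinearMap.smul_apply] at h3
  calc x = (2 : K)⁻¹ • (2 : K) • x := (inv_smul_smul₀ two_ne_zero x).symm
    _ = _ := by
      rw [h3]
      module

/-- The elements of weight `1` are the maps `E w e` with `w` orthogonal to `e` and `f`. -/
theorem eq_ospE_of_weight_one [CharZero K] {x : osp q}
    (hx : ospBracket q (ospE q e f) x = x) :
    x = ospE q (-(x.1 f)) e ∧ (ospE q e f).1 (x.1 f) = 0 := by
  have h1 : ∀ v, (ospE q e f).1 (x.1 v) = x.1 ((ospE q e f).1 v) + x.1 v := by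
    intro v
    have h2 := p.bracket_h_apply x v
    rw [hx] at h2
    exact sub_eq_iff_eq_add'.1 h2.symm
  -- Here x e would have eigenvalue 2, excluded by 2³ - 2 = 6 ≠ 0.
  have hxe : x.1 e = 0 := by
    have h2 := h1 e
    rw [p.h_left] at h2
    have h3 := p.h_h_h_apply (x.1 e)
    simp only [h2, map_add] at h3
    have h4 : (6 : K) • x.1 e = 0 := by
      rw [← sub_eq_zero] at h3
      rw [← h3]
      module
    exact (smul_eq_zero.1 h4).resolve_left (by norm_num)
  constructor
  · have h3 := p.bracket_h_eq x
    rw [hx, hxe, map_zero, LinearMap.zero_apply, neg_zero, zero_sub] at h3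
    rw [map_neg, LinearMap.neg_apply]
    exact h3
  · rw [h1, p.h_right, map_neg, neg_add_cancel]

/-- A subspace of `osp q` is everything if it contains all `E u e` and is closed under brackets with
`E f f` and all `E u e`. -/
theorem eq_top_of_mem [CharZero K] [Module.Finite K V] (hq : q.Nondegenerate)
    (N : Submodule K (osp q)) (hN : ∀ u, ospE q u e ∈ N)
    (hf : ∀ x ∈ N, ospBracket q (ospE q f f) x ∈ N)
    (he : ∀ α, ∀ u ∈ 𝒱 α, ∀ x ∈ N, ospBracket q (ospE q u e) x ∈ N) : N = ⊤ := by
  have hNf : ∀ u, ospE q u f ∈ N := by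
    intro u
    -- This bracket is 2q(f, u) E(f,e) + 2E(u,f), and the first term already lies in N.
    have h1 := hf _ (hN u)
    rw [ospBracket_ospE_of_even q p.ff_mem, p.ff_apply, p.ff_apply, p.pair, map_smul,
      LinearMap.smul_apply, map_smul] at h1
    have h2 := (Submodule.add_mem_iff_right N (N.smul_mem (2 * q.bilin f u) (hN f))).1 h1
    have h3 := N.smul_mem (2⁻¹ : K) h2
    rwa [mul_one, inv_smul_smul₀ two_ne_zero] at h3
  refine hq.ospE_ext two_ne_zero fun α β v hv u hu => ?_
  -- The bracket of E(u,e) with E(v,f) contains ±E(v,u), because E(u,e) sends f to -u plus a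
  -- multiple of e; all other terms are known to lie in N.
  have h1 := he β u hu _ (hNf v)
  rw [ospBracket_ospE q (ospE_mem q hu p.left_mem) hv] at h1
  change ospE q ((ospE q u e).1 v) f + _ • ospE q v ((ospE q u e).1 f) ∈ N at h1
  have h2 := (Submodule.add_mem_iff_right N (hNf _)).1 h1
  have h3 := zsmul_mem h2 (sgn (β + 1) α)
  rw [sgn_smul_sgn_smul, p.ospE_left_apply_right, map_add, map_smul, map_neg] at h3
  have h4 := (Submodule.add_mem_iff_left N (N.smul_mem _ (hN _))).1 h3
  exact neg_mem_iff.1 h4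

/-- The adjoint module of `osp q` has no endomorphisms except for the scalars. -/
theorem centroid [CharZero K] [Module.Finite K V] (hq : q.Nondegenerate)
    (g : Module.End K (osp q)) (hg : ∀ x y, g (ospBracket q x y) = ospBracket q x (g y)) :
    ∃ c : K, ∀ x, g x = c • x := by
  -- g preserves weights and hence the weight-2 line; c is its eigenvalue there. The kernel of g - c
  -- is then stable under all brackets and contains E(e,e).
  obtain ⟨c, hc⟩ := p.exists_eq_smul_ee (x := g (ospE q e e)) (by
    rw [← hg, p.bracket_h_ee, map_smul])
  refine ⟨c, fun x => ?_⟩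
  suffices h : LinearMap.ker (g - c • LinearMap.id) = ⊤ by
    have hx : x ∈ LinearMap.ker (g - c • LinearMap.id) := h ▸ Submodule.mem_top
    simpa [sub_eq_zero] using hx
  have hmem : ∀ x, x ∈ LinearMap.ker (g - c • LinearMap.id) ↔ g x = c • x := by
    intro x
    simp [sub_eq_zero]
  have hst : ∀ y x, x ∈ LinearMap.ker (g - c • LinearMap.id) →
      ospBracket q y x ∈ LinearMap.ker (g - c • LinearMap.id) := by
    intro y x hx
    rw [hmem] at hx ⊢
    rw [hg, hx, map_smul]
  set N := LinearMap.ker (g - c • LinearMap.id) with hNdef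
  -- Bracketing x with E(e,e) gives 2E(x e, e); the choices x = E(f,f) and x = E(u,f) then produce
  -- every E(u,e).
  have hxe : ∀ x : osp q, ospE q (x.1 e) e ∈ N := by
    intro x
    have h1 := hst x _ ((hmem _).2 hc)
    rw [p.bracket_ee_eq] at h1
    have h3 := N.smul_mem (2⁻¹ : K) h1
    rwa [inv_smul_smul₀ two_ne_zero] at h3
  have hfe : ospE q f e ∈ N := by
    have h1 := hxe (ospE q f f)
    rw [p.ff_apply, p.pair, map_smul, LinearMap.smul_apply] at h1
    have h3 := N.smul_mem (2⁻¹ : K) h1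
    rwa [mul_one, inv_smul_smul₀ two_ne_zero] at h3
  refine p.eq_top_of_mem hq N (fun u => ?_) (fun x hx => hst _ x hx) fun α u _ x hx => hst _ x hx
  have h1 := hxe (ospE q u f)
  rw [p.ospE_right_apply_left, map_add, LinearMap.add_apply, map_smul, LinearMap.smul_apply] at h1
  exact (Submodule.add_mem_iff_left N (N.smul_mem _ hfe)).1 h1

end IsOddPair

end OddPair

/-! ### Existence of symplectic pairs -/

section OddPair

variable {K : Type*} [Field K] {V : Type*} [AddCommGroup V] [Module K V]
  {𝒱 : ZMod 2 → Submodule K V} [DirectSum.Decomposition 𝒱]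

theorem QuadForm.Nondegenerate.exists_isOddPair {q : QuadForm 𝒱} (hq : q.Nondegenerate)
    (h1 : 𝒱 1 ≠ ⊥) : ∃ e f, IsOddPair q e f := by
  obtain ⟨f, hf, hf0⟩ := Submodule.exists_mem_ne_zero_of_ne_bot h1
  have h2 : ∃ v ∈ 𝒱 1, q.bilin f v ≠ 0 := by
    by_contra! h
    refine hf0 (hq f fun v => ?_)
    rw [← sum_part 𝒱 v, map_sum]
    refine Finset.sum_eq_zero fun β _ => ?_
    rcases zmod_two_eq β with rfl | rfl
    · exact q.even 1 0 f hf _ (part_mem _ _ _) (by decide)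
    · exact h _ (part_mem _ _ _)
  obtain ⟨v, hv, hfv⟩ := h2
  exact ⟨(q.bilin f v)⁻¹ • v, f, Submodule.smul_mem _ _ hv, hf, by
    rw [map_smul, smul_eq_mul, inv_mul_cancel₀ hfv]⟩

end OddPair

section Derivations

variable {K : Type*} [Field K] [CharZero K] {V : Type*} [AddCommGroup V] [Module K V]
  {𝒱 : ZMod 2 → Submodule K V} [DirectSum.Decomposition 𝒱]

/-! ### Derivations of `osp q` -/

namespace IsOddPair

variable {q : QuadForm 𝒱} {e f : V} (p : IsOddPair q e f) {δ : ZMod 2} {D : Module.End K (osp q)}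
include p

/-- Once D kills h it preserves weights, hence scales E(e,e) and E(f,f). A multiple of ad h removes
the first scalar, and the bracket of the two removes the second. -/
theorem exists_inner_sl2 (hD : D ∈ derDeg (ospGrading q) (ospBracket q) δ) :
    ∃ z ∈ ospGrading q δ, (D + ospBracket q z) (ospE q e f) = 0 ∧
      (D + ospBracket q z) (ospE q e e) = 0 ∧ (D + ospBracket q z) (ospE q f f) = 0 := by
  have hskew : ∀ z, ospBracket q z (ospE q e f) = -ospBracket q (ospE q e f) z := by
    intro z
    have h0 : (ospE q e f).1 ∈ endGrading 𝒱 0 := p.h_mem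
    apply Subtype.ext
    rw [Submodule.coe_neg, ospBracket_coe, ospBracket_coe, superBracket_of_even_left 𝒱 h0,
      superBracket_of_even_right 𝒱 h0, neg_sub]
  obtain ⟨z, hz, hzh⟩ := (isLeibniz_osp q).exists_inner_apply_eq_zero p.injective p.h_mem
    p.isQuintic_bracket_h hskew hD
  have hD₁ := add_mem hD ((isLeibniz_osp q).ad_mem_derDeg hz)
  set D₁ := D + ospBracket q z with hD₁def
  have hcomm : ∀ x, ospBracket q (ospE q e f) (D₁ x) = D₁ (ospBracket q (ospE q e f) x) := by
    intro x
    rw [derDeg_bracket_even hD₁ p.h_mem, hzh, map_zero, LinearMap.zero_apply, zero_add]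
  obtain ⟨c, hc⟩ := p.exists_eq_smul_ee (x := D₁ (ospE q e e)) (by
    rw [hcomm, p.bracket_h_ee, map_smul])
  -- The factor 1/2 offsets the weight 2 of E(e,e). If D is odd, c E(e,e) is both even and odd, so c
  -- = 0 and the correction keeps the degree of D.
  have hcδ : (-(c / 2)) • ospE q e f ∈ ospGrading q δ := by
    rcases zmod_two_eq δ with rfl | rfl
    · exact Submodule.smul_mem _ _ p.h_mem
    · have h1 := hD₁.1 _ _ p.ee_mem
      rw [hc, add_zero] at h1
      have h2 := part_ne (ospGrading q) h1 (β := 0) (by decide)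
      rw [part_same _ (Submodule.smul_mem _ _ p.ee_mem)] at h2
      have h3 : c = 0 := (smul_eq_zero.1 h2).resolve_right p.ee_ne_zero
      rw [h3, zero_div, neg_zero, zero_smul]
      exact zero_mem _
  have hD₂ := add_mem hD₁ ((isLeibniz_osp q).ad_mem_derDeg hcδ)
  refine ⟨z + (-(c / 2)) • ospE q e f, add_mem hz hcδ, ?_⟩
  rw [map_add, ← add_assoc, ← hD₁def]
  set D₂ := D₁ + ospBracket q ((-(c / 2)) • ospE q e f) with hD₂def
  have h1 : D₂ (ospE q e f) = 0 := by
    rw [hD₂def, LinearMap.add_apply, hzh, map_smul, LinearMap.smul_apply, p.bracket_h_h, smul_zero,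
      add_zero]
  have h2 : D₂ (ospE q e e) = 0 := by
    rw [hD₂def, LinearMap.add_apply, hc, map_smul, LinearMap.smul_apply, p.bracket_h_ee]
    module
  refine ⟨h1, h2, ?_⟩
  -- Weight -2 for the pair (e, f) is weight 2 for the swapped pair (f, -e).
  have hff : ∃ c : K, D₂ (ospE q f f) = c • ospE q f f := by
    apply p.swap.exists_eq_smul_ee
    have h3 := derDeg_bracket_even hD₂ p.h_mem (ospE q f f)
    rw [p.bracket_h_ff, h1, map_zero, LinearMap.zero_apply, zero_add, map_neg, map_smul] at h3
    rw [map_neg, p.ospE_right_left, map_neg, LinearMap.neg_apply, ← h3, neg_neg]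
  obtain ⟨c', hc'⟩ := hff
  -- The bracket of E(e,e) and E(f,f) is -4h, on which D₂ vanishes, while the derivation rule gives
  -- c' times it.
  have h3 := derDeg_bracket_even hD₂ p.ee_mem (ospE q f f)
  rw [p.bracket_ee_ff, h2, map_zero, LinearMap.zero_apply, zero_add, hc', map_neg, map_smul, h1,
    smul_zero, neg_zero, map_smul, p.bracket_ee_ff, smul_neg, smul_smul, eq_comm, neg_eq_zero] at h3
  have h4 := (smul_eq_zero.1 h3).resolve_right p.h_ne_zero
  rw [hc', (mul_eq_zero.1 h4).resolve_right (by norm_num), zero_smul]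

/-- A derivation vanishing on `E e e`, `E f f`, `E e f` and all `E u e` with `u` orthogonal to `e` and
`f` is zero. -/
theorem derivation_eq_zero [Module.Finite K V] (hq : q.Nondegenerate)
    (hD : D ∈ derDeg (ospGrading q) (ospBracket q) δ) (hh : D (ospE q e f) = 0)
    (he : D (ospE q e e) = 0) (hf : D (ospE q f f) = 0)
    (hu : ∀ u, D (ospE q (u - (ospE q e f).1 ((ospE q e f).1 u)) e) = 0) : D = 0 := by
  rw [← LinearMap.ker_eq_top]
  have hue : ∀ u, D (ospE q u e) = 0 := by
    intro u
    rw [p.eq_proj_add u, sub_eq_add_neg _ (q.bilin e u • f), ← neg_smul, map_add, map_add,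
      map_smul, map_smul, LinearMap.add_apply, LinearMap.add_apply, LinearMap.smul_apply,
      LinearMap.smul_apply, map_add, map_add, map_smul, map_smul, hu, he, p.ospE_right_left, hh,
      smul_zero, smul_zero, add_zero, add_zero]
  refine p.eq_top_of_mem hq _ (fun u => hue u) (fun x hx => ?_) fun α u hu x hx => ?_
  · rw [LinearMap.mem_ker] at hx ⊢
    rw [derDeg_bracket_even hD p.ff_mem, hf, hx, map_zero, map_zero, LinearMap.zero_apply,
      add_zero]
  · rw [LinearMap.mem_ker] at hx ⊢
    rw [hD.2 _ _ (ospE_mem q hu p.left_mem), hue, hx, map_zero, map_zero, LinearMap.zero_apply,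
      smul_zero, add_zero]

theorem bilin_eq_zero_of_h {u : V} (hu : (ospE q e f).1 u = 0) :
    q.bilin e u = 0 ∧ q.bilin f u = 0 := by
  rw [p.h_apply] at hu
  have h1 := congrArg (q.bilin e) hu
  have h2 := congrArg (q.bilin f) hu
  simp only [map_add, map_smul, map_zero, p.pair, p.pair', p.left_self, p.right_self,
    smul_eq_mul] at h1 h2
  constructor
  · linear_combination -h1
  · linear_combination h2

/-- Two weight-1 elements bracket into the weight-2 line, and the coefficient recovers q on the
complement of e and f. -/
theorem bracket_ospE_left {α β : ZMod 2} {u v : V} (hu : u ∈ 𝒱 α) (hv : v ∈ 𝒱 β)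
    (hu0 : (ospE q e f).1 u = 0) (hv0 : (ospE q e f).1 v = 0) :
    ospBracket q (ospE q u e) (ospE q v e) = -((sgn 1 β • q.bilin u v) • ospE q e e) := by
  have h1 : (ospE q u e).1 v = -((sgn 1 β • q.bilin u v) • e) := by
    rw [ospE_apply q u p.left_mem hv, (p.bilin_eq_zero_of_h hv0).1, zero_smul, zero_sub, smul_assoc]
  have h2 : (ospE q u e).1 e = 0 := by
    rw [ospE_apply q u p.left_mem p.left_mem, p.left_self, q.bilin_odd_right p.left_mem,
      (p.bilin_eq_zero_of_h hu0).1, neg_zero, zero_smul, zero_smul, smul_zero, sub_zero]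
  rw [ospBracket_ospE q (ospE_mem q hu p.left_mem) hv]
  change ospE q ((ospE q u e).1 v) e + _ • ospE q v ((ospE q u e).1 e) = _
  rw [h1, h2, map_zero, smul_zero, add_zero, map_neg, LinearMap.neg_apply, map_smul,
    LinearMap.smul_apply]

theorem h_proj_apply (v : V) :
    (ospE q e f).1 (v - (ospE q e f).1 ((ospE q e f).1 v)) = 0 := by
  rw [map_sub, p.h_h_h_apply, sub_self]

theorem bilin_h_h_eq_zero {u : V} (hu : (ospE q e f).1 u = 0) (v : V) :
    q.bilin u ((ospE q e f).1 ((ospE q e f).1 v)) = 0 ∧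
      q.bilin ((ospE q e f).1 ((ospE q e f).1 v)) u = 0 := by
  obtain ⟨h1, h2⟩ := p.bilin_eq_zero_of_h hu
  rw [p.h_h_apply]
  constructor
  · rw [map_sub, map_smul, map_smul, q.bilin_odd_right p.left_mem, q.bilin_odd_right p.right_mem,
      h1, h2, neg_zero, smul_zero, smul_zero, sub_zero]
  · rw [map_sub, map_smul, map_smul, LinearMap.sub_apply, LinearMap.smul_apply,
      LinearMap.smul_apply, h1, h2, smul_zero, smul_zero, sub_zero]

/-- A derivation vanishing on `E e e`, `E f f` and `E e f` is inner. -/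
theorem mem_inner [Module.Finite K V] (hq : q.Nondegenerate)
    (hD : D ∈ derDeg (ospGrading q) (ospBracket q) δ) (hh : D (ospE q e f) = 0)
    (he : D (ospE q e e) = 0) (hf : D (ospE q f f) = 0) :
    D ∈ inner (ospBracket q) := by
  have hhdeg : (ospE q e f).1 ∈ endGrading 𝒱 0 := p.h_mem
  let P : Module.End K V := LinearMap.id - (ospE q e f).1 * (ospE q e f).1
  have hP : ∀ v, P v = v - (ospE q e f).1 ((ospE q e f).1 v) := fun v => rfl
  have hPdeg : ∀ α, ∀ v ∈ 𝒱 α, P v ∈ 𝒱 α := by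
    intro α v hv
    have h1 := hhdeg _ _ (hhdeg _ _ hv)
    rw [zero_add, zero_add] at h1
    exact sub_mem hv h1
  have hhP : ∀ v, (ospE q e f).1 (P v) = 0 := p.h_proj_apply
  -- A weight-1 element x equals E(-(x f), e), so the action of D on weight 1 is read off by
  -- evaluating at f. Precomposing with P makes t vanish on e and f.
  let t : Module.End K V :=
    -(LinearMap.applyₗ f ∘ₗ (osp q).subtype ∘ₗ D ∘ₗ (ospE q).flip e ∘ₗ P)
  have ht : ∀ v, t v = -((D (ospE q (P v) e)).1 f) := fun v => rfl
  have hwt : ∀ v, ospBracket q (ospE q e f) (D (ospE q (P v) e)) = D (ospE q (P v) e) := by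
    intro v
    have h1 := derDeg_bracket_even hD p.h_mem (ospE q (P v) e)
    rw [hh, map_zero, LinearMap.zero_apply, zero_add, p.bracket_h_ospE, hhP, map_zero,
      LinearMap.zero_apply, zero_add, p.h_left] at h1
    exact h1.symm
  have hDt : ∀ v, D (ospE q (P v) e) = ospE q (t v) e := fun v =>
    (p.eq_ospE_of_weight_one (hwt v)).1
  have hht : ∀ v, (ospE q e f).1 (t v) = 0 := by
    intro v
    rw [ht, map_neg, (p.eq_ospE_of_weight_one (hwt v)).2, neg_zero]
  have hPe : P e = 0 := by rw [hP, p.h_left, p.h_left, sub_self]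
  have hPf : P f = 0 := by rw [hP, p.h_right, map_neg, p.h_right, neg_neg, sub_self]
  have hte : t e = 0 := by
    rw [ht, hPe, map_zero, LinearMap.zero_apply, map_zero, Submodule.coe_zero,
      LinearMap.zero_apply, neg_zero]
  have htf : t f = 0 := by
    rw [ht, hPf, map_zero, LinearMap.zero_apply, map_zero, Submodule.coe_zero,
      LinearMap.zero_apply, neg_zero]
  have hPP : ∀ v, P (P v) = P v := by
    intro v
    rw [hP (P v), hhP, map_zero, sub_zero]
  have htP : ∀ v, t (P v) = t v := by
    intro v
    rw [ht, ht, hPP]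
  have htdeg : t ∈ endGrading 𝒱 δ := by
    intro α v hv
    have h1 : (D (ospE q (P v) e)).1 ∈ endGrading 𝒱 (δ + (α + 1)) :=
      hD.1 _ _ (ospE_mem q (hPdeg α v hv) p.left_mem)
    have h2 := h1 _ _ p.right_mem
    have h3 : ∀ α δ : ZMod 2, δ + (α + 1) + 1 = δ + α := by decide
    rw [h3] at h2
    exact neg_mem h2
  -- D kills E(e,e), hence the bracket of E(P u, e) and E(P v, e), whose coefficient is ±q(P u, P
  -- v). Comparing coefficients after the derivation rule is the skewness of t.
  have htosp : t ∈ osp q := by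
    rw [osp_homogeneous q htdeg]
    intro α β u hu v hv
    have h1 : q.bilin (t u) v = q.bilin (t u) (P v) := by
      rw [hP, map_sub, (p.bilin_h_h_eq_zero (hht u) v).1, sub_zero]
    have h2 : q.bilin u (t v) = q.bilin (P u) (t v) := by
      rw [hP, map_sub, LinearMap.sub_apply, (p.bilin_h_h_eq_zero (hht v) u).2, sub_zero]
    rw [h1, h2]
    have h3 := hD.2 _ _ (ospE_mem q (hPdeg α u hu) p.left_mem) (ospE q (P v) e)
    rw [p.bracket_ospE_left (hPdeg α u hu) (hPdeg β v hv) (hhP u) (hhP v), hDt, hDt,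
      p.bracket_ospE_left (htdeg _ _ hu) (hPdeg β v hv) (hht u) (hhP v),
      p.bracket_ospE_left (hPdeg α u hu) (htdeg _ _ hv) (hhP u) (hht v), map_neg, map_smul, he,
      smul_zero, neg_zero] at h3
    have h4 : (sgn 1 β • q.bilin (t u) (P v) +
        sgn δ (α + 1) • sgn 1 (δ + β) • q.bilin (P u) (t v)) • ospE q e e = 0 := by
      rw [add_smul, ← neg_eq_zero, h3, smul_neg, neg_add, smul_assoc (sgn δ (α + 1))]
    have h5 := (smul_eq_zero.1 h4).resolve_right p.ee_ne_zero
    have h6 := congrArg (sgn 1 β • ·) h5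
    have e1 : ∀ α β δ : ZMod 2, sgn 1 β * (sgn δ (α + 1) * sgn 1 (δ + β)) = sgn δ α := by decide
    simp only [smul_add, smul_smul, sgn_mul_self, one_smul, e1, smul_zero] at h6
    exact h6
  have htdeg' : (⟨t, htosp⟩ : osp q) ∈ ospGrading q δ := htdeg
  have hbr : ∀ α, ∀ u ∈ 𝒱 α, ∀ v, t v = 0 →
      ospBracket q ⟨t, htosp⟩ (ospE q u v) = ospE q (t u) v := by
    intro α u hu v hv
    rw [ospBracket_ospE q htdeg' hu]
    change _ + _ • ospE q u (t v) = _
    rw [hv, map_zero, smul_zero, add_zero]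
  have hbr0 : ∀ u ∈ 𝒱 1, t u = 0 → ∀ v, t v = 0 →
      ospBracket q ⟨t, htosp⟩ (ospE q u v) = 0 := by
    intro u hu hu0 v hv
    rw [hbr 1 u hu v hv, hu0, map_zero, LinearMap.zero_apply]
  -- D and ad t agree on the sl₂, where both vanish, and on the weight-1 space, and this determines
  -- a derivation.
  refine mem_inner_of_add_ad_neg_eq_zero (t := ⟨t, htosp⟩) (p.derivation_eq_zero hq
    (add_mem hD ((isLeibniz_osp q).ad_mem_derDeg (neg_mem htdeg')))
    (add_ad_neg_apply_eq_zero ?_) (add_ad_neg_apply_eq_zero ?_) (add_ad_neg_apply_eq_zero ?_)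
    fun u => add_ad_neg_apply_eq_zero ?_)
  · rw [hh, hbr0 _ p.left_mem hte _ htf]
  · rw [he, hbr0 _ p.left_mem hte _ hte]
  · rw [hf, hbr0 _ p.right_mem htf _ htf]
  · rw [← hP u, hDt, ← sum_part 𝒱 u]
    simp only [map_sum, LinearMap.sum_apply]
    refine Finset.sum_congr rfl fun α _ => ?_
    rw [hbr α _ (hPdeg α _ (part_mem 𝒱 α u)) e hte, htP]

theorem isCompleteCentral [Module.Finite K V] (hq : q.Nondegenerate) :
    IsCompleteCentral (ospGrading q) (ospBracket q) where
  toIsLeibniz := isLeibniz_osp q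
  injective := p.injective
  derDeg_le := by
    intro α D hD
    obtain ⟨z, hz, h1, h2, h3⟩ := p.exists_inner_sl2 hD
    exact mem_inner_of_add_mem
      (p.mem_inner hq (add_mem hD ((isLeibniz_osp q).ad_mem_derDeg hz)) h1 h2 h3)
  centroid := p.centroid hq
  even_nonabelian := by
    refine ⟨_, p.h_mem, _, p.ee_mem, ?_⟩
    rw [p.bracket_h_ee]
    exact smul_ne_zero two_ne_zero p.ee_ne_zero

end IsOddPair

theorem IsOspForm.isCompleteCentral {q : QuadForm 𝒱} {M N : ℕ} (hq : IsOspForm q M N)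
    (hN : 0 < N) : IsCompleteCentral (ospGrading q) (ospBracket q) := by
  have := hq.finite
  obtain ⟨e, f, p⟩ := hq.nondegenerate.exists_isOddPair (by
    intro h
    have h1 := hq.finrank_odd
    rw [h, finrank_bot] at h1
    omega)
  exact p.isCompleteCentral hq.nondegenerate

end Derivations

section Symplectic

variable {K : Type*} [Field K] {V : Type*} [AddCommGroup V] [Module K V]
  {W : Type*} [AddCommGroup W] [Module K W]

/-! ### Classification of alternating forms -/

/-- A symplectic family of vectors for a bilinear form. -/
structure IsSymplecticFamily (B : V →ₗ[K] V →ₗ[K] K) {k : ℕ} (b : Fin k ⊕ Fin k → V) : Prop where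
  gram : ∀ i j, B (b i) (b j) = Matrix.J (Fin k) K i j

/-- The Gram matrix J is invertible, since J² = -1. -/
theorem IsSymplecticFamily.linearIndependent {B : V →ₗ[K] V →ₗ[K] K} {k : ℕ}
    {b : Fin k ⊕ Fin k → V} (h : IsSymplecticFamily B b) : LinearIndependent K b := by
  rw [Fintype.linearIndependent_iff]
  intro c hc
  have h1 : Matrix.vecMul c (Matrix.J (Fin k) K) = 0 := by
    ext j
    have := congrArg (fun v => B v (b j)) hc
    simp only [map_sum, map_smul, LinearMap.sum_apply, LinearMap.smul_apply, h.gram, map_zero,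
      LinearMap.zero_apply, smul_eq_mul] at this
    exact this
  have h2 := congrArg (fun v => Matrix.vecMul v (Matrix.J (Fin k) K)) h1
  simp only [Matrix.vecMul_vecMul, Matrix.J_squared, Matrix.zero_vecMul, Matrix.vecMul_neg,
    Matrix.vecMul_one] at h2
  intro i
  have := congrFun h2 i
  simpa using this

/-- Symplectic Gram–Schmidt: project a vector outside the span of the family to its complement, and
do the same with a partner supplied by nondegeneracy. -/
theorem exists_isSymplecticFamily [Module.Finite K V] (B : V →ₗ[K] V →ₗ[K] K) (hB : B.IsAlt)
    (hnd : ∀ u, (∀ v, B u v = 0) → u = 0) (k : ℕ) (hk : 2 * k ≤ Module.finrank K V) :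
    ∃ b : Fin k ⊕ Fin k → V, IsSymplecticFamily B b := by
  induction k with
  | zero => exact ⟨fun _ => 0, ⟨by rintro (i | i) <;> exact i.elim0⟩⟩
  | succ k ih =>
    obtain ⟨b, hb⟩ := ih (by omega)
    have hneg : ∀ x y, B y x = -B x y := fun x y => (hB.neg x y).symm
    have hproj : ∀ v, ∃ w ∈ Submodule.span K (Set.range b), ∀ i, B (v - w) (b i) = 0 := by
      intro v
      -- The coefficients of the projection are the values B(v, b_i) times the inverse Gram matrix
      -- J⁻¹ = -J.
      refine ⟨∑ j, Matrix.vecMul (fun i => -B v (b i)) (Matrix.J (Fin k) K) j • b j,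
        sum_mem fun j _ => Submodule.smul_mem _ _ (Submodule.subset_span ⟨j, rfl⟩), fun i => ?_⟩
      simp only [map_sub, map_sum, map_smul, LinearMap.sub_apply, LinearMap.sum_apply,
        LinearMap.smul_apply, hb.gram, smul_eq_mul]
      change B v (b i) - Matrix.vecMul (Matrix.vecMul (fun i => -B v (b i)) (Matrix.J (Fin k) K))
        (Matrix.J (Fin k) K) i = 0
      rw [Matrix.vecMul_vecMul, Matrix.J_squared, Matrix.vecMul_neg, Matrix.vecMul_one,
        Pi.neg_apply, neg_neg, sub_self]
    have hspan : ∀ u, (∀ i, B u (b i) = 0) → ∀ w ∈ Submodule.span K (Set.range b), B u w = 0 := by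
      intro u hu w hw
      induction hw using Submodule.span_induction with
      | mem w hw =>
        obtain ⟨i, rfl⟩ := hw
        exact hu i
      | zero => rw [map_zero]
      | add w w' _ _ hw hw' => rw [map_add, hw, hw', add_zero]
      | smul c w _ hw => rw [map_smul, hw, smul_zero]
    obtain ⟨v, hv⟩ : ∃ v, v ∉ Submodule.span K (Set.range b) := by
      by_contra! h
      have h1 : Submodule.span K (Set.range b) = ⊤ := eq_top_iff.2 fun v _ => h v
      have h2 := finrank_range_le_card (R := K) b
      rw [Set.finrank, h1, finrank_top] at h2
      simp only [Fintype.card_sum, Fintype.card_fin] at h2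
      omega
    obtain ⟨w, hw, hvw⟩ := hproj v
    set e := v - w with he
    have he0 : e ≠ 0 := fun h => hv (by rwa [sub_eq_zero.1 h])
    obtain ⟨x, hx⟩ : ∃ x, B e x ≠ 0 := by
      by_contra! h
      exact he0 (hnd e h)
    obtain ⟨y, hy, hxy⟩ := hproj x
    have hxy' : B e (x - y) = B e x := by rw [map_sub, hspan e hvw y hy, sub_zero]
    -- The normalisation B(e, f) = -1 matches `Matrix.J`, whose upper right block is -1.
    set f := (-(B e x)⁻¹) • (x - y) with hf
    have hef : B e f = -1 := by
      rw [hf, map_smul, hxy', smul_eq_mul, neg_mul, inv_mul_cancel₀ hx]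
    have hfb : ∀ i, B f (b i) = 0 := by
      intro i
      rw [hf, map_smul, LinearMap.smul_apply, hxy, smul_zero]
    refine ⟨Sum.elim (Fin.cons e (b ∘ Sum.inl)) (Fin.cons f (b ∘ Sum.inr)), ⟨?_⟩⟩
    have hbe : ∀ i, B (b i) e = 0 := fun i => by rw [hneg e, hvw, neg_zero]
    have hbf : ∀ i, B (b i) f = 0 := fun i => by rw [hneg f, hfb, neg_zero]
    have hfe : B f e = 1 := by rw [hneg e, hef, neg_neg]
    rintro (i | i) (j | j) <;> refine Fin.cases ?_ (fun i => ?_) i <;>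
      refine Fin.cases ?_ (fun j => ?_) j <;>
      simp [Matrix.J, hb.gram, hvw, hfb, hbe, hbf, hef, hfe, hB.self_eq_zero, Matrix.one_apply,
        Fin.succ_ne_zero, (Fin.succ_ne_zero _).symm]

theorem exists_isometry_of_isAlt [Module.Finite K V] [Module.Finite K W]
    (B : V →ₗ[K] V →ₗ[K] K) (hB : B.IsAlt) (hnd : ∀ u, (∀ v, B u v = 0) → u = 0)
    (C : W →ₗ[K] W →ₗ[K] K) (hC : C.IsAlt) (hnd' : ∀ u, (∀ v, C u v = 0) → u = 0) {n : ℕ}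
    (hV : Module.finrank K V = 2 * n) (hW : Module.finrank K W = 2 * n) :
    ∃ φ : V ≃ₗ[K] W, ∀ u v, C (φ u) (φ v) = B u v := by
  obtain ⟨b, hb⟩ := exists_isSymplecticFamily B hB hnd n hV.ge
  obtain ⟨c, hc⟩ := exists_isSymplecticFamily C hC hnd' n hW.ge
  -- Dimension zero is separate because building a basis from an independent family requires a
  -- nonempty index type.
  rcases Nat.eq_zero_or_pos n with rfl | hn
  · have : Subsingleton V := Module.finrank_zero_iff.1 hV
    exact ⟨LinearEquiv.ofFinrankEq V W (hV.trans hW.symm), fun u v => by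
      rw [Subsingleton.elim u 0, map_zero, map_zero, map_zero, LinearMap.zero_apply,
        LinearMap.zero_apply]⟩
  have : Nonempty (Fin n ⊕ Fin n) := ⟨Sum.inl ⟨0, hn⟩⟩
  let b' := basisOfLinearIndependentOfCardEqFinrank hb.linearIndependent (by
    rw [hV, Fintype.card_sum, Fintype.card_fin]; omega)
  let c' := basisOfLinearIndependentOfCardEqFinrank hc.linearIndependent (by
    rw [hW, Fintype.card_sum, Fintype.card_fin]; omega)
  let φ := b'.equiv c' (Equiv.refl _)
  have key : C.compl₁₂ φ.toLinearMap φ.toLinearMap = B := by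
    refine b'.ext fun i => b'.ext fun j => ?_
    simp only [LinearMap.compl₁₂_apply, LinearEquiv.coe_coe, φ, Module.Basis.equiv_apply,
      Equiv.refl_apply]
    simp only [b', c', coe_basisOfLinearIndependentOfCardEqFinrank, hb.gram, hc.gram]
  exact ⟨φ, fun u v => LinearMap.congr_fun₂ key u v⟩

/-! ### Classification of symmetric forms -/

/-- Over an algebraically closed field both quadratic forms are equivalent to the same sum of
squares; polarisation returns to the bilinear forms. -/
theorem exists_isometry_of_isSymm [IsAlgClosed K] [CharZero K] [Module.Finite K V]
    [Module.Finite K W] (B : V →ₗ[K] V →ₗ[K] K) (hB : ∀ u v, B u v = B v u)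
    (hnd : ∀ u, (∀ v, B u v = 0) → u = 0) (C : W →ₗ[K] W →ₗ[K] K) (hC : ∀ u v, C u v = C v u)
    (hnd' : ∀ u, (∀ v, C u v = 0) → u = 0) (h : Module.finrank K V = Module.finrank K W) :
    ∃ φ : V ≃ₗ[K] W, ∀ u v, C (φ u) (φ v) = B u v := by
  have : Invertible (2 : K) := invertibleOfNonzero two_ne_zero
  have hBa : QuadraticMap.associated (LinearMap.BilinMap.toQuadraticMap B) = B :=
    QuadraticMap.associated_left_inverse K hB
  have hCa : QuadraticMap.associated (LinearMap.BilinMap.toQuadraticMap C) = C :=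
    QuadraticMap.associated_left_inverse K hC
  have h1 := QuadraticForm.equivalent_weightedSumSquares_of_isAlgClosed
    (LinearMap.BilinMap.toQuadraticMap B) (by rw [hBa]; exact hnd)
  have h2 := QuadraticForm.equivalent_weightedSumSquares_of_isAlgClosed
    (LinearMap.BilinMap.toQuadraticMap C) (by rw [hCa]; exact hnd')
  rw [← h] at h2
  obtain ⟨φ⟩ := h1.trans h2.symm
  refine ⟨φ.toLinearEquiv, fun u v => ?_⟩
  have h3 : ∀ u, C (φ u) (φ u) = B u u := fun u => φ.map_app u
  have h4 := h3 (u + v)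
  have h5 : φ (u + v) = φ u + φ v := map_add φ.toLinearEquiv u v
  rw [h5] at h4
  simp only [map_add, LinearMap.add_apply, h3, hC (φ v) (φ u), hB v u] at h4
  change C (φ u) (φ v) = _
  linear_combination (1 / 2 : K) * h4

end Symplectic

section Classification

variable {K : Type*} [Field K] {V : Type*} [AddCommGroup V] [Module K V]
  {𝒱 : ZMod 2 → Submodule K V} {W : Type*} [AddCommGroup W] [Module K W]
  {𝒲 : ZMod 2 → Submodule K W}

theorem IsIsometry.conj_mem_osp {q : QuadForm 𝒱} {r : QuadForm 𝒲} {φ : V ≃ₗ[K] W}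
    (h : IsIsometry q r φ) {x : Module.End K V} (hx : x ∈ osp q)
    (h' : ∀ α, ∀ w ∈ 𝒲 α, φ.symm w ∈ 𝒱 α) : φ.conj x ∈ osp r := by
  intro α β u hu v hv
  have h1 := hx α β _ (h' α u hu) _ (h' β v hv)
  rw [← h.isometry, ← h.isometry] at h1
  simpa only [LinearEquiv.apply_symm_apply, LinearEquiv.conj_apply_apply] using h1

variable [DirectSum.Decomposition 𝒱] [DirectSum.Decomposition 𝒲]

/-! ### Classification of quadratic forms on super vector spaces -/

theorem exists_gradedEquiv (φ : ∀ α, 𝒱 α ≃ₗ[K] 𝒲 α) :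
    ∃ ψ : V ≃ₗ[K] W, ∀ α, ∀ v : 𝒱 α, ψ v = φ α v := by
  classical
  refine ⟨(DirectSum.decomposeLinearEquiv 𝒱).trans
    ((DFinsupp.mapRange.linearEquiv φ).trans (DirectSum.decomposeLinearEquiv 𝒲).symm),
    fun α v => ?_⟩
  simp only [LinearEquiv.trans_apply, DirectSum.decomposeLinearEquiv_apply,
    DirectSum.decompose_coe]
  rw [LinearEquiv.symm_apply_eq, DirectSum.decomposeLinearEquiv_apply, DirectSum.decompose_coe]
  exact DFinsupp.mapRange_single (hf := fun i => map_zero (φ i))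

theorem exists_isIsometry_of_parts {q : QuadForm 𝒱} {r : QuadForm 𝒲}
    (h : ∀ α, ∃ φ : 𝒱 α ≃ₗ[K] 𝒲 α, ∀ u v : 𝒱 α, r.bilin (φ u) (φ v) = q.bilin u v) :
    ∃ φ : V ≃ₗ[K] W, IsIsometry q r φ := by
  choose φ hφ using h
  obtain ⟨ψ, hψ⟩ := exists_gradedEquiv φ
  have heven : ∀ α, ∀ v ∈ 𝒱 α, ψ v ∈ 𝒲 α := by
    intro α v hv
    rw [hψ α ⟨v, hv⟩]
    exact (φ α ⟨v, hv⟩).2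
  refine ⟨ψ, heven, fun u v => ?_⟩
  have key : r.bilin.compl₁₂ ψ.toLinearMap ψ.toLinearMap = q.bilin := by
    refine end_ext 𝒱 fun α u hu => end_ext 𝒱 fun β v hv => ?_
    simp only [LinearMap.compl₁₂_apply, LinearEquiv.coe_coe]
    by_cases h : α = β
    · subst h
      have h1 := hφ α ⟨u, hu⟩ ⟨v, hv⟩
      rw [← hψ α ⟨u, hu⟩, ← hψ α ⟨v, hv⟩] at h1
      exact h1
    · rw [q.even _ _ _ hu _ hv h, r.even _ _ _ (heven _ _ hu) _ (heven _ _ hv) h]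
  exact LinearMap.congr_fun₂ key u v

theorem QuadForm.Nondegenerate.restrict {q : QuadForm 𝒱} (hq : q.Nondegenerate) (α : ZMod 2)
    (u : 𝒱 α) (hu : ∀ v : 𝒱 α, q.bilin u v = 0) : u = 0 := by
  refine Subtype.ext (hq u fun v => ?_)
  rw [← sum_part 𝒱 v, map_sum]
  refine Finset.sum_eq_zero fun β _ => ?_
  by_cases h : α = β
  · subst h
    exact hu ⟨_, part_mem 𝒱 α v⟩
  · exact q.even α β _ u.2 _ (part_mem _ _ _) h

theorem QuadForm.isAlt_odd [CharZero K] (q : QuadForm 𝒱) :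
    (q.bilin.domRestrict₁₂ (𝒱 1) (𝒱 1)).IsAlt := by
  intro u
  have h1 := q.bilin_odd_right u.2 u
  rw [LinearMap.domRestrict₁₂_apply]
  linear_combination (1 / 2 : K) * h1

theorem IsOspForm.exists_isIsometry [IsAlgClosed K] [CharZero K] {q : QuadForm 𝒱}
    {r : QuadForm 𝒲} {M n : ℕ} (hq : IsOspForm q M (2 * n)) (hr : IsOspForm r M (2 * n)) :
    ∃ φ : V ≃ₗ[K] W, IsIsometry q r φ := by
  have := hq.finite
  have := hr.finite
  refine exists_isIsometry_of_parts fun α => ?_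
  rcases zmod_two_eq α with rfl | rfl
  · exact exists_isometry_of_isSymm (q.bilin.domRestrict₁₂ (𝒱 0) (𝒱 0))
      (fun u v => by
        simpa only [sgn_zero_left, one_smul, LinearMap.domRestrict₁₂_apply] using
          q.supersymm 0 0 u u.2 v v.2)
      (hq.nondegenerate.restrict 0) (r.bilin.domRestrict₁₂ (𝒲 0) (𝒲 0))
      (fun u v => by
        simpa only [sgn_zero_left, one_smul, LinearMap.domRestrict₁₂_apply] using
          r.supersymm 0 0 u u.2 v v.2)
      (hr.nondegenerate.restrict 0) (hq.finrank_even.trans hr.finrank_even.symm)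
  · exact exists_isometry_of_isAlt _ q.isAlt_odd (hq.nondegenerate.restrict 1) _ r.isAlt_odd
      (hr.nondegenerate.restrict 1) hq.finrank_odd hr.finrank_odd

theorem IsIsometry.symm {q : QuadForm 𝒱} {r : QuadForm 𝒲} {φ : V ≃ₗ[K] W}
    (h : IsIsometry q r φ) : IsIsometry r q φ.symm where
  even := by
    intro α w hw
    -- An even map commutes with the projections to homogeneous parts, so its inverse is even too.
    have h1 := apply_part 𝒱 𝒲 (α := 0) φ.toLinearMap
      (fun β v hv => by rw [zero_add]; exact h.even β v hv) α (φ.symm w)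
    simp only [LinearEquiv.coe_coe, LinearEquiv.apply_symm_apply, zero_add] at h1
    rw [part_same _ hw] at h1
    rw [← h1, LinearEquiv.symm_apply_apply]
    exact part_mem _ _ _
  isometry u v := by
    rw [← h.isometry, LinearEquiv.apply_symm_apply, LinearEquiv.apply_symm_apply]

theorem IsIsometry.osp_eq {q : QuadForm 𝒱} {r : QuadForm 𝒲} {φ : V ≃ₗ[K] W}
    (h : IsIsometry q r φ) :
    (osp r : Set (Module.End K W)) = φ.conj '' (osp q : Set (Module.End K V)) := by
  ext x
  constructor
  · intro hx
    exact ⟨φ.symm.conj x, h.symm.conj_mem_osp hx (by simpa using h.even), LinearMap.ext fun v => by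
      simp⟩
  · rintro ⟨y, hy, rfl⟩
    exact h.conj_mem_osp hy h.symm.even

end Classification

/-! ### Part (1) for an arbitrary nondegenerate form -/

theorem IsOspForm.eospIsOsp {K : Type u} [Field K] [IsAlgClosed K] [CharZero K] {V : Type w}
    [AddCommGroup V] [Module K V] {𝒱 : ZMod 2 → Submodule K V} [DirectSum.Decomposition 𝒱]
    {q : QuadForm 𝒱} {M n : ℕ} (hq : IsOspForm q M (2 * n)) :
    EospIsOsp.{u, v, w} q M (2 * n) where
  isOspForm := hq
  eosp_eq := by
    have := hq.finite
    exact hq.nondegenerate.eosp_eq two_ne_zero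
  unique W _ _ 𝒲 _ r hr := by
    have := hq.finite
    obtain ⟨φ, hφ⟩ := hq.exists_isIsometry hr
    refine ⟨φ, hφ, ?_⟩
    rw [hq.nondegenerate.eosp_eq two_ne_zero, hφ.osp_eq]
    rfl

section Standard

variable (K : Type*) [Field K]

/-! ### The standard forms -/

theorem finrank_coordGrading {ι : Type*} [Fintype ι] (p : ι → ZMod 2) (α : ZMod 2) :
    Module.finrank K (coordGrading K p α) = Fintype.card {i // p i = α} := by
  let e : coordGrading K p α ≃ₗ[K] ({i // p i = α} → K) :=
    { toFun := fun v i => v.1 i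
      map_add' := fun _ _ => rfl
      map_smul' := fun _ _ => rfl
      invFun := fun v => ⟨fun i => if h : p i = α then v ⟨i, h⟩ else 0, fun i hi => dif_neg hi⟩
      left_inv := by
        intro v
        refine Subtype.ext (funext fun i => ?_)
        by_cases h : p i = α
        · simp [h]
        · simp [h, v.2 i h]
      right_inv := by
        intro v
        funext i
        simp [i.2] }
  rw [e.finrank_eq, Module.finrank_pi]

variable {K}

theorem gramForm_nondegenerate {ι : Type*} [Fintype ι] [DecidableEq ι] {p : ι → ZMod 2}
    {G : Matrix ι ι K} {heven : ∀ i j, p i ≠ p j → G i j = 0}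
    {hsymm : ∀ i j, G i j = sgn (p i) (p j) • G j i} (G' : Matrix ι ι K) (hG : G * G' = 1) :
    (gramForm p G heven hsymm).Nondegenerate := by
  intro u hu
  have h1 : Matrix.vecMul u G = 0 := by
    ext j
    have h2 := hu (Pi.single j 1)
    simp only [gramForm, Matrix.toLinearMap₂'_apply'] at h2
    rw [Matrix.dotProduct_mulVec, dotProduct_single_one] at h2
    exact h2
  rw [← Matrix.vecMul_one u, ← hG, ← Matrix.vecMul_vecMul, h1, Matrix.zero_vecMul]

theorem hypGram_mul (m n : ℕ) : hypGram K m n *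
    Matrix.fromBlocks (Matrix.fromBlocks 0 1 1 0) 0 0 (Matrix.fromBlocks 0 (-1) 1 0) = 1 := by
  simp [hypGram, Matrix.fromBlocks_multiply]

theorem isOspForm_hypForm (m n : ℕ) : IsOspForm (hypForm K m n) (2 * m) (2 * n) where
  finite := inferInstance
  nondegenerate := gramForm_nondegenerate _ (hypGram_mul m n)
  finrank_even := by
    rw [finrank_coordGrading, Fintype.card_subtype, Finset.card_filter]
    simp [hypParity, two_mul]
  finrank_odd := by
    rw [finrank_coordGrading, Fintype.card_subtype, Finset.card_filter]
    simp [hypParity, two_mul]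

theorem isOspForm_hypFormPlus (m n : ℕ) :
    IsOspForm (hypFormPlus K m n) (2 * m + 1) (2 * n) where
  finite := inferInstance
  nondegenerate := gramForm_nondegenerate (Matrix.fromBlocks
    (Matrix.fromBlocks (Matrix.fromBlocks 0 1 1 0) 0 0 (Matrix.fromBlocks 0 (-1) 1 0)) 0 0 1) (by
    simp [Matrix.fromBlocks_multiply, hypGram_mul])
  finrank_even := by
    rw [finrank_coordGrading, Fintype.card_subtype, Finset.card_filter]
    simp [hypParity, two_mul]
  finrank_odd := by
    rw [finrank_coordGrading, Fintype.card_subtype, Finset.card_filter]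
    simp [hypParity, two_mul]

end Standard

end Super

/-! ### The main theorem -/

theorem corollary4p12 {K : Type u} [Field K] [IsAlgClosed K] [CharZero K] (m n : ℕ)
    (hm : 0 < m) (hn : 0 < n) :
    (Super.EospIsOsp.{u, v, u} (Super.hypForm K m n) (2 * m) (2 * n) ∧
      Super.EospIsOsp.{u, v, u} (Super.hypFormPlus K m n) (2 * m + 1) (2 * n)) ∧
    ∀ (V : Type v) [AddCommGroup V] [Module K V] (𝒱 : ZMod 2 → Submodule K V)
      [DirectSum.Decomposition 𝒱] (q : Super.QuadForm 𝒱), Super.IsOspForm q m (2 * n) →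
      (∀ (A : Type w) [Ring A] [Algebra K A] (𝒜 : ZMod 2 → Submodule K A) [GradedAlgebra 𝒜],
        Super.Supercommutative 𝒜 →
        Super.IsSemidirect
          (Super.tensorGrading (Super.ospGrading q) 𝒜)
          (Super.der (Super.tensorGrading (Super.ospGrading q) 𝒜)
            (Super.tensorBracket (Super.ospGrading q) 𝒜 (Super.ospBracket q)))
          (Super.inner (Super.tensorBracket (Super.ospGrading q) 𝒜 (Super.ospBracket q)))
          ((Super.der 𝒜 (LinearMap.mul K A)).map
            (Super.tensorLift (Super.ospGrading q) 𝒜)) ∧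
        Super.IsEmbedding 𝒜 (Super.der 𝒜 (LinearMap.mul K A))
          (Super.tensorGrading (Super.ospGrading q) 𝒜)
          (Super.tensorLift (Super.ospGrading q) 𝒜)) ∧
      Super.der (Super.ospGrading q) (Super.ospBracket q) =
        Super.inner (Super.ospBracket q) := by
  refine ⟨⟨(Super.isOspForm_hypForm m n).eospIsOsp,
    (Super.isOspForm_hypFormPlus m n).eospIsOsp⟩, ?_⟩
  intro V _ _ 𝒱 _ q hq
  have := hq.finite
  have h := hq.isCompleteCentral (by omega)
  refine ⟨fun A _ _ 𝒜 _ h𝒜 => ⟨h.isSemidirect 𝒜 h𝒜, h.isEmbedding 𝒜⟩, ?_⟩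
  exact le_antisymm (iSup_le h.derDeg_le) h.toIsLeibniz.inner_le_der
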